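/- Let $Y$ be a smooth compact connected manifold (without boundary) of dimension $n$, let $Z$ be a smooth Anosov vector field on $Y$ with flow $\varphi_t$, and let $F$ be a complex flat vector bundle of finite rank on $Y$. Thus $Z$ vanishes nowhere and there is a $\varphi_t$-invariant splitting $TY=\mathbb{R}Z\oplus T_uY\oplus T_sY$ such that, for some Riemannian metric and some $C,\theta>0$, for all $t\ge 0$ one has $|\varphi_{t*}v|\le Ce^{-\theta t}|v|$ for $v\in T_sY$ and $|\varphi_{-t*}v|\le Ce^{-\theta t}|v|$ for $v\in T_uY$. Put $n_s=\dim T_sY$. For a vector bundle $E$, let $\mathrm{o}(E)$ denote its orientation bundle, a $\mathbb{Z}_2$-bundle; $\mathrm{o}(TY)$ is flat, and $F^*\otimes_{\mathbb{Z}_2}\mathrm{o}(TY)$ is again a complex flat vector bundle. The flow lifts to $F$ by parallel transport along its trajectories, and acts on $\mathrm{o}(T_sY)$ through the action of $\varphi_{t*}$ on $T_sY$. Let $\underline{\mathbf{F}}$ be the set of points $y\in Y$ with $\varphi_{-t}(y)=y$ for some $t>0$, taken modulo the flow (the set of primitive closed trajectories), and for $y\in\underline{\mathbf F}$ let $t_y>0$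 be the smallest such $t$. The Fried zeta function is $$R_{Z,F}(\sigma)=\prod_{y\in\underline{\mathbf{F}}}\Big[\det\big(1-e^{-t_y\sigma}\varphi_{t_y*}\big)\big|_{(F\otimes_{\mathbb{Z}_2}\mathrm{o}(T_sY))_y}\Big]^{(-1)^{n_s+1}} .$$ Then there is $c\in\mathbb{R}$ such that for all $\sigma\in\mathbb{C}$ with $\mathrm{Re}\,\sigma>c$ the infinite products $R_{Z,F}(\sigma)$ and $R_{-Z,F^*\otimes_{\mathbb{Z}_2}\mathrm{o}(TY)}(\sigma)$ converge (unconditionally), the latter is nonzero, and $$R_{Z,F}(\sigma)=\Big[R_{-Z,\,F^{*}\otimes_{\mathbb{Z}_{2}}\mathrm{o}(TY)}(\sigma)\Big]^{(-1)^{n-1}} .$$ -/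

import Mathlib

open scoped Manifold ContDiff Topology

noncomputable section

namespace Fried

/-! ### Flat complex vector bundles -/

/-- A flat complex vector bundle with typical fibre `V` over `Y`: a vector bundle presented by local
trivializations over an open cover whose transition functions are locally constant. The flat
connection is the one for which the frames coming from these trivializations are parallel. -/
structure FlatVectorBundle (Y : Type*) [TopologicalSpace Y] (V : Type*) [NormedAddCommGroup V]
    [NormedSpace ℂ V] (ι : Type*) extends VectorBundleCore ℂ Y V ι where
  locallyConstant : ∀ i j, ∀ y ∈ baseSet i ∩ baseSet j,
    ∀ᶠ y' in 𝓝 y, coordChange i j y' = coordChange i j y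

section Flat

variable {Y : Type*} [TopologicalSpace Y] {V : Type*} [NormedAddCommGroup V] [NormedSpace ℂ V]
  {ι : Type*}

/-- The dual flat vector bundle `F*`; its transition functions are the inverse transposes of those
of `F`. -/
def FlatVectorBundle.dual (F : FlatVectorBundle Y V ι) : FlatVectorBundle Y (V →L[ℂ] ℂ) ι where
  baseSet := F.baseSet
  isOpen_baseSet := F.isOpen_baseSet
  indexAt := F.indexAt
  mem_baseSet_at := F.mem_baseSet_at
  coordChange i j y := (F.coordChange j i y).precomp ℂ
  coordChange_self i y hy ξ := by
    ext v
    simp [F.coordChange_self i y hy v]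
  continuousOn_coordChange i j y hy := by
    apply ContinuousAt.continuousWithinAt
    apply (continuousAt_const (y := (F.coordChange j i y).precomp ℂ)).congr
    filter_upwards [F.locallyConstant j i y hy.symm] with y' hy'
    rw [hy']
  coordChange_comp i j k y hy ξ := by
    ext v
    simp [F.coordChange_comp k j i y ⟨⟨hy.2, hy.1.2⟩, hy.1.1⟩ v]
  locallyConstant i j y hy := by
    filter_upwards [F.locallyConstant j i y hy.symm] with y' hy'
    rw [hy']

/-- A vector field `s` along the curve `c` in the flat bundle `F` (with `s t` in the fibre over
`c t`, which is identified with `V` by the preferred trivialization at `c t`) is parallel if its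
coordinates in every flat trivialization are locally constant. -/
def FlatVectorBundle.IsParallelAlong (F : FlatVectorBundle Y V ι) (c : ℝ → Y) (s : ℝ → V) : Prop :=
  ∀ t i, c t ∈ F.baseSet i → ∀ᶠ t' in 𝓝 t,
    F.coordChange (F.indexAt (c t')) i (c t') (s t') = F.coordChange (F.indexAt (c t)) i (c t) (s t)

open Classical in
/-- Parallel transport along the curve `c` from the fibre over `c 0` to the fibre over `c t`. -/
def FlatVectorBundle.transport (F : FlatVectorBundle Y V ι) (c : ℝ → Y) (t : ℝ) : V →ₗ[ℂ] V :=
  if h : ∃ P : ℝ → V →ₗ[ℂ] V, P 0 = LinearMap.id ∧ ∀ v, F.IsParallelAlong c (fun t => P t v) then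
    h.choose t
  else LinearMap.id

end Flat

/-! ### The orientation bundle -/

section Manifold

variable {n : ℕ} {Y : Type*} [TopologicalSpace Y] [ChartedSpace (EuclideanSpace ℝ (Fin n)) Y]
  [IsManifold (𝓡 n) ∞ Y]

/-- The transition functions of the orientation bundle `o(TY)` between two charts of `Y`: the sign
of the Jacobian of the change of charts. -/
def orientationSign (a b : atlas (EuclideanSpace ℝ (Fin n)) Y) (y : Y) : ℝ :=
  (SignType.sign (LinearMap.det ((tangentBundleCore (𝓡 n) Y).coordChange a b y).toLinearMap) : ℝ)

theorem orientationSign_self (a : atlas (EuclideanSpace ℝ (Fin n)) Y) (y : Y)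
    (hy : y ∈ a.1.source) : orientationSign a a y = 1 := by
  have h : ((tangentBundleCore (𝓡 n) Y).coordChange a a y).toLinearMap = LinearMap.id := by
    ext1 v
    exact (tangentBundleCore (𝓡 n) Y).coordChange_self a y hy v
  rw [orientationSign, h]
  simp

theorem orientationSign_comp (a b c : atlas (EuclideanSpace ℝ (Fin n)) Y) (y : Y)
    (ha : y ∈ a.1.source) (hb : y ∈ b.1.source) (hc : y ∈ c.1.source) :
    orientationSign b c y * orientationSign a b y = orientationSign a c y := by
  have h : ((tangentBundleCore (𝓡 n) Y).coordChange b c y).toLinearMap ∘ₗ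
      ((tangentBundleCore (𝓡 n) Y).coordChange a b y).toLinearMap =
      ((tangentBundleCore (𝓡 n) Y).coordChange a c y).toLinearMap := by
    ext1 v
    exact (tangentBundleCore (𝓡 n) Y).coordChange_comp a b c y ⟨⟨ha, hb⟩, hc⟩ v
  simp only [orientationSign]
  rw [← h, LinearMap.det_comp, sign_mul]
  simp

theorem orientationSign_locallyConstant (a b : atlas (EuclideanSpace ℝ (Fin n)) Y) (y : Y)
    (ha : y ∈ a.1.source) (hb : y ∈ b.1.source) :
    ∀ᶠ y' in 𝓝 y, orientationSign a b y' = orientationSign a b y := by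
  have hne : LinearMap.det ((tangentBundleCore (𝓡 n) Y).coordChange a b y).toLinearMap ≠ 0 := by
    intro h0
    have h := orientationSign_comp a b a y ha hb ha
    rw [orientationSign_self a y ha] at h
    have h1 : orientationSign a b y = 0 := by
      rw [orientationSign, h0]
      simp
    simp [h1] at h
  have hopen : a.1.source ∩ b.1.source ∈ 𝓝 y :=
    (a.1.open_source.inter b.1.open_source).mem_nhds ⟨ha, hb⟩
  have hc : ContinuousAt ((tangentBundleCore (𝓡 n) Y).coordChange a b) y :=
    ((tangentBundleCore (𝓡 n) Y).continuousOn_coordChange a b).continuousAt hopen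
  have hd : ContinuousAt (fun y' =>
      LinearMap.det ((tangentBundleCore (𝓡 n) Y).coordChange a b y').toLinearMap) y :=
    (ContinuousLinearMap.continuous_det
      (E := EuclideanSpace ℝ (Fin n)) (𝕜 := ℝ)).continuousAt.comp hc
  have hs : ∀ᶠ y' in 𝓝 y, SignType.sign
      (LinearMap.det ((tangentBundleCore (𝓡 n) Y).coordChange a b y').toLinearMap) =
      SignType.sign
      (LinearMap.det ((tangentBundleCore (𝓡 n) Y).coordChange a b y).toLinearMap) := by
    rcases lt_or_gt_of_ne hne with h | h
    · filter_upwards [hd.eventually_lt_const h] with y' hy'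
      rw [sign_neg hy', sign_neg h]
    · filter_upwards [hd.eventually_const_lt h] with y' hy'
      rw [sign_pos hy', sign_pos h]
  filter_upwards [hs] with y' hy'
  simp only [orientationSign, hy']

variable (n) in
/-- The flat vector bundle `F ⊗ o(TY)`, the tensor product of `F` with the orientation bundle of
`TY`; its trivializations are indexed by a trivialization of `F` and a chart of `Y`. -/
def FlatVectorBundle.tensorOrientation {V : Type*} [NormedAddCommGroup V] [NormedSpace ℂ V]
    {ι : Type*} (F : FlatVectorBundle Y V ι) :
    FlatVectorBundle Y V (ι × atlas (EuclideanSpace ℝ (Fin n)) Y) where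
  baseSet i := F.baseSet i.1 ∩ i.2.1.source
  isOpen_baseSet i := (F.isOpen_baseSet i.1).inter i.2.1.open_source
  indexAt y := (F.indexAt y, achart (EuclideanSpace ℝ (Fin n)) y)
  mem_baseSet_at y := ⟨F.mem_baseSet_at y, mem_chart_source _ y⟩
  coordChange i j y := (orientationSign i.2 j.2 y : ℂ) • F.coordChange i.1 j.1 y
  coordChange_self i y hy v := by
    simp [orientationSign_self i.2 y hy.2, F.coordChange_self i.1 y hy.1 v]
  continuousOn_coordChange i j y hy := by
    apply ContinuousAt.continuousWithinAt
    apply (continuousAt_const (y := (orientationSign i.2 j.2 y : ℂ) •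
      F.coordChange i.1 j.1 y)).congr
    filter_upwards [F.locallyConstant i.1 j.1 y ⟨hy.1.1, hy.2.1⟩,
      orientationSign_locallyConstant i.2 j.2 y hy.1.2 hy.2.2] with y' h1 h2
    rw [h1, h2]
  coordChange_comp i j k y hy v := by
    simp only [_root_.smul_apply, map_smul, smul_smul]
    rw [F.coordChange_comp i.1 j.1 k.1 y ⟨⟨hy.1.1.1, hy.1.2.1⟩, hy.2.1⟩ v,
      ← orientationSign_comp i.2 j.2 k.2 y hy.1.1.2 hy.1.2.2 hy.2.2]
    push_cast
    rw [mul_comm]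
  locallyConstant i j y hy := by
    filter_upwards [F.locallyConstant i.1 j.1 y ⟨hy.1.1, hy.2.1⟩,
      orientationSign_locallyConstant i.2 j.2 y hy.1.2 hy.2.2] with y' h1 h2
    rw [h1, h2]

/-! ### Flows and the Anosov property -/

open Classical in
/-- The flow `φ_t` of the vector field `Z`: `t ↦ flow Z t y` is the integral curve of `Z` starting
at `y`. -/
def flow (Z : (y : Y) → TangentSpace (𝓡 n) y) (t : ℝ) (y : Y) : Y :=
  if h : ∃ c : ℝ → Y, c 0 = y ∧ IsMIntegralCurve (I := 𝓡 n) c Z then h.choose t else y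

/-- The differential `φ_{t*}` of the flow. -/
def flowDeriv (Z : (y : Y) → TangentSpace (𝓡 n) y) (t : ℝ) (y : Y) :
    TangentSpace (𝓡 n) y →L[ℝ] TangentSpace (𝓡 n) (flow Z t y) :=
  mfderiv (𝓡 n) (𝓡 n) (flow Z t) y

/-- The length of a tangent vector for a Riemannian metric. -/
def length (g : Bundle.ContMDiffRiemannianMetric (𝓡 n) ∞ (EuclideanSpace ℝ (Fin n))
    (fun y : Y => TangentSpace (𝓡 n) y)) (y : Y) (v : TangentSpace (𝓡 n) y) : ℝ :=
  Real.sqrt (g.inner y v v)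

/-- `TY = ℝ Z ⊕ Eu ⊕ Es` is an Anosov splitting for `Z`, with unstable bundle `Eu` and stable bundle
`Es`. -/
structure IsAnosovSplitting (Z : (y : Y) → TangentSpace (𝓡 n) y)
    (Eu Es : (y : Y) → Submodule ℝ (TangentSpace (𝓡 n) y)) : Prop where
  ne_zero : ∀ y, Z y ≠ 0
  disjoint : ∀ y, Disjoint (Eu y) (Es y)
  isCompl : ∀ y, IsCompl (Submodule.span ℝ {Z y}) (Eu y ⊔ Es y)
  map_unstable : ∀ t y, (Eu y).map (flowDeriv Z t y).toLinearMap = Eu (flow Z t y)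
  map_stable : ∀ t y, (Es y).map (flowDeriv Z t y).toLinearMap = Es (flow Z t y)
  hyperbolic : ∃ g : Bundle.ContMDiffRiemannianMetric (𝓡 n) ∞ (EuclideanSpace ℝ (Fin n))
      (fun y : Y => TangentSpace (𝓡 n) y), ∃ C > (0 : ℝ), ∃ θ > (0 : ℝ), ∀ t ≥ (0 : ℝ), ∀ y : Y,
    (∀ v ∈ Es y, length g _ (flowDeriv Z t y v) ≤ C * Real.exp (-θ * t) * length g y v) ∧
    (∀ v ∈ Eu y, length g _ (flowDeriv Z (-t) y v) ≤ C * Real.exp (-θ * t) * length g y v)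

/-- `Z` is an Anosov vector field. -/
def IsAnosov (Z : (y : Y) → TangentSpace (𝓡 n) y) : Prop :=
  ∃ Es Eu : (y : Y) → Submodule ℝ (TangentSpace (𝓡 n) y), IsAnosovSplitting Z Eu Es

open Classical in
/-- The stable bundle `T_s Y` of the Anosov vector field `Z` (an Anosov splitting is unique). -/
def stableBundle (Z : (y : Y) → TangentSpace (𝓡 n) y) (y : Y) :
    Submodule ℝ (TangentSpace (𝓡 n) y) :=
  if h : IsAnosov Z then h.choose y else ⊥

/-! ### The Fried zeta function -/

/-- The set of non-trivial periodic points of `φ_{-t}`, `t > 0`. -/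
def periodicPoints (Z : (y : Y) → TangentSpace (𝓡 n) y) : Set Y :=
  {y | ∃ t > (0 : ℝ), flow Z (-t) y = y}

/-- The smallest positive period `t_y` of a periodic point. -/
def period (Z : (y : Y) → TangentSpace (𝓡 n) y) (y : Y) : ℝ :=
  sInf {t | 0 < t ∧ flow Z (-t) y = y}

/-- The primitive closed trajectories: periodic points modulo the flow, as orbits in `Y`. -/
def PrimitiveOrbit (Z : (y : Y) → TangentSpace (𝓡 n) y) : Type _ :=
  {γ : Set Y // ∃ y ∈ periodicPoints Z, γ = Set.range (fun t : ℝ => flow Z t y)}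

/-- A periodic point on a primitive closed trajectory. -/
def PrimitiveOrbit.point {Z : (y : Y) → TangentSpace (𝓡 n) y} (γ : PrimitiveOrbit Z) : Y :=
  γ.2.choose

/-- The determinant of the restriction to `W` of an endomorphism preserving `W`. -/
def detOn {E : Type*} [AddCommGroup E] [Module ℝ E] (W : Submodule ℝ E) (A : E →ₗ[ℝ] E) : ℝ :=
  open Classical in if h : ∀ v ∈ W, A v ∈ W then LinearMap.det (A.restrict h) else 1

/-- The action of `φ_{t*}`, `t = t_y`, on the orientation line `o(T_s Y)_y` at a periodic point `y`:
multiplication by the sign of the determinant of `φ_{t*}` on `T_{s,y} Y`. Here `φ_t y = y`, so that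
source and target of `φ_{t*}` are the same tangent space. -/
def stableSign (Z : (y : Y) → TangentSpace (𝓡 n) y) (y : Y) : ℝ :=
  (SignType.sign (detOn (E := EuclideanSpace ℝ (Fin n)) (stableBundle Z y)
    (flowDeriv Z (period Z y) y).toLinearMap) : ℝ)

variable {V : Type*} [NormedAddCommGroup V] [NormedSpace ℂ V] {ι : Type*}

/-- The lift of `φ_t` to the flat bundle `F`, as a map from the fibre over `y` to the fibre over
`φ_t y`: parallel transport along the trajectory of `y`. -/
def flowLift (Z : (y : Y) → TangentSpace (𝓡 n) y) (F : FlatVectorBundle Y V ι) (t : ℝ) (y : Y) :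
    V →ₗ[ℂ] V :=
  F.transport (fun s => flow Z s y) t

/-- The factor of the Fried zeta function attached to a primitive closed trajectory: the power
`(-1) ^ (n_s + 1)` of the determinant of `1 - e ^ (-t_y σ) φ_{t_y *}` on `(F ⊗ o(T_s Y))_y`. -/
def friedFactor (Z : (y : Y) → TangentSpace (𝓡 n) y) (F : FlatVectorBundle Y V ι) (σ : ℂ)
    (γ : PrimitiveOrbit Z) : ℂ :=
  LinearMap.det (LinearMap.id - Complex.exp (-(period Z γ.point : ℂ) * σ) •
      (stableSign Z γ.point : ℂ) • flowLift Z F (period Z γ.point) γ.point) ^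
    ((-1 : ℤ) ^ (Module.finrank ℝ (stableBundle Z γ.point) + 1))

/-- The Fried zeta function `R_{Z,F}(σ)`. -/
def friedZeta (Z : (y : Y) → TangentSpace (𝓡 n) y) (F : FlatVectorBundle Y V ι) (σ : ℂ) : ℂ :=
  ∏' γ : PrimitiveOrbit Z, friedFactor Z F σ γ

end Manifold

end Fried

end

/-! The identity holds factor by factor. Reversing time keeps the closed trajectories and their
periods and exchanges the stable and unstable bundles. Around a closed trajectory of period T, the
holonomy of F* ⊗ o(TY) along -Z is the transpose of the holonomy of F along Z, times the sign of the
determinant of φ_{-T*} on TY; a transpose has the same determinant. Since φ_{-T*} fixes Z, that sign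
is the product of the signs on T_s and T_u. Multiplied by the sign on T_u, which is the stable
bundle of -Z, it leaves the sign on T_s. So the two determinants agree, and the exponents
(-1)^(n_s+1) and (-1)^(n_u+1) differ by (-1)^(n-1) because n_s + n_u + 1 = n. This is
`friedFactorAt_neg_dual`.

Convergence needs two exponential bounds. The holonomy grows at most exponentially in the period
because finitely many trivializations suffice and each fixed time step costs a bounded factor
(`exists_flowLift_bound`). The closed trajectories are at most exponentially many
(`exists_summable_exp_period`): embed Y in a Euclidean space and let x, y be points of period T and
T + τ. Their difference w satisfies w = Dφ_T w + τ Z + O(e^{3LT} (|w| + |τ|)²). Hyperbolicity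
inverts 1 - Dφ_T on T_s ⊕ T_u, and moving y along its trajectory to the point nearest x controls the
remaining component along Z. Hence |w| + |τ| ≤ Q e^{3LT} (|w| + |τ|)², so exponentially close closed
trajectories coincide (`exists_isolation`), and a volume packing argument makes Σ e^{-bT} finite.

For Re σ large the factors are then nonzero with summable distance to 1, so the product converges
unconditionally to a nonzero value and may be inverted term by term. The flow, the stable bundle,
parallel transport and the point on each trajectory are defined by choice; uniqueness or invariance
results remove this dependence. -/

open scoped Manifold ContDiff Topology

noncomputable section

set_option linter.unusedSectionVars false

namespace Fried

/-! ### Globally defined flows on a finite-dimensional vector space -/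

section Ambient

open Set Metric

/-- A `C¹` vector field of at most linear growth on a finite-dimensional space is complete. -/
theorem exists_global_solution {E : Type*} [NormedAddCommGroup E] [NormedSpace ℝ E]
    [FiniteDimensional ℝ E] {v : E → E} (hv : ContDiff ℝ 1 v) {A : ℝ} (hA : 0 < A)
    (hgrow : ∀ x, ‖v x‖ ≤ A * (1 + ‖x‖)) (x : E) :
    ∃ γ : ℝ → E, γ 0 = x ∧ ∀ t, HasDerivAt γ (v (γ t)) t := by
  have hcomplete : CompleteSpace E := FiniteDimensional.complete ℝ E
  have hproper : ProperSpace E := FiniteDimensional.proper ℝ E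
  have hv' : ContMDiff 𝓘(ℝ, E) 𝓘(ℝ, E).tangent 1
      (fun x => (⟨x, v x⟩ : TangentBundle 𝓘(ℝ, E) E)) :=
    fun y => contMDiffAt_vectorSpace_iff_contDiffAt.2 hv.contDiffAt
  -- On the ball of radius ‖x‖ + 1 about x the field is bounded by 2A(‖x‖ + 1), so the
  -- Picard–Lindelöf time is 1/(2A) whatever x is. A uniform time of existence makes the solution
  -- global.
  have hε : (0 : ℝ) < 1 / (2 * A) := by positivity
  obtain ⟨γ, h0, hγ⟩ := exists_isMIntegralCurve_of_isMIntegralCurveOn (I := 𝓘(ℝ, E)) (v := v)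
    hv' hε (fun x => by
      obtain ⟨K, hK⟩ := hv.contDiffOn.exists_lipschitzOnWith one_ne_zero
        (convex_closedBall x (‖x‖ + 1)) (isCompact_closedBall x (‖x‖ + 1))
      have hpl : IsPicardLindelof (fun _ => v) (tmin := 0 - 1 / (2 * A)) (tmax := 0 + 1 / (2 * A))
          ⟨0, by constructor <;> linarith⟩ x (⟨‖x‖ + 1, by positivity⟩ : NNReal) 0
          (⟨2 * A * (‖x‖ + 1), by positivity⟩ : NNReal) K := by
        refine IsPicardLindelof.of_time_independent (fun y hy => ?_) hK ?_
        · have h1 : ‖y‖ ≤ ‖x‖ + (‖x‖ + 1) := by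
            have h2 := norm_le_norm_add_norm_sub' y x
            have h3 : ‖y - x‖ ≤ ‖x‖ + 1 := mem_closedBall_iff_norm.1 hy
            linarith
          refine (hgrow y).trans ?_
          change _ ≤ 2 * A * (‖x‖ + 1)
          nlinarith
        · have h1 : max (0 + 1 / (2 * A) - 0) (0 - (0 - 1 / (2 * A))) = 1 / (2 * A) := by simp
          change 2 * A * (‖x‖ + 1) * max (0 + 1 / (2 * A) - 0) (0 - (0 - 1 / (2 * A))) ≤
            (‖x‖ + 1) - 0
          rw [h1]
          field_simp
          linarith
      obtain ⟨α, hα0, hα⟩ := hpl.exists_eq_forall_mem_Icc_hasDerivWithinAt₀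
      refine ⟨α, hα0, fun t ht => ?_⟩
      have ht' : t ∈ Ioo (0 - 1 / (2 * A)) (0 + 1 / (2 * A)) := by simpa using ht
      exact ((hα t (Ioo_subset_Icc_self ht')).hasDerivAt
        (Icc_mem_nhds ht'.1 ht'.2)).hasFDerivAt.hasMFDerivAt.hasMFDerivWithinAt) x
  exact ⟨γ, h0, fun t => hasMFDerivAt_iff_hasFDerivAt.1 (hγ t)⟩

variable {E : Type*} [NormedAddCommGroup E] [NormedSpace ℝ E]

/-- The global flow `map t` of a vector field `F`, together with the solution `deriv t` of the
linearized equation and bounds for `F` up to second order. -/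
structure LinearizedFlow (F : E → E) where
  map : ℝ → E → E
  deriv : ℝ → E → E →L[ℝ] E
  rate : ℝ
  curv : ℝ
  one_le_rate : 1 ≤ rate
  curv_nonneg : 0 ≤ curv
  map_zero : ∀ x, map 0 x = x
  hasDerivAt_map : ∀ x t, HasDerivAt (fun s => map s x) (F (map t x)) t
  deriv_zero : ∀ x, deriv 0 x = ContinuousLinearMap.id ℝ E
  hasDerivAt_deriv : ∀ x t, HasDerivAt (fun s => deriv s x)
    ((fderiv ℝ F (map t x)).comp (deriv t x)) t
  norm_sub_le : ∀ x y, ‖F y - F x‖ ≤ rate * ‖y - x‖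
  norm_fderiv_le : ∀ x, ‖fderiv ℝ F x‖ ≤ rate
  norm_sub_sub_le : ∀ x y, ‖F y - F x - fderiv ℝ F x (y - x)‖ ≤ curv * ‖y - x‖ ^ 2

/-- A compactly supported `C²` vector field has a linearized flow. -/
theorem LinearizedFlow.nonempty [FiniteDimensional ℝ E] {F : E → E} (hF : ContDiff ℝ 2 F)
    (hc : HasCompactSupport F) : Nonempty (LinearizedFlow F) := by
  have hF' : ContDiff ℝ 1 (fderiv ℝ F) := hF.fderiv_right (by norm_num)
  obtain ⟨K, hK⟩ := ContDiff.lipschitzWith_of_hasCompactSupport hc hF (by simp)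
  obtain ⟨M, hM⟩ := ContDiff.lipschitzWith_of_hasCompactSupport
    (hc.fderiv (𝕜 := ℝ)) hF' (by simp)
  obtain ⟨B, hB⟩ := hc.exists_bound_of_continuous hF.continuous
  have hB0 : 0 ≤ B := (norm_nonneg _).trans (hB 0)
  have hKd : ∀ x, ‖fderiv ℝ F x‖ ≤ K := fun x => norm_fderiv_le_of_lipschitz ℝ hK
  -- The flow and its linearization solve one autonomous system on E × (E →L[ℝ] E). Its field is C¹
  -- and of linear growth, because F and its derivative are bounded.
  have hex : ∀ p : E × (E →L[ℝ] E), ∃ γ : ℝ → E × (E →L[ℝ] E), γ 0 = p ∧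
      ∀ t, HasDerivAt γ (F (γ t).1, (fderiv ℝ F (γ t).1).comp (γ t).2) t := by
    have hv : ContDiff ℝ 1 (fun q : E × (E →L[ℝ] E) =>
        (F q.1, (fderiv ℝ F q.1).comp q.2)) := by
      refine ContDiff.prodMk ((hF.of_le one_le_two).comp contDiff_fst) ?_
      exact (hF'.comp contDiff_fst).clm_comp contDiff_snd
    refine exists_global_solution hv (A := B + K + 1) (by positivity) (fun q => ?_)
    refine norm_prod_le_iff.2 ⟨?_, ?_⟩
    · have h1 := hB q.1
      have h2 : 0 ≤ (B + K + 1) * ‖q‖ := by positivity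
      have h3 : (0:ℝ) ≤ K := K.2
      simp only
      nlinarith
    · have h1 : ‖(fderiv ℝ F q.1).comp q.2‖ ≤ K * ‖q‖ :=
        (ContinuousLinearMap.opNorm_comp_le _ _).trans
          (mul_le_mul (hKd _) (norm_snd_le q) (norm_nonneg _) K.2)
      have h3 : (0:ℝ) ≤ K := K.2
      simp only
      nlinarith [norm_nonneg q]
  choose γ h0 hγ using hex
  have hfst : ∀ x t, HasDerivAt (fun s => (γ (x, .id ℝ E) s).1) (F (γ (x, .id ℝ E) t).1) t :=
    fun x t => (hγ (x, .id ℝ E) t).fst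
  -- The rate is K + 1 rather than K so that it is at least 1; the quadratic estimate below divides
  -- by it.
  refine ⟨⟨fun t x => (γ (x, .id ℝ E) t).1, fun t x => (γ (x, .id ℝ E) t).2, K + 1, M,
    by simp, M.2, fun x => by simp [h0], hfst, fun x => by simp [h0],
    fun x t => (hγ (x, .id ℝ E) t).snd, fun x y => ?_, fun x => ?_, fun x y => ?_⟩⟩
  · refine (hK.norm_sub_le y x).trans ?_
    gcongr
    simp
  · exact (hKd x).trans (by simp)
  · have h := (convex_segment (𝕜 := ℝ) x y).norm_image_sub_le_of_norm_fderiv_le' (𝕜 := ℝ) (f := F)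
      (φ := fderiv ℝ F x) (C := M * ‖y - x‖)
      (fun z _ => (hF.differentiable (by simp)) z) (fun z hz => ?_)
      (left_mem_segment ℝ x y) (right_mem_segment ℝ x y)
    · rw [pow_two, ← mul_assoc]
      exact h
    · refine (hM.norm_sub_le z x).trans ?_
      gcongr
      obtain ⟨a, b, ha, hb, hab, rfl⟩ := hz
      have : a • x + b • y - x = b • (y - x) := by
        rw [smul_sub, ← sub_eq_zero]
        have : a = 1 - b := by linarith
        subst this
        module
      rw [this, norm_smul, Real.norm_of_nonneg hb]
      exact mul_le_of_le_one_left (norm_nonneg _) (by linarith)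

/-! ### Gronwall estimates for the flow and its linearization -/

namespace LinearizedFlow

variable {F : E → E}

/-- Time reversal of a linearized flow. -/
def reverse (Φ : LinearizedFlow F) : LinearizedFlow (-F) where
  map t := Φ.map (-t)
  deriv t := Φ.deriv (-t)
  rate := Φ.rate
  curv := Φ.curv
  one_le_rate := Φ.one_le_rate
  curv_nonneg := Φ.curv_nonneg
  map_zero x := by simp [Φ.map_zero]
  hasDerivAt_map x t := by
    simpa using! (Φ.hasDerivAt_map x (-t)).scomp t (hasDerivAt_neg t)
  deriv_zero x := by simp [Φ.deriv_zero]
  hasDerivAt_deriv x t := by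
    have h := (Φ.hasDerivAt_deriv x (-t)).scomp t (hasDerivAt_neg t)
    rw [fderiv_neg]
    simpa using! h
  norm_sub_le x y := by
    have h := Φ.norm_sub_le x y
    rw [← norm_neg] at h
    refine le_trans (le_of_eq ?_) h
    congr 1
    simp only [Pi.neg_apply]
    abel
  norm_fderiv_le x := by
    rw [fderiv_neg, norm_neg]
    exact Φ.norm_fderiv_le x
  norm_sub_sub_le x y := by
    have h := Φ.norm_sub_sub_le x y
    rw [← norm_neg] at h
    refine le_trans (le_of_eq ?_) h
    congr 1
    rw [fderiv_neg]
    simp only [Pi.neg_apply, _root_.neg_apply]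
    abel

variable (Φ : LinearizedFlow F)

theorem rate_pos : 0 < Φ.rate := zero_lt_one.trans_le Φ.one_le_rate

theorem norm_map_sub_le_of_nonneg (x y : E) {t : ℝ} (ht : 0 ≤ t) :
    ‖Φ.map t y - Φ.map t x‖ ≤ ‖y - x‖ * Real.exp (Φ.rate * t) := by
  have hd : ∀ s, HasDerivAt (fun s => Φ.map s y - Φ.map s x) (F (Φ.map s y) - F (Φ.map s x)) s :=
    fun s => (Φ.hasDerivAt_map y s).sub (Φ.hasDerivAt_map x s)
  have h := norm_le_gronwallBound_of_norm_deriv_right_le (a := 0) (b := t) (K := Φ.rate) (ε := 0)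
    (δ := ‖y - x‖) (fun s _ => (hd s).continuousAt.continuousWithinAt)
    (fun s _ => (hd s).hasDerivWithinAt) (by simp [Φ.map_zero])
    (fun s _ => by simpa using Φ.norm_sub_le _ _) t ⟨ht, le_rfl⟩
  simpa [gronwallBound_ε0] using h

theorem norm_map_sub_le (x y : E) (t : ℝ) :
    ‖Φ.map t y - Φ.map t x‖ ≤ Real.exp (Φ.rate * |t|) * ‖y - x‖ := by
  rw [mul_comm]
  rcases le_total 0 t with ht | ht
  · rw [abs_of_nonneg ht]
    exact Φ.norm_map_sub_le_of_nonneg x y ht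
  · rw [abs_of_nonpos ht]
    simpa [reverse] using Φ.reverse.norm_map_sub_le_of_nonneg x y (t := -t) (by linarith)

theorem norm_deriv_apply_le_of_nonneg (x u : E) {t : ℝ} (ht : 0 ≤ t) :
    ‖Φ.deriv t x u‖ ≤ ‖u‖ * Real.exp (Φ.rate * t) := by
  have hd : ∀ s, HasDerivAt (fun s => Φ.deriv s x u) (fderiv ℝ F (Φ.map s x) (Φ.deriv s x u)) s :=
    fun s => (Φ.hasDerivAt_deriv x s).clm_apply (hasDerivAt_const s u) |>.congr_deriv (by simp)
  have h := norm_le_gronwallBound_of_norm_deriv_right_le (a := 0) (b := t) (K := Φ.rate) (ε := 0)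
    (δ := ‖u‖) (fun s _ => (hd s).continuousAt.continuousWithinAt)
    (fun s _ => (hd s).hasDerivWithinAt) (by simp [Φ.deriv_zero])
    (fun s _ => by
      simpa using (ContinuousLinearMap.le_opNorm _ _).trans
        (mul_le_mul_of_nonneg_right (Φ.norm_fderiv_le _) (norm_nonneg _))) t ⟨ht, le_rfl⟩
  simpa [gronwallBound_ε0] using h

theorem norm_deriv_apply_le (x u : E) (t : ℝ) :
    ‖Φ.deriv t x u‖ ≤ Real.exp (Φ.rate * |t|) * ‖u‖ := by
  rw [mul_comm]
  rcases le_total 0 t with ht | ht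
  · rw [abs_of_nonneg ht]
    exact Φ.norm_deriv_apply_le_of_nonneg x u ht
  · rw [abs_of_nonpos ht]
    simpa [reverse] using Φ.reverse.norm_deriv_apply_le_of_nonneg x u (t := -t) (by linarith)

/-- The remainder solves the linearized equation with a forcing term of size `curv` times the
squared distance of the two trajectories. That square contributes e^{2Lt} and Gronwall another
e^{Lt}, whence the exponent 3. The explicit dependence on time is what sets the isolation scale of
closed trajectories. -/
theorem norm_map_sub_sub_le_of_nonneg (x y : E) {t : ℝ} (ht : 0 ≤ t) :
    ‖Φ.map t y - Φ.map t x - Φ.deriv t x (y - x)‖ ≤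
      Φ.curv * Real.exp (3 * Φ.rate * t) * ‖y - x‖ ^ 2 := by
  have hd : ∀ s, HasDerivAt (fun s => Φ.map s y - Φ.map s x - Φ.deriv s x (y - x))
      (F (Φ.map s y) - F (Φ.map s x) - fderiv ℝ F (Φ.map s x) (Φ.deriv s x (y - x))) s :=
    fun s => ((Φ.hasDerivAt_map y s).sub (Φ.hasDerivAt_map x s)).sub
      ((Φ.hasDerivAt_deriv x s).clm_apply (hasDerivAt_const s _) |>.congr_deriv (by simp))
  have hr := Φ.rate_pos
  have hcurv := Φ.curv_nonneg
  have h := norm_le_gronwallBound_of_norm_deriv_right_le (a := 0) (b := t) (K := Φ.rate)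
    (ε := Φ.curv * (‖y - x‖ * Real.exp (Φ.rate * t)) ^ 2)
    (δ := 0) (fun s _ => (hd s).continuousAt.continuousWithinAt)
    (fun s _ => (hd s).hasDerivWithinAt) (by simp [Φ.deriv_zero, Φ.map_zero])
    (fun s hs => by
      set r := Φ.map s y - Φ.map s x - Φ.deriv s x (y - x) with hrdef
      -- The derivative of the remainder is the linearized field applied to it plus the Taylor error
      -- of F between the two trajectories.
      have h1 : F (Φ.map s y) - F (Φ.map s x) - fderiv ℝ F (Φ.map s x) (Φ.deriv s x (y - x)) =
          fderiv ℝ F (Φ.map s x) r + (F (Φ.map s y) - F (Φ.map s x) -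
            fderiv ℝ F (Φ.map s x) (Φ.map s y - Φ.map s x)) := by
        rw [hrdef, map_sub (fderiv ℝ F (Φ.map s x)) (Φ.map s y - Φ.map s x)]
        abel
      rw [h1]
      refine (norm_add_le _ _).trans (add_le_add ?_ ?_)
      · exact (ContinuousLinearMap.le_opNorm _ _).trans
          (mul_le_mul_of_nonneg_right (Φ.norm_fderiv_le _) (norm_nonneg _))
      · refine (Φ.norm_sub_sub_le _ _).trans ?_
        gcongr
        refine (Φ.norm_map_sub_le_of_nonneg x y hs.1).trans ?_
        gcongr
        exact hs.2.le) t ⟨ht, le_rfl⟩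
  refine h.trans ?_
  rw [gronwallBound_of_K_ne_0 hr.ne', sub_zero]
  have he : Real.exp (3 * Φ.rate * t) = Real.exp (Φ.rate * t) ^ 2 * Real.exp (Φ.rate * t) := by
    rw [← Real.exp_nat_mul, ← Real.exp_add]
    congr 1
    push_cast
    ring
  rw [he]
  simp only [zero_mul, zero_add]
  set X := Real.exp (Φ.rate * t)
  have hX : 0 < X := Real.exp_pos _
  have h2 : Φ.curv * (‖y - x‖ * X) ^ 2 / Φ.rate ≤ Φ.curv * (‖y - x‖ * X) ^ 2 :=
    div_le_self (by positivity) Φ.one_le_rate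
  calc Φ.curv * (‖y - x‖ * X) ^ 2 / Φ.rate * (X - 1)
      ≤ Φ.curv * (‖y - x‖ * X) ^ 2 / Φ.rate * X := by
        gcongr
        linarith
    _ ≤ Φ.curv * (‖y - x‖ * X) ^ 2 * X := by gcongr
    _ = _ := by ring

theorem norm_map_sub_sub_le (x y : E) (t : ℝ) :
    ‖Φ.map t y - Φ.map t x - Φ.deriv t x (y - x)‖ ≤
      Φ.curv * Real.exp (3 * Φ.rate * |t|) * ‖y - x‖ ^ 2 := by
  rcases le_total 0 t with ht | ht
  · rw [abs_of_nonneg ht]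
    exact Φ.norm_map_sub_sub_le_of_nonneg x y ht
  · rw [abs_of_nonpos ht]
    simpa [reverse] using Φ.reverse.norm_map_sub_sub_le_of_nonneg x y (t := -t) (by linarith)

/-- Differentiability in the initial point is read off from the quadratic remainder bound. -/
theorem hasFDerivAt_map (t : ℝ) (x : E) : HasFDerivAt (Φ.map t) (Φ.deriv t x) x := by
  refine HasFDerivAt.of_isLittleO ?_
  have h : (fun y => Φ.map t y - Φ.map t x - Φ.deriv t x (y - x)) =O[𝓝 x]
      fun y => ‖y - x‖ ^ 2 :=
    Asymptotics.IsBigO.of_bound (Φ.curv * Real.exp (3 * Φ.rate * |t|))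
      (Filter.Eventually.of_forall fun y => by simpa using Φ.norm_map_sub_sub_le x y t)
  refine h.trans_isLittleO ?_
  have h2 : (fun u : E => ‖u‖ ^ 2) =o[𝓝 0] fun u => u := Asymptotics.isLittleO_norm_pow_id one_lt_two
  have h3 : Filter.Tendsto (fun y => y - x) (𝓝 x) (𝓝 0) := by
    have : ContinuousAt (fun y => y - x) x := by fun_prop
    simpa [ContinuousAt] using this
  exact h2.comp_tendsto h3

theorem continuous_deriv (x : E) : Continuous fun t => Φ.deriv t x :=
  continuous_iff_continuousAt.2 fun t => (Φ.hasDerivAt_deriv x t).continuousAt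

/-- Solutions of the differential equation near a time are unique. -/
theorem eventuallyEq_of_hasDerivAt (Φ : LinearizedFlow F) {α β : ℝ → E} {t₀ : ℝ}
    (hα : ∀ᶠ t in 𝓝 t₀, HasDerivAt α (F (α t)) t) (hβ : ∀ᶠ t in 𝓝 t₀, HasDerivAt β (F (β t)) t)
    (h : α t₀ = β t₀) : α =ᶠ[𝓝 t₀] β := by
  have hL : LipschitzWith ⟨Φ.rate, Φ.rate_pos.le⟩ F :=
    LipschitzWith.of_dist_le_mul fun x y => by
      rw [dist_eq_norm, dist_eq_norm]
      exact Φ.norm_sub_le y x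
  exact ODE_solution_unique_of_eventually (v := fun _ => F) (s := fun _ => univ)
    (Filter.Eventually.of_forall fun _ => hL.lipschitzOnWith)
    (hα.mono fun t ht => ⟨ht, mem_univ _⟩) (hβ.mono fun t ht => ⟨ht, mem_univ _⟩) h

theorem eq_map_of_hasDerivAt {α : ℝ → E} (hα : ∀ t, HasDerivAt α (F (α t)) t) (t : ℝ) :
    α t = Φ.map t (α 0) := by
  have hL : LipschitzWith ⟨Φ.rate, Φ.rate_pos.le⟩ F :=
    LipschitzWith.of_dist_le_mul fun x y => by
      rw [dist_eq_norm, dist_eq_norm]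
      exact Φ.norm_sub_le y x
  have h : α = fun t => Φ.map t (α 0) :=
    ODE_solution_unique_univ (v := fun _ => F) (s := fun _ => univ) (t₀ := 0)
      (fun _ => hL.lipschitzOnWith)
      (fun t => ⟨hα t, mem_univ _⟩) (fun t => ⟨Φ.hasDerivAt_map _ t, mem_univ _⟩)
      (by simp [Φ.map_zero])
  exact congrFun h t

end LinearizedFlow

end Ambient

/-! ### Embedding the manifold and extending the vector field -/

section Embedding

open Set Metric

variable {n : ℕ} {Y : Type*} [TopologicalSpace Y] [ChartedSpace (EuclideanSpace ℝ (Fin n)) Y]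
  {E : Type*} [NormedAddCommGroup E] [NormedSpace ℝ E]

theorem two_le_infty : (2 : WithTop ℕ∞) ≤ ∞ := by
  have h : ((2 : ℕ∞) : WithTop ℕ∞) ≤ ∞ := WithTop.coe_le_coe.2 le_top
  exact h

/-- A map into a vector space read in the preferred chart at `y`. -/
theorem contDiffAt_comp_extChartAt_symm {e : Y → E} {m : WithTop ℕ∞} {y : Y}
    (he : ContMDiffAt (𝓡 n) 𝓘(ℝ, E) m e y) :
    ContDiffAt ℝ m (e ∘ (extChartAt (𝓡 n) y).symm) (extChartAt (𝓡 n) y y) := by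
  have h := (contMDiffAt_iff.1 he).2
  simpa [contDiffWithinAt_univ, chartAt_self_eq, Function.comp_assoc] using! h

theorem mfderiv_eq_fderiv_comp_extChartAt_symm {e : Y → E} {y : Y}
    (he : MDifferentiableAt (𝓡 n) 𝓘(ℝ, E) e y) :
    mfderiv (𝓡 n) 𝓘(ℝ, E) e y =
      fderiv ℝ (e ∘ (extChartAt (𝓡 n) y).symm) (extChartAt (𝓡 n) y y) := by
  rw [he.mfderiv]
  simp [writtenInExtChartAt, fderivWithin_univ, chartAt_self_eq]
  rfl

/-- An immersion into a vector space has local left inverses of class `C²`. -/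
theorem exists_local_leftInverse [CompleteSpace E] {e : Y → E}
    (he : ContMDiff (𝓡 n) 𝓘(ℝ, E) ∞ e) {y : Y}
    (hinj : Function.Injective (mfderiv (𝓡 n) 𝓘(ℝ, E) e y)) [FiniteDimensional ℝ E] :
    ∃ G : E → EuclideanSpace ℝ (Fin n), ContDiffAt ℝ 2 G (e y) ∧
      ∀ᶠ y' in 𝓝 y, G (e y') = extChartAt (𝓡 n) y y' := by
  set h := e ∘ (extChartAt (𝓡 n) y).symm with hh
  set a := extChartAt (𝓡 n) y y with ha
  have hc : ContDiffAt ℝ 2 h a :=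
    (contDiffAt_comp_extChartAt_symm (he y)).of_le two_le_infty
  rw [mfderiv_eq_fderiv_comp_extChartAt_symm ((he y).mdifferentiableAt (by simp))] at hinj
  -- A linear left inverse p of the differential makes p ∘ h a map between spaces of equal dimension
  -- with derivative the identity; its local inverse composed with p is the required G.
  obtain ⟨π, hπ⟩ := LinearMap.exists_leftInverse_of_injective (fderiv ℝ h a).toLinearMap
    (LinearMap.ker_eq_bot.2 hinj)
  set p : E →L[ℝ] EuclideanSpace ℝ (Fin n) := LinearMap.toContinuousLinearMap π with hp
  have hf : ContDiffAt ℝ 2 (p ∘ h) a := p.contDiff.contDiffAt.comp a hc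
  have hd : HasFDerivAt (p ∘ h)
      ((ContinuousLinearEquiv.refl ℝ (EuclideanSpace ℝ (Fin n)) :
        EuclideanSpace ℝ (Fin n) →L[ℝ] EuclideanSpace ℝ (Fin n))) a := by
    have h1 := p.hasFDerivAt.comp a (hc.differentiableAt (by simp)).hasFDerivAt
    refine h1.congr_fderiv ?_
    ext1 v
    exact LinearMap.congr_fun hπ v
  have hah : h a = e y := by simp [hh, ha]
  refine ⟨hf.localInverse hd (by simp) ∘ p, ?_, ?_⟩
  · have h2 := hf.to_localInverse hd (by simp)
    refine ContDiffAt.comp (e y) ?_ p.contDiff.contDiffAt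
    simpa [hah] using h2
  · have hs := hf.hasStrictFDerivAt' hd (by simp)
    have h3 := hs.eventually_left_inverse
    have h4 : Filter.Tendsto (extChartAt (𝓡 n) y) (𝓝 y) (𝓝 a) := continuousAt_extChartAt y
    filter_upwards [h4.eventually h3, extChartAt_source_mem_nhds (I := 𝓡 n) y] with y' h5 h6
    have h7 : h (extChartAt (𝓡 n) y y') = e y' := by
      simp only [hh, Function.comp_apply]
      rw [(extChartAt (𝓡 n) y).left_inv h6]
    simp only [Function.comp_apply] at h5 ⊢
    rw [h7] at h5
    exact h5

/-- Smooth functions on an embedded compact manifold extend to compactly supported functions of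
class `C²`. -/
theorem exists_extension [CompactSpace Y] {N : ℕ} {e : Y → EuclideanSpace ℝ (Fin N)}
    (he : ContMDiff (𝓡 n) (𝓡 N) ∞ e) (hemb : Topology.IsClosedEmbedding e)
    (hinj : ∀ y, Function.Injective (mfderiv (𝓡 n) (𝓡 N) e y))
    {f : Y → E} (hf : ContMDiff (𝓡 n) 𝓘(ℝ, E) ∞ f) :
    ∃ F : EuclideanSpace ℝ (Fin N) → E, ContDiff ℝ 2 F ∧ HasCompactSupport F ∧
      ∀ y, F (e y) = f y := by
  -- The constraint at z is convex: it fixes the value when z lies on the embedded manifold and is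
  -- vacuous otherwise. Local solutions can therefore be glued by a partition of unity.
  have hloc : ∀ x : EuclideanSpace ℝ (Fin N), ∃ U ∈ 𝓝 x, ∃ g : EuclideanSpace ℝ (Fin N) → E,
      ContMDiffOn (𝓡 N) 𝓘(ℝ, E) 2 g U ∧ ∀ z ∈ U, g z ∈ {w | ∀ y, e y = z → w = f y} := by
    intro x
    by_cases hx : x ∈ range e
    · obtain ⟨y, rfl⟩ := hx
      obtain ⟨G, hG, hGe⟩ := exists_local_leftInverse he (hinj y)
      set g := (f ∘ (extChartAt (𝓡 n) y).symm) ∘ G with hg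
      have hGy : G (e y) = extChartAt (𝓡 n) y y := hGe.self_of_nhds
      have hgc : ContDiffAt ℝ 2 g (e y) := by
        refine ContDiffAt.comp (e y) ?_ hG
        rw [hGy]
        exact (contDiffAt_comp_extChartAt_symm (hf y)).of_le two_le_infty
      have hY : ∀ᶠ y' in 𝓝 y, g (e y') = f y' := by
        filter_upwards [hGe, extChartAt_source_mem_nhds (I := 𝓡 n) y] with y' h1 h2
        simp only [hg, Function.comp_apply, h1]
        rw [(extChartAt (𝓡 n) y).left_inv h2]
      -- Agreement near y in Y must become agreement on an ambient neighbourhood; the embedding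
      -- being inducing excludes other sheets of the image close to `e y`.
      rw [hemb.isInducing.nhds_eq_comap] at hY
      obtain ⟨W, hW, hWY⟩ := Filter.mem_comap.1 hY
      refine ⟨W ∩ {z | ContDiffAt ℝ 2 g z}, Filter.inter_mem hW (hgc.eventually (by simp)), g,
        fun z hz => ?_, ?_⟩
      · have hz' : ContDiffAt ℝ 2 g z := hz.2
        exact hz'.contMDiffAt.contMDiffWithinAt
      rintro z hz y' rfl
      exact hWY hz.1
    · exact ⟨(range e)ᶜ, hemb.isClosed_range.isOpen_compl.mem_nhds hx, fun _ => 0,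
        contMDiffOn_const, fun z hz y hy => absurd ⟨y, hy⟩ hz⟩
  obtain ⟨g, hg⟩ := exists_contMDiffMap_forall_mem_convex_of_local (𝓡 N) (n := 2)
    (t := fun z => {w : E | ∀ y, e y = z → w = f y})
    (fun z w₁ h₁ w₂ h₂ a b _ _ hab y hy => by
      rw [h₁ y hy, h₂ y hy, ← add_smul, hab, one_smul]) hloc
  -- The image is compact, so a bump function equal to 1 on a large ball gives compact support
  -- without changing the values on it.
  obtain ⟨R, hR⟩ := (isCompact_range hemb.continuous).isBounded.subset_closedBall 0
  have hR' : (0 : ℝ) < |R| + 1 := by positivity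
  let χ : ContDiffBump (0 : EuclideanSpace ℝ (Fin N)) := ⟨|R| + 1, |R| + 2, hR', by linarith⟩
  refine ⟨fun x => χ x • g x, ?_, ?_, fun y => ?_⟩
  · exact χ.contDiff.smul (contMDiff_iff_contDiff.1 g.contMDiff)
  · exact χ.hasCompactSupport.smul_right
  · have h1 : χ (e y) = 1 := by
      apply χ.one_of_mem_closedBall
      refine closedBall_subset_closedBall ?_ (hR ⟨y, rfl⟩)
      change R ≤ |R| + 1
      linarith [le_abs_self R]
    simp only [h1, one_smul]
    exact hg (e y) y rfl

variable [IsManifold (𝓡 n) ∞ Y]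

/-- An embedding of the manifold in Euclidean space, a compactly supported vector field extending
`Z`, and its linearized flow. -/
structure FlowEmbedding (Z : (y : Y) → TangentSpace (𝓡 n) y) where
  N : ℕ
  emb : Y → EuclideanSpace ℝ (Fin N)
  contMDiff_emb : ContMDiff (𝓡 n) (𝓡 N) ∞ emb
  isClosedEmbedding : Topology.IsClosedEmbedding emb
  injective_mfderiv : ∀ y, Function.Injective (mfderiv (𝓡 n) (𝓡 N) emb y)
  field : EuclideanSpace ℝ (Fin N) → EuclideanSpace ℝ (Fin N)
  field_emb : ∀ y, field (emb y) = mfderiv (𝓡 n) (𝓡 N) emb y (Z y)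
  ambient : LinearizedFlow field

theorem FlowEmbedding.nonempty [T2Space Y] [CompactSpace Y]
    {Z : (y : Y) → TangentSpace (𝓡 n) y}
    (hZ : ContMDiff (𝓡 n) (𝓡 n).tangent ∞ (fun y => (⟨y, Z y⟩ : TangentBundle (𝓡 n) Y))) :
    Nonempty (FlowEmbedding Z) := by
  obtain ⟨N, e, he, hemb, hinj⟩ := exists_embedding_euclidean_of_compact (I := 𝓡 n) (M := Y)
  have hf : ContMDiff (𝓡 n) (𝓡 N) ∞
      (fun y => (mfderiv (𝓡 n) (𝓡 N) e y (Z y) : EuclideanSpace ℝ (Fin N))) := by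
    have h1 : ContMDiff (𝓡 n).tangent (𝓡 N).tangent ∞ (tangentMap (𝓡 n) (𝓡 N) e) :=
      he.contMDiff_tangentMap (by simp)
    have h2 : ContMDiff (𝓡 N).tangent (𝓡 N) ∞
        (fun p : TangentBundle (𝓡 N) (EuclideanSpace ℝ (Fin N)) => p.2) :=
      contMDiff_snd_tangentBundle_modelSpace _ _
    exact h2.comp (h1.comp hZ)
  obtain ⟨F, hF, hFc, hFe⟩ := exists_extension he hemb hinj hf
  obtain ⟨Φ⟩ := LinearizedFlow.nonempty hF hFc
  exact ⟨⟨N, e, he, hemb, hinj, F, hFe, Φ⟩⟩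

end Embedding

/-! ### The flow on the manifold -/

section Flow

open Set Metric

variable {n : ℕ} {Y : Type*} [TopologicalSpace Y] [ChartedSpace (EuclideanSpace ℝ (Fin n)) Y]
  [IsManifold (𝓡 n) ∞ Y] {Z : (y : Y) → TangentSpace (𝓡 n) y}

namespace FlowEmbedding

variable (A : FlowEmbedding Z)

/-- The differential of the embedding. -/
def diff (y : Y) : EuclideanSpace ℝ (Fin n) →L[ℝ] EuclideanSpace ℝ (Fin A.N) :=
  mfderiv (𝓡 n) (𝓡 A.N) A.emb y

theorem injective_diff (y : Y) : Function.Injective (A.diff y) := A.injective_mfderiv y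

theorem hasMFDerivAt_emb (y : Y) : HasMFDerivAt (𝓡 n) (𝓡 A.N) A.emb y (A.diff y) :=
  ((A.contMDiff_emb y).mdifferentiableAt (by simp)).hasMFDerivAt

theorem diff_field (y : Y) : A.diff y (Z y) = A.field (A.emb y) := (A.field_emb y).symm

theorem hasDerivAt_emb_comp {γ : ℝ → Y} {t : ℝ}
    (h : HasMFDerivAt 𝓘(ℝ, ℝ) (𝓡 n) γ t ((1 : ℝ →L[ℝ] ℝ).smulRight (Z (γ t)))) :
    HasDerivAt (A.emb ∘ γ) (A.field (A.emb (γ t))) t := by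
  have h1 := (A.hasMFDerivAt_emb (γ t)).comp t h
  let z : EuclideanSpace ℝ (Fin n) := Z (γ t)
  have h2 : HasFDerivAt (A.emb ∘ γ) ((A.diff (γ t)).comp ((1 : ℝ →L[ℝ] ℝ).smulRight z)) t :=
    hasMFDerivAt_iff_hasFDerivAt.1 h1
  refine h2.hasDerivAt.congr_deriv ?_
  rw [← A.diff_field]
  change A.diff (γ t) ((1 : ℝ) • z) = A.diff (γ t) z
  rw [one_smul]

/-- The ambient trajectory never leaves the embedded manifold. The times at which it lies on it form
a closed set because the image is closed, and an open set because a local integral curve on Y maps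
to an ambient solution, which is unique. The line is connected, so all times occur. -/
theorem exists_integralCurve (A : FlowEmbedding Z)
    (hZ : ContMDiff (𝓡 n) (𝓡 n).tangent ∞ (fun y => (⟨y, Z y⟩ : TangentBundle (𝓡 n) Y)))
    (y : Y) :
    ∃ c : ℝ → Y, c 0 = y ∧ IsMIntegralCurve (I := 𝓡 n) c Z := by
  have hloc : ∀ t₀ y₁, A.ambient.map t₀ (A.emb y) = A.emb y₁ → ∃ γ : ℝ → Y,
      IsMIntegralCurveAt (I := 𝓡 n) γ Z t₀ ∧
      ∀ᶠ t in 𝓝 t₀, A.emb (γ t) = A.ambient.map t (A.emb y) := by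
    intro t₀ y₁ hy₁
    obtain ⟨γ, hγ0, hγ⟩ := exists_isMIntegralCurveAt_of_contMDiffAt_boundaryless (I := 𝓡 n) (v := Z)
      t₀ (x₀ := y₁) ((hZ y₁).of_le (by simp))
    refine ⟨γ, hγ, ?_⟩
    refine A.ambient.eventuallyEq_of_hasDerivAt (α := A.emb ∘ γ) (hγ.mono fun t ht =>
      A.hasDerivAt_emb_comp ht)
      (Filter.Eventually.of_forall fun t => A.ambient.hasDerivAt_map _ t) ?_
    simp [hγ0, hy₁]
  have hcont : Continuous fun t => A.ambient.map t (A.emb y) :=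
    continuous_iff_continuousAt.2 fun t => (A.ambient.hasDerivAt_map _ t).continuousAt
  have hclopen : IsClopen {t | A.ambient.map t (A.emb y) ∈ range A.emb} := by
    refine ⟨A.isClosedEmbedding.isClosed_range.preimage hcont, isOpen_iff_mem_nhds.2 ?_⟩
    rintro t₀ ⟨y₁, hy₁⟩
    obtain ⟨γ, -, hγ⟩ := hloc t₀ y₁ hy₁.symm
    filter_upwards [hγ] with t ht
    exact ⟨γ t, ht⟩
  have huniv := hclopen.eq_univ ⟨0, by simp [A.ambient.map_zero]⟩
  have hall : ∀ t, ∃ y', A.emb y' = A.ambient.map t (A.emb y) := fun t => by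
    have : t ∈ {t | A.ambient.map t (A.emb y) ∈ range A.emb} := by rw [huniv]; trivial
    exact this
  choose c hc using hall
  refine ⟨c, A.isClosedEmbedding.injective (by rw [hc, A.ambient.map_zero]), ?_⟩
  rw [isMIntegralCurve_iff_isMIntegralCurveAt]
  intro t₀
  obtain ⟨γ, hγ, hγc⟩ := hloc t₀ (c t₀) (hc t₀).symm
  have heq : ∀ᶠ t in 𝓝 t₀, c t = γ t := hγc.mono fun t ht =>
    A.isClosedEmbedding.injective ((hc t).trans ht.symm)
  filter_upwards [hγ, heq.eventually_nhds] with t h1 h2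
  have h3 := h1.congr_of_eventuallyEq (f₁ := c) h2
  rw [h2.self_of_nhds]
  exact h3

end FlowEmbedding

variable [T2Space Y] [CompactSpace Y]
  (hZ : ContMDiff (𝓡 n) (𝓡 n).tangent ∞ (fun y => (⟨y, Z y⟩ : TangentBundle (𝓡 n) Y)))

section Basic

include hZ

theorem exists_flow_curve (y : Y) :
    ∃ c : ℝ → Y, c 0 = y ∧ IsMIntegralCurve (I := 𝓡 n) c Z := by
  obtain ⟨A⟩ := FlowEmbedding.nonempty hZ
  exact A.exists_integralCurve hZ y

theorem isMIntegralCurve_flow (y : Y) : IsMIntegralCurve (I := 𝓡 n) (fun t => flow Z t y) Z := by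
  have h := exists_flow_curve hZ y
  simp only [flow, dif_pos h]
  exact h.choose_spec.2

theorem flow_zero (y : Y) : flow Z 0 y = y := by
  have h := exists_flow_curve hZ y
  simp only [flow, dif_pos h]
  exact h.choose_spec.1

/-- Uniqueness of integral curves. -/
theorem eq_flow {c : ℝ → Y} (hc : IsMIntegralCurve (I := 𝓡 n) c Z) (t : ℝ) :
    c t = flow Z t (c 0) := by
  have h : c = fun t => flow Z t (c 0) :=
    isMIntegralCurve_Ioo_eq_of_contMDiff_boundaryless (I := 𝓡 n) (t₀ := 0)
      (hZ.of_le (by simp)) hc (isMIntegralCurve_flow hZ _) (flow_zero hZ _).symm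
  exact congrFun h t

theorem flow_add (s t : ℝ) (y : Y) : flow Z (s + t) y = flow Z s (flow Z t y) := by
  have h := (isMIntegralCurve_flow hZ y).comp_add t
  have h2 := eq_flow hZ h s
  simpa using! h2

theorem flow_neg_flow (t : ℝ) (y : Y) : flow Z (-t) (flow Z t y) = y := by
  rw [← flow_add hZ, neg_add_cancel, flow_zero hZ]

theorem flow_flow_neg (t : ℝ) (y : Y) : flow Z t (flow Z (-t) y) = y := by
  rw [← flow_add hZ, add_neg_cancel, flow_zero hZ]

theorem contMDiff_neg_field : ContMDiff (𝓡 n) (𝓡 n).tangent ∞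
    (fun y => (⟨y, (-Z) y⟩ : TangentBundle (𝓡 n) Y)) :=
  hZ.neg_section

theorem flow_neg (t : ℝ) (y : Y) : flow (-Z) t y = flow Z (-t) y := by
  have h := (isMIntegralCurve_flow hZ y).comp_mul (-1)
  have h' : IsMIntegralCurve (I := 𝓡 n) ((fun t => flow Z t y) ∘ (· * (-1))) (-Z) := by
    convert! h using 1
    funext y
    simp
  have h2 := eq_flow (contMDiff_neg_field hZ) h' t
  simpa [flow_zero hZ] using! h2.symm

theorem continuous_flow_time (y : Y) : Continuous fun t => flow Z t y :=
  (isMIntegralCurve_flow hZ y).continuous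

end Basic

namespace FlowEmbedding

variable (A : FlowEmbedding Z)

include hZ

theorem emb_flow (t : ℝ) (y : Y) : A.emb (flow Z t y) = A.ambient.map t (A.emb y) := by
  have h := A.ambient.eq_map_of_hasDerivAt (α := A.emb ∘ fun t => flow Z t y)
    (fun t => A.hasDerivAt_emb_comp (isMIntegralCurve_flow hZ y t)) t
  simpa [flow_zero hZ] using h

theorem continuous_flow (A : FlowEmbedding Z) (t : ℝ) : Continuous (flow Z t) := by
  rw [A.isClosedEmbedding.isInducing.continuous_iff]
  have h : A.emb ∘ flow Z t = A.ambient.map t ∘ A.emb := funext fun y => A.emb_flow hZ t y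
  rw [h]
  refine Continuous.comp ?_ A.isClosedEmbedding.continuous
  exact continuous_iff_continuousAt.2 fun x => (A.ambient.hasFDerivAt_map t x).continuousAt

/-- Near y, in the chart at the image point, the flow is the ambient flow on the embedded manifold
followed by a local left inverse of the embedding. -/
theorem mdifferentiableAt_flow (A : FlowEmbedding Z) (t : ℝ) (y : Y) :
    MDifferentiableAt (𝓡 n) (𝓡 n) (flow Z t) y := by
  obtain ⟨G, hG, hGe⟩ := exists_local_leftInverse A.contMDiff_emb
    (A.injective_mfderiv (flow Z t y))
  rw [mdifferentiableAt_iff_target]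
  refine ⟨(A.continuous_flow hZ t).continuousAt, ?_⟩
  have h1 : MDifferentiableAt (𝓡 n) (𝓡 n) (G ∘ (A.ambient.map t ∘ A.emb)) y := by
    have h2 : MDifferentiableAt (𝓡 n) (𝓡 A.N) (A.ambient.map t ∘ A.emb) y :=
      ((A.ambient.hasFDerivAt_map t (A.emb y)).hasMFDerivAt.comp y
        (A.hasMFDerivAt_emb y)).mdifferentiableAt
    have h3 : DifferentiableAt ℝ G ((A.ambient.map t ∘ A.emb) y) := by
      rw [Function.comp_apply, ← A.emb_flow hZ]
      exact hG.differentiableAt (by simp)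
    exact h3.mdifferentiableAt.comp y h2
  refine h1.congr_of_eventuallyEq ?_
  filter_upwards [(A.continuous_flow hZ t).continuousAt.eventually hGe] with y' hy'
  simp only [Function.comp_apply]
  rw [← hy', A.emb_flow hZ]

/-- This transfers the ambient linearized estimates to the differential of the flow on Y. -/
theorem diff_flowDeriv (t : ℝ) (y : Y) (v : EuclideanSpace ℝ (Fin n)) :
    A.diff (flow Z t y) (flowDeriv Z t y v) = A.ambient.deriv t (A.emb y) (A.diff y v) := by
  have h1 := (A.hasMFDerivAt_emb (flow Z t y)).comp y (A.mdifferentiableAt_flow hZ t y).hasMFDerivAt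
  have h2 := (A.ambient.hasFDerivAt_map t (A.emb y)).hasMFDerivAt.comp y (A.hasMFDerivAt_emb y)
  have h : A.emb ∘ flow Z t = A.ambient.map t ∘ A.emb := funext fun y => A.emb_flow hZ t y
  rw [h] at h1
  exact DFunLike.congr_fun (hasMFDerivAt_unique h1 h2) v

end FlowEmbedding

end Flow

/-! ### Comparison of norms on the tangent bundle -/

section Norms

open Set Metric Bundle

variable {n : ℕ} {Y : Type*} [TopologicalSpace Y] [ChartedSpace (EuclideanSpace ℝ (Fin n)) Y]
  [IsManifold (𝓡 n) ∞ Y]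

/-- Two continuous homogeneous functions on the tangent bundle of a compact manifold are comparable
if the second one is positive away from the zero section. -/
theorem exists_le_mul_of_homogeneous [CompactSpace Y] {q₁ q₂ : TangentBundle (𝓡 n) Y → ℝ}
    (hq₁ : Continuous q₁) (hq₂ : Continuous q₂)
    (h₁ : ∀ (y : Y) (v : TangentSpace (𝓡 n) y) (a : ℝ), 0 ≤ a → q₁ ⟨y, a • v⟩ = a * q₁ ⟨y, v⟩)
    (h₂ : ∀ (y : Y) (v : TangentSpace (𝓡 n) y) (a : ℝ), 0 ≤ a → q₂ ⟨y, a • v⟩ = a * q₂ ⟨y, v⟩)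
    (hpos : ∀ (y : Y) (v : TangentSpace (𝓡 n) y), v ≠ 0 → 0 < q₂ ⟨y, v⟩) :
    ∃ C > 0, ∀ (y : Y) (v : TangentSpace (𝓡 n) y), q₁ ⟨y, v⟩ ≤ C * q₂ ⟨y, v⟩ := by
  have hnn : ∀ (y : Y) (v : TangentSpace (𝓡 n) y), 0 ≤ q₂ ⟨y, v⟩ := by
    intro y v
    rcases eq_or_ne v 0 with rfl | hv
    · have := h₂ y 0 0 le_rfl
      rw [smul_zero, zero_mul] at this
      exact this.ge
    · exact (hpos y v hv).le
  have hloc : ∀ y₀ : Y, ∃ C > 0, ∀ᶠ y in 𝓝 y₀, ∀ v : TangentSpace (𝓡 n) y,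
      q₁ ⟨y, v⟩ ≤ C * q₂ ⟨y, v⟩ := by
    intro y₀
    set T := trivializationAt (EuclideanSpace ℝ (Fin n)) (TangentSpace (𝓡 n) (M := Y)) y₀ with hT
    have hmem : y₀ ∈ T.baseSet := mem_baseSet_trivializationAt _ _ y₀
    set S := sphere (0 : EuclideanSpace ℝ (Fin n)) 1 with hS
    have hSc : IsCompact S := isCompact_sphere _ _
    have hcont : ∀ w, ContinuousAt (fun p : Y × EuclideanSpace ℝ (Fin n) =>
        T.toOpenPartialHomeomorph.symm p) (y₀, w) := fun w =>
      T.toOpenPartialHomeomorph.continuousAt_symm (T.mem_target.2 hmem)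
    have hsymm : ∀ y ∈ T.baseSet, ∀ w, T.toOpenPartialHomeomorph.symm (y, w) =
        (⟨y, T.symm y w⟩ : TangentBundle (𝓡 n) Y) := fun y hy w => (T.mk_symm hy w).symm
    have hne : ∀ y ∈ T.baseSet, ∀ w ∈ S, T.symm y w ≠ 0 := by
      intro y hy w hw h0
      have h3 : T.linearMapAt ℝ y (T.symm y w) = w := by
        have := (T.continuousLinearEquivAt ℝ y hy).apply_symm_apply w
        simpa [Trivialization.coe_linearMapAt_of_mem _ hy] using! this
      rw [h0, map_zero] at h3
      rw [← h3, hS, mem_sphere_zero_iff_norm, norm_zero] at hw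
      exact zero_ne_one hw
    have hbd : ∃ C > 0, ∀ w ∈ S, q₁ (T.toOpenPartialHomeomorph.symm (y₀, w)) <
        C * q₂ (T.toOpenPartialHomeomorph.symm (y₀, w)) := by
      have hc : ContinuousOn (fun w => q₁ (T.toOpenPartialHomeomorph.symm (y₀, w)) /
          q₂ (T.toOpenPartialHomeomorph.symm (y₀, w))) S := by
        intro w hw
        have hw' : ContinuousAt (fun w => T.toOpenPartialHomeomorph.symm (y₀, w)) w :=
          (hcont w).comp (f := fun w => (y₀, w)) (by fun_prop)
        refine (ContinuousAt.div (hq₁.continuousAt.comp hw') (hq₂.continuousAt.comp hw')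
          ?_).continuousWithinAt
        simp only [Function.comp_apply]
        rw [hsymm y₀ hmem]
        exact (hpos _ _ (hne y₀ hmem w hw)).ne'
      obtain ⟨B, hB⟩ := hSc.bddAbove_image hc
      refine ⟨|B| + 1, by positivity, fun w hw => ?_⟩
      have h4 := hB ⟨w, hw, rfl⟩
      have h5 : 0 < q₂ (T.toOpenPartialHomeomorph.symm (y₀, w)) := by
        rw [hsymm y₀ hmem]
        exact hpos _ _ (hne y₀ hmem w hw)
      simp only at h4
      rw [div_le_iff₀ h5] at h4
      refine h4.trans_lt ?_
      gcongr
      linarith [le_abs_self B]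
    obtain ⟨C, hC, hCb⟩ := hbd
    refine ⟨C, hC, ?_⟩
    -- A strict inequality on the compact unit sphere persists over nearby base points; homogeneity
    -- then extends it to all vectors.
    have hev : ∀ᶠ y in 𝓝 y₀, ∀ w ∈ S, q₁ (T.toOpenPartialHomeomorph.symm (y, w)) <
        C * q₂ (T.toOpenPartialHomeomorph.symm (y, w)) := by
      refine hSc.eventually_forall_of_forall_eventually fun w hw => ?_
      have hl : ContinuousAt (fun p : Y × EuclideanSpace ℝ (Fin n) =>
          q₁ (T.toOpenPartialHomeomorph.symm p)) (y₀, w) := hq₁.continuousAt.comp (hcont w)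
      have hr : ContinuousAt (fun p : Y × EuclideanSpace ℝ (Fin n) =>
          C * q₂ (T.toOpenPartialHomeomorph.symm p)) (y₀, w) :=
        continuousAt_const.mul (hq₂.continuousAt.comp (hcont w))
      exact hl.eventually_lt hr (hCb w hw)
    filter_upwards [hev, T.open_baseSet.mem_nhds hmem] with y hy hyb v
    rcases eq_or_ne v 0 with rfl | hv
    · have e1 := h₁ y 0 0 le_rfl
      have e2 := h₂ y 0 0 le_rfl
      rw [smul_zero, zero_mul] at e1 e2
      rw [e1, e2, mul_zero]
    set L := T.continuousLinearEquivAt ℝ y hyb with hL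
    have hLv : L v ≠ 0 := by simpa using hv
    have hw : (‖L v‖⁻¹ • L v) ∈ S := by
      rw [hS, mem_sphere_zero_iff_norm, norm_smul, norm_inv, norm_norm,
        inv_mul_cancel₀ (norm_ne_zero_iff.2 hLv)]
    have h6 := hy _ hw
    have h7 : T.symm y (‖L v‖⁻¹ • L v) = ‖L v‖⁻¹ • v := by
      have : L.symm (‖L v‖⁻¹ • L v) = ‖L v‖⁻¹ • v := by
        rw [map_smul, L.symm_apply_apply]
      rw [← this]
      rfl
    rw [hsymm y hyb, h7, h₁ y v _ (by positivity), h₂ y v _ (by positivity)] at h6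
    have h8 : 0 < ‖L v‖⁻¹ := by positivity
    nlinarith [mul_pos h8 h8]
  choose C hC hCe using hloc
  obtain ⟨s, hs⟩ := CompactSpace.elim_nhds_subcover (fun y₀ => {y | ∀ v : TangentSpace (𝓡 n) y,
    q₁ ⟨y, v⟩ ≤ C y₀ * q₂ ⟨y, v⟩}) hCe
  refine ⟨1 + ∑ y ∈ s, C y, add_pos_of_pos_of_nonneg one_pos
    (Finset.sum_nonneg fun y _ => (hC y).le), fun y v => ?_⟩
  have hy : y ∈ ⋃ y₀ ∈ s, {y | ∀ v : TangentSpace (𝓡 n) y,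
    q₁ ⟨y, v⟩ ≤ C y₀ * q₂ ⟨y, v⟩} := by
    rw [hs]
    trivial
  simp only [mem_iUnion] at hy
  obtain ⟨y₀, hy₀, hy⟩ := hy
  refine (hy v).trans (mul_le_mul_of_nonneg_right ?_ (hnn y v))
  have := Finset.single_le_sum (fun y _ => (hC y).le) hy₀
  linarith

theorem continuous_length (g : Bundle.ContMDiffRiemannianMetric (𝓡 n) ∞ (EuclideanSpace ℝ (Fin n))
    (fun y : Y => TangentSpace (𝓡 n) y)) :
    Continuous fun p : TangentBundle (𝓡 n) Y => length g p.1 p.2 := by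
  refine Real.continuous_sqrt.comp ?_
  have h1 : Continuous fun p : TangentBundle (𝓡 n) Y => p.1 := FiberBundle.continuous_proj _ _
  have h2 : Continuous (fun p : TangentBundle (𝓡 n) Y =>
      TotalSpace.mk' ℝ (E := Bundle.Trivial Y ℝ) p.1 (g.inner p.1 p.2 p.2)) :=
    continuous_iff_continuousAt.2 fun p =>
      ContinuousAt.clm_bundle_apply₂ (F₁ := EuclideanSpace ℝ (Fin n))
        (F₂ := EuclideanSpace ℝ (Fin n)) (g.contMDiff.continuous.comp h1).continuousAt
        (v := fun p : TangentBundle (𝓡 n) Y => p.2) (w := fun p : TangentBundle (𝓡 n) Y => p.2)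
        continuousAt_id continuousAt_id
  refine continuous_iff_continuousAt.2 fun p => ?_
  have h3 := h2.continuousAt (x := p)
  simp only [FiberBundle.continuousAt_totalSpace] at h3
  exact h3.2

theorem FlowEmbedding.continuous_norm_diff {Z : (y : Y) → TangentSpace (𝓡 n) y}
    (A : FlowEmbedding Z) : Continuous fun p : TangentBundle (𝓡 n) Y => ‖A.diff p.1 p.2‖ := by
  have h1 : ContMDiff (𝓡 n).tangent (𝓡 A.N).tangent ∞ (tangentMap (𝓡 n) (𝓡 A.N) A.emb) :=
    A.contMDiff_emb.contMDiff_tangentMap (by simp)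
  have h2 : ContMDiff (𝓡 A.N).tangent (𝓡 A.N) ∞
      (fun p : TangentBundle (𝓡 A.N) (EuclideanSpace ℝ (Fin A.N)) => p.2) :=
    contMDiff_snd_tangentBundle_modelSpace _ _
  exact (h2.comp h1).continuous.norm

/-- The length for a Riemannian metric is comparable to the norm in the ambient space. -/
theorem FlowEmbedding.exists_length_comparison [CompactSpace Y]
    {Z : (y : Y) → TangentSpace (𝓡 n) y} (A : FlowEmbedding Z)
    (g : Bundle.ContMDiffRiemannianMetric (𝓡 n) ∞ (EuclideanSpace ℝ (Fin n))
      (fun y : Y => TangentSpace (𝓡 n) y)) :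
    ∃ C > 0, ∀ (y : Y) (v : TangentSpace (𝓡 n) y),
      ‖A.diff y v‖ ≤ C * length g y v ∧ length g y v ≤ C * ‖A.diff y v‖ := by
  have hd : ∀ (y : Y) (v : TangentSpace (𝓡 n) y) (a : ℝ), 0 ≤ a →
      ‖A.diff y (a • v)‖ = a * ‖A.diff y v‖ := fun y v a ha => by
    have h : A.diff y (a • v) = a • A.diff y v := map_smul _ _ _
    rw [h, norm_smul, Real.norm_of_nonneg ha]
  have hl : ∀ (y : Y) (v : TangentSpace (𝓡 n) y) (a : ℝ), 0 ≤ a →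
      length g y (a • v) = a * length g y v := fun y v a ha => by
    simp only [length]
    rw [map_smul, map_smul, _root_.smul_apply, smul_smul, smul_eq_mul,
      Real.sqrt_mul (mul_nonneg ha ha), Real.sqrt_mul_self ha]
  obtain ⟨C₁, hC₁, h₁⟩ := exists_le_mul_of_homogeneous A.continuous_norm_diff (continuous_length g)
    hd hl (fun y v hv => Real.sqrt_pos.2 (g.pos y v hv))
  obtain ⟨C₂, hC₂, h₂⟩ := exists_le_mul_of_homogeneous (continuous_length g) A.continuous_norm_diff
    hl hd (fun y v hv => norm_pos_iff.2 fun h => hv (A.injective_diff y (by rw [h]; exact (map_zero _).symm)))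
  refine ⟨C₁ + C₂, by positivity, fun y v => ⟨(h₁ y v).trans ?_, (h₂ y v).trans ?_⟩⟩
  · exact mul_le_mul_of_nonneg_right (by linarith) (Real.sqrt_nonneg _)
  · exact mul_le_mul_of_nonneg_right (by linarith) (norm_nonneg _)

end Norms

/-! ### The differential of the flow, and secants of the embedded manifold -/

section Cocycle

open Set Metric

variable {n : ℕ} {Y : Type*} [TopologicalSpace Y] [ChartedSpace (EuclideanSpace ℝ (Fin n)) Y]
  [IsManifold (𝓡 n) ∞ Y]

/-- The differential of the flow in the preferred coordinates of the tangent spaces. -/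
def dflow (Z : (y : Y) → TangentSpace (𝓡 n) y) (t : ℝ) (y : Y) :
    EuclideanSpace ℝ (Fin n) →L[ℝ] EuclideanSpace ℝ (Fin n) := flowDeriv Z t y

/-- A vector field in the preferred coordinates of the tangent spaces. -/
def fieldCoord (Z : (y : Y) → TangentSpace (𝓡 n) y) (y : Y) : EuclideanSpace ℝ (Fin n) := Z y

variable {Z : (y : Y) → TangentSpace (𝓡 n) y} [T2Space Y] [CompactSpace Y]
  (hZ : ContMDiff (𝓡 n) (𝓡 n).tangent ∞ (fun y => (⟨y, Z y⟩ : TangentBundle (𝓡 n) Y)))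

include hZ

theorem mdifferentiableAt_flow (t : ℝ) (y : Y) :
    MDifferentiableAt (𝓡 n) (𝓡 n) (flow Z t) y := by
  obtain ⟨A⟩ := FlowEmbedding.nonempty hZ
  exact A.mdifferentiableAt_flow hZ t y

theorem dflow_zero (y : Y) : dflow Z 0 y = ContinuousLinearMap.id ℝ _ := by
  have h : flow Z 0 = id := funext fun y => flow_zero hZ y
  have h2 : (mfderiv (𝓡 n) (𝓡 n) (flow Z 0) y : EuclideanSpace ℝ (Fin n) →L[ℝ] _) =
      mfderiv (𝓡 n) (𝓡 n) (id : Y → Y) y := by rw [h]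
  exact h2.trans mfderiv_id

theorem dflow_add (s t : ℝ) (y : Y) :
    dflow Z (s + t) y = (dflow Z s (flow Z t y)).comp (dflow Z t y) := by
  have h : flow Z (s + t) = flow Z s ∘ flow Z t := funext fun y => flow_add hZ s t y
  have h2 : (mfderiv (𝓡 n) (𝓡 n) (flow Z (s + t)) y : EuclideanSpace ℝ (Fin n) →L[ℝ] _) =
      mfderiv (𝓡 n) (𝓡 n) (flow Z s ∘ flow Z t) y := by rw [h]
  exact h2.trans (mfderiv_comp y (mdifferentiableAt_flow hZ s _) (mdifferentiableAt_flow hZ t y))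

theorem dflow_add_apply (s t : ℝ) (y : Y) (v : EuclideanSpace ℝ (Fin n)) :
    dflow Z (s + t) y v = dflow Z s (flow Z t y) (dflow Z t y v) := by
  rw [dflow_add hZ]
  rfl

theorem dflow_neg_dflow (t : ℝ) (y : Y) (v : EuclideanSpace ℝ (Fin n)) :
    dflow Z (-t) (flow Z t y) (dflow Z t y v) = v := by
  rw [← dflow_add_apply hZ, neg_add_cancel, dflow_zero hZ]
  rfl

theorem dflow_neg_field (t : ℝ) (y : Y) : dflow (-Z) t y = dflow Z (-t) y := by
  have h : flow (-Z) t = flow Z (-t) := funext fun y => flow_neg hZ t y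
  have h2 : (mfderiv (𝓡 n) (𝓡 n) (flow (-Z) t) y : EuclideanSpace ℝ (Fin n) →L[ℝ] _) =
      mfderiv (𝓡 n) (𝓡 n) (flow Z (-t)) y := by rw [h]
  exact h2

theorem injective_dflow (t : ℝ) (y : Y) : Function.Injective (dflow Z t y) := fun v w h => by
  rw [← dflow_neg_dflow hZ t y v, h, dflow_neg_dflow hZ t y w]

/-- The vector field is invariant under its flow. -/
theorem dflow_field (t : ℝ) (y : Y) : dflow Z t y (fieldCoord Z y) = fieldCoord Z (flow Z t y) := by
  have h1 : HasMFDerivAt 𝓘(ℝ, ℝ) (𝓡 n) (fun s => flow Z s y) 0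
      ((1 : ℝ →L[ℝ] ℝ).smulRight (Z (flow Z 0 y))) := isMIntegralCurve_flow hZ y 0
  have h2 : HasMFDerivAt 𝓘(ℝ, ℝ) (𝓡 n) (fun s => flow Z s (flow Z t y)) 0
      ((1 : ℝ →L[ℝ] ℝ).smulRight (Z (flow Z 0 (flow Z t y)))) :=
    isMIntegralCurve_flow hZ (flow Z t y) 0
  have h3 := (mdifferentiableAt_flow hZ t (flow Z 0 y)).hasMFDerivAt.comp (0 : ℝ) h1
  have h4 : (flow Z t ∘ fun s => flow Z s y) = fun s => flow Z s (flow Z t y) := by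
    funext s
    simp only [Function.comp_apply]
    rw [← flow_add hZ, ← flow_add hZ, add_comm]
  rw [h4] at h3
  have h5 := DFunLike.congr_fun (hasMFDerivAt_unique h3 h2) (1 : ℝ)
  have h6 : dflow Z t (flow Z 0 y) ((1 : ℝ) • fieldCoord Z (flow Z 0 y)) =
      (1 : ℝ) • fieldCoord Z (flow Z 0 (flow Z t y)) := h5
  rw [one_smul, one_smul, flow_zero hZ, flow_zero hZ] at h6
  exact h6

omit hZ [T2Space Y] [CompactSpace Y] in
theorem FlowEmbedding.diff_fieldCoord (A : FlowEmbedding Z) (y : Y) :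
    A.diff y (fieldCoord Z y) = A.field (A.emb y) := A.diff_field y

theorem FlowEmbedding.diff_dflow (A : FlowEmbedding Z) (t : ℝ) (y : Y)
    (v : EuclideanSpace ℝ (Fin n)) :
    A.diff (flow Z t y) (dflow Z t y v) = A.ambient.deriv t (A.emb y) (A.diff y v) :=
  A.diff_flowDeriv hZ t y v

end Cocycle

section Secants

open Set Metric

variable {n : ℕ} {Y : Type*} [TopologicalSpace Y] [ChartedSpace (EuclideanSpace ℝ (Fin n)) Y]
  [IsManifold (𝓡 n) ∞ Y] {Z : (y : Y) → TangentSpace (𝓡 n) y}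

/-- In a chart, Taylor's formula bounds the deviation of the secant from the tangent space by M
times the squared coordinate distance. The local left inverse is K-Lipschitz, so that distance is at
most K times the ambient one; the constant is M K². -/
theorem FlowEmbedding.exists_secant_bound_near (A : FlowEmbedding Z) (y₀ : Y) :
    ∃ C : ℝ, ∀ᶠ p in 𝓝 (y₀, y₀), ∃ v, ‖A.emb p.2 - A.emb p.1 - A.diff p.1 v‖ ≤
      C * ‖A.emb p.2 - A.emb p.1‖ ^ 2 := by
  set ψ := extChartAt (𝓡 n) y₀ with hψ
  set h := A.emb ∘ ψ.symm with hh
  have hc : ContDiffAt ℝ 2 h (ψ y₀) :=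
    (contDiffAt_comp_extChartAt_symm (A.contMDiff_emb y₀)).of_le two_le_infty
  have hc' : ContDiffAt ℝ 1 (fderiv ℝ h) (ψ y₀) := hc.fderiv_right (by norm_num)
  obtain ⟨M, U, hU, hM⟩ := hc'.exists_lipschitzOnWith
  obtain ⟨G, hG, hGe⟩ := exists_local_leftInverse A.contMDiff_emb (A.injective_mfderiv y₀)
  obtain ⟨K, W, hW, hK⟩ := (hG.of_le one_le_two).exists_lipschitzOnWith
  obtain ⟨r, hr, hball⟩ := Metric.mem_nhds_iff.1
    (Filter.inter_mem hU ((hc.eventually (by simp)).and (extChartAt_target_mem_nhds (I := 𝓡 n) y₀)))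
  have hsrc : ∀ᶠ y in 𝓝 y₀, y ∈ ψ.source := extChartAt_source_mem_nhds (I := 𝓡 n) y₀
  have hnear : ∀ᶠ y in 𝓝 y₀, ψ y ∈ ball (ψ y₀) r ∧ y ∈ ψ.source ∧ A.emb y ∈ W ∧
      G (A.emb y) = ψ y :=
    ((continuousAt_extChartAt (I := 𝓡 n) y₀).eventually (ball_mem_nhds _ hr)).and
      (hsrc.and ((A.isClosedEmbedding.continuous.continuousAt.eventually hW).and hGe))
  refine ⟨M * K ^ 2, ?_⟩
  rw [nhds_prod_eq]
  filter_upwards [hnear.prod_mk hnear] with p hp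
  obtain ⟨⟨hx1, hx2, hx3, hx4⟩, ⟨hy1, hy2, hy3, hy4⟩⟩ := hp
  set a := ψ p.1 with ha
  set b := ψ p.2 with hb
  have hax : ψ.symm a = p.1 := ψ.left_inv hx2
  have hha : h a = A.emb p.1 := by simp [hh, hax]
  have hhb : h b = A.emb p.2 := by simp [hh, hb, ψ.left_inv hy2]
  have hdist : ‖b - a‖ ≤ K * ‖A.emb p.2 - A.emb p.1‖ := by
    rw [← hx4, ← hy4]
    exact hK.norm_sub_le hy3 hx3
  have htaylor : ‖h b - h a - fderiv ℝ h a (b - a)‖ ≤ M * ‖b - a‖ * ‖b - a‖ := by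
    have hseg : segment ℝ a b ⊆ ball (ψ y₀) r := (convex_ball _ _).segment_subset hx1 hy1
    refine (convex_segment (𝕜 := ℝ) a b).norm_image_sub_le_of_norm_fderiv_le' (𝕜 := ℝ)
      (fun z hz => ?_) (fun z hz => ?_) (left_mem_segment ℝ a b) (right_mem_segment ℝ a b)
    · have : ContDiffAt ℝ 2 h z := (hball (hseg hz)).2.1
      exact this.differentiableAt (by simp)
    · refine (hM.norm_sub_le (hball (hseg hz)).1 (hball hx1).1).trans ?_
      gcongr
      obtain ⟨c, d, hc0, hd0, hcd, rfl⟩ := hz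
      have : c • a + d • b - a = d • (b - a) := by
        have : c = 1 - d := by linarith
        subst this
        module
      rw [this, norm_smul, Real.norm_of_nonneg hd0]
      exact mul_le_of_le_one_left (norm_nonneg _) (by linarith)
  -- The chart is the one at y₀, while `diff` uses preferred coordinates at `p.1`; the chain rule
  -- supplies the tangent vector in the latter.
  have htan : ∃ v, fderiv ℝ h a (b - a) = A.diff p.1 v := by
    have hm : MDifferentiableAt (𝓡 n) (𝓡 n) ψ.symm a :=
      ((contMDiffOn_extChartAt_symm (I := 𝓡 n) (n := ∞) y₀).contMDiffAt
        ((isOpen_extChartAt_target (I := 𝓡 n) y₀).mem_nhds (ψ.map_source hx2))).mdifferentiableAt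
        (by simp)
    have h1 := A.hasMFDerivAt_emb (ψ.symm a)
    let B : EuclideanSpace ℝ (Fin n) →L[ℝ] EuclideanSpace ℝ (Fin n) :=
      mfderiv (𝓡 n) (𝓡 n) ψ.symm a
    have h2 : HasFDerivAt h ((A.diff (ψ.symm a)).comp B) a :=
      hasMFDerivAt_iff_hasFDerivAt.1 (h1.comp a hm.hasMFDerivAt)
    refine ⟨B (b - a), ?_⟩
    have h3 : fderiv ℝ h a (b - a) = A.diff (ψ.symm a) (B (b - a)) := by
      rw [h2.fderiv]
      rfl
    rw [h3, hax]
  obtain ⟨v, hv⟩ := htan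
  refine ⟨v, ?_⟩
  rw [← hv, ← hha, ← hhb]
  refine htaylor.trans ?_
  rw [hha, hhb]
  have hM0 : (0 : ℝ) ≤ M := M.2
  calc (M : ℝ) * ‖b - a‖ * ‖b - a‖ = M * ‖b - a‖ ^ 2 := by ring
    _ ≤ M * (K * ‖A.emb p.2 - A.emb p.1‖) ^ 2 := by gcongr
    _ = _ := by ring

/-- Secants of the embedded manifold are tangent up to second order. -/
theorem FlowEmbedding.exists_secant_bound [T2Space Y] [CompactSpace Y] (A : FlowEmbedding Z) :
    ∃ C > 0, ∀ x y : Y, ∃ v, ‖A.emb y - A.emb x - A.diff x v‖ ≤ C * ‖A.emb y - A.emb x‖ ^ 2 := by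
  have hloc : ∀ q : Y × Y, ∃ C : ℝ, ∀ᶠ p in 𝓝 q, ∃ v, ‖A.emb p.2 - A.emb p.1 - A.diff p.1 v‖ ≤
      C * ‖A.emb p.2 - A.emb p.1‖ ^ 2 := by
    rintro ⟨x₀, y₀⟩
    rcases eq_or_ne x₀ y₀ with rfl | hne
    · exact A.exists_secant_bound_near x₀
    · have hpos : 0 < ‖A.emb y₀ - A.emb x₀‖ :=
        norm_pos_iff.2 (sub_ne_zero.2 fun h => hne (A.isClosedEmbedding.injective h).symm)
      have hcont : ContinuousAt (fun p : Y × Y => ‖A.emb p.2 - A.emb p.1‖) (x₀, y₀) := by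
        have := A.isClosedEmbedding.continuous
        fun_prop
      -- Away from the diagonal the zero tangent vector suffices, since the ambient distance stays
      -- above half its value at (x₀, y₀).
      refine ⟨2 / ‖A.emb y₀ - A.emb x₀‖, ?_⟩
      filter_upwards [hcont.eventually_const_lt (half_lt_self hpos)] with p hp
      refine ⟨0, ?_⟩
      rw [map_zero, sub_zero, pow_two, ← mul_assoc]
      refine le_mul_of_one_le_left (norm_nonneg _) ?_
      rw [div_mul_eq_mul_div, le_div_iff₀ hpos]
      linarith
  choose C hC using hloc
  obtain ⟨s, hs⟩ := CompactSpace.elim_nhds_subcover _ hC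
  refine ⟨1 + ∑ q ∈ s, |C q|, by positivity, fun x y => ?_⟩
  have hy : (x, y) ∈ (⊤ : Set (Y × Y)) := trivial
  rw [← hs] at hy
  simp only [mem_iUnion] at hy
  obtain ⟨q, hq, v, hv⟩ := hy
  refine ⟨v, hv.trans ?_⟩
  gcongr
  have h1 := Finset.single_le_sum (fun q _ => abs_nonneg (C q)) hq
  have h2 := le_abs_self (C q)
  linarith

end Secants

/-! ### Hyperbolicity and isolation of closed trajectories -/

section Hyperbolic

open Set Metric

variable {n : ℕ} {Y : Type*} [TopologicalSpace Y] [ChartedSpace (EuclideanSpace ℝ (Fin n)) Y]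
  [IsManifold (𝓡 n) ∞ Y] {Z : (y : Y) → TangentSpace (𝓡 n) y}

/-- Hyperbolicity of a splitting with respect to the norm of an ambient Euclidean space. -/
structure FlowEmbedding.IsHyperbolic (A : FlowEmbedding Z)
    (Eu Es : Y → Submodule ℝ (EuclideanSpace ℝ (Fin n))) (C θ : ℝ) : Prop where
  one_le : 1 ≤ C
  pos : 0 < θ
  ne_zero : ∀ y, Z y ≠ 0
  exists_decomp : ∀ (y : Y) (v : EuclideanSpace ℝ (Fin n)), ∃ a : ℝ, ∃ s ∈ Es y, ∃ u ∈ Eu y,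
    v = a • fieldCoord Z y + s + u
  dflow_mem_stable : ∀ t y, ∀ v ∈ Es y, dflow Z t y v ∈ Es (flow Z t y)
  dflow_mem_unstable : ∀ t y, ∀ v ∈ Eu y, dflow Z t y v ∈ Eu (flow Z t y)
  stable_le : ∀ t ≥ 0, ∀ y, ∀ v ∈ Es y,
    ‖A.diff (flow Z t y) (dflow Z t y v)‖ ≤ C * Real.exp (-θ * t) * ‖A.diff y v‖
  unstable_le : ∀ t ≥ 0, ∀ y, ∀ v ∈ Eu y,
    ‖A.diff (flow Z (-t) y) (dflow Z (-t) y v)‖ ≤ C * Real.exp (-θ * t) * ‖A.diff y v‖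

/-- The metric length and the ambient norm are comparable by compactness, so only the constant C
changes; the added 1 makes it at least 1. -/
theorem IsAnosovSplitting.isHyperbolic [CompactSpace Y]
    {Eu Es : (y : Y) → Submodule ℝ (TangentSpace (𝓡 n) y)} (h : IsAnosovSplitting Z Eu Es)
    (A : FlowEmbedding Z) : ∃ C θ, A.IsHyperbolic Eu Es C θ := by
  obtain ⟨g, C, hC, θ, hθ, hyp⟩ := h.hyperbolic
  obtain ⟨B, hB, hcomp⟩ := A.exists_length_comparison g
  have key : ∀ (t : ℝ) (y z : Y) (v : TangentSpace (𝓡 n) y) (w : TangentSpace (𝓡 n) z),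
      length g z w ≤ C * Real.exp (-θ * t) * length g y v →
      ‖A.diff z w‖ ≤ (B * C * B + 1) * Real.exp (-θ * t) * ‖A.diff y v‖ := by
    intro t y z v w hvw
    have hexp := Real.exp_pos (-θ * t)
    calc ‖A.diff z w‖ ≤ B * length g z w := (hcomp z w).1
      _ ≤ B * (C * Real.exp (-θ * t) * length g y v) := by gcongr
      _ ≤ B * (C * Real.exp (-θ * t) * (B * ‖A.diff y v‖)) := by
        gcongr
        exact (hcomp y v).2
      _ = B * C * B * (Real.exp (-θ * t) * ‖A.diff y v‖) := by ring
      _ ≤ (B * C * B + 1) * (Real.exp (-θ * t) * ‖A.diff y v‖) := by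
        gcongr
        linarith
      _ = _ := by ring
  refine ⟨B * C * B + 1, θ, ⟨?_, hθ, h.ne_zero, ?_, ?_, ?_, ?_, ?_⟩⟩
  · have : 0 < B * C * B := by positivity
    linarith
  · intro y
    suffices hv : ∀ v : TangentSpace (𝓡 n) y, ∃ a : ℝ, ∃ s ∈ Es y, ∃ u ∈ Eu y,
        v = a • Z y + s + u from hv
    intro v
    have hv : v ∈ Submodule.span ℝ {Z y} ⊔ (Eu y ⊔ Es y) := by
      rw [(h.isCompl y).sup_eq_top]
      trivial
    obtain ⟨z, hz, w, hw, rfl⟩ := Submodule.mem_sup.1 hv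
    obtain ⟨a, rfl⟩ := Submodule.mem_span_singleton.1 hz
    obtain ⟨u, hu, s, hs, rfl⟩ := Submodule.mem_sup.1 hw
    exact ⟨a, s, hs, u, hu, by rw [add_assoc, add_comm s u]⟩
  · intro t y v hv
    have := Submodule.mem_map_of_mem (f := (flowDeriv Z t y).toLinearMap) hv
    rw [h.map_stable t y] at this
    exact this
  · intro t y v hv
    have := Submodule.mem_map_of_mem (f := (flowDeriv Z t y).toLinearMap) hv
    rw [h.map_unstable t y] at this
    exact this
  · intro t ht y v hv
    exact key t y _ v _ ((hyp t ht y).1 v hv)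
  · intro t ht y v hv
    exact key t y _ v _ ((hyp t ht y).2 v hv)

namespace FlowEmbedding

theorem exists_field_bound [CompactSpace Y] (A : FlowEmbedding Z) :
    ∃ B > 0, ∀ y, ‖A.field (A.emb y)‖ ≤ B := by
  have hc : Continuous A.field := by
    have hL : LipschitzWith ⟨A.ambient.rate, A.ambient.rate_pos.le⟩ A.field :=
      LipschitzWith.of_dist_le_mul fun x y => by
        rw [dist_eq_norm, dist_eq_norm]
        exact A.ambient.norm_sub_le y x
    exact hL.continuous
  obtain ⟨B, hB⟩ := (isCompact_range (hc.comp A.isClosedEmbedding.continuous)).isBounded.exists_norm_le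
  exact ⟨|B| + 1, by positivity, fun y => (hB _ ⟨y, rfl⟩).trans (by linarith [le_abs_self B])⟩

theorem exists_field_lower_bound [CompactSpace Y] (A : FlowEmbedding Z) (hne : ∀ y, Z y ≠ 0) :
    ∃ m > 0, ∀ y, m ≤ ‖A.field (A.emb y)‖ := by
  rcases isEmpty_or_nonempty Y with hY | hY
  · exact ⟨1, one_pos, fun y => (hY.false y).elim⟩
  have hc : Continuous A.field := by
    have hL : LipschitzWith ⟨A.ambient.rate, A.ambient.rate_pos.le⟩ A.field :=
      LipschitzWith.of_dist_le_mul fun x y => by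
        rw [dist_eq_norm, dist_eq_norm]
        exact A.ambient.norm_sub_le y x
    exact hL.continuous
  obtain ⟨y₀, -, h₀⟩ := isCompact_univ.exists_isMinOn (univ_nonempty (α := Y))
    (hc.comp A.isClosedEmbedding.continuous).norm.continuousOn
  refine ⟨‖A.field (A.emb y₀)‖, norm_pos_iff.2 fun h => hne y₀ ?_, fun y => h₀ (mem_univ y)⟩
  rw [← A.diff_field] at h
  exact A.injective_diff y₀ (h.trans (map_zero _).symm)

variable [T2Space Y] [CompactSpace Y] {A : FlowEmbedding Z}
  {Eu Es : Y → Submodule ℝ (EuclideanSpace ℝ (Fin n))} {C θ : ℝ}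
  (hZ : ContMDiff (𝓡 n) (𝓡 n).tangent ∞ (fun y => (⟨y, Z y⟩ : TangentBundle (𝓡 n) Y)))

/-- A vector of the form `Z + s + u` controls its components. -/
theorem IsHyperbolic.exists_angle_bound (h : A.IsHyperbolic Eu Es C θ)
    (hZ : ContMDiff (𝓡 n) (𝓡 n).tangent ∞ (fun y => (⟨y, Z y⟩ : TangentBundle (𝓡 n) Y))) :
    ∃ K > 0, ∀ (y : Y) (a : ℝ), ∀ s ∈ Es y, ∀ u ∈ Eu y,
      |a| + ‖A.diff y s‖ + ‖A.diff y u‖ ≤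
        K * ‖A.diff y (a • fieldCoord Z y + s + u)‖ := by
  obtain ⟨B, hB, hBf⟩ := A.exists_field_bound
  obtain ⟨m, hm, hmf⟩ := A.exists_field_lower_bound h.ne_zero
  have hC : 0 < C := zero_lt_one.trans_le h.one_le
  have hθ := h.pos
  -- No continuity of the bundles is assumed, so the uniform angle is obtained dynamically. Flowing
  -- for time t forward bounds u, and backward bounds s, by Cε(X‖w‖ + (B + C)S), where S is the sum
  -- of the sizes of the components. The lower bound m for the field then controls a. Altogether S ≤
  -- const·‖w‖ + qεS, and t is chosen with qε ≤ 1/2 so that the last term is absorbed.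
  set q := (1 + 1 / m) * (2 * C * (B + C)) with hq
  have hq0 : 0 < q := by positivity
  obtain ⟨t, ht, hqt⟩ : ∃ t ≥ 0, q * Real.exp (-θ * t) ≤ 1 / 2 := by
    refine ⟨max 0 (Real.log (2 * q) / θ), le_max_left _ _, ?_⟩
    have h1 : Real.log (2 * q) ≤ θ * max 0 (Real.log (2 * q) / θ) := by
      rw [← div_le_iff₀' hθ]
      exact le_max_right _ _
    have h2 : 2 * q ≤ Real.exp (θ * max 0 (Real.log (2 * q) / θ)) := by
      rw [← Real.log_le_iff_le_exp (by positivity)]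
      exact h1
    rw [neg_mul, Real.exp_neg, ← div_eq_mul_inv, div_le_iff₀ (Real.exp_pos _)]
    linarith
  set ε := Real.exp (-θ * t) with hε
  have hε0 : 0 < ε := Real.exp_pos _
  have hε1 : ε ≤ 1 := Real.exp_le_one_iff.2 (by nlinarith)
  set X := Real.exp (A.ambient.rate * t) with hX
  have hX0 : 0 < X := Real.exp_pos _
  refine ⟨2 * ((1 + 1 / m) * (2 * C * ε * X) + 1 / m), by positivity, fun y a s hs u hu => ?_⟩
  set w := a • fieldCoord Z y + s + u with hw
  set S := |a| + ‖A.diff y s‖ + ‖A.diff y u‖ with hS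
  -- the differential of the flow at time `r`, read in the ambient space
  have hmove : ∀ r : ℝ, A.ambient.deriv r (A.emb y) (A.diff y w) =
      a • A.field (A.emb (flow Z r y)) + A.diff (flow Z r y) (dflow Z r y s) + A.diff (flow Z r y) (dflow Z r y u) := by
    intro r
    rw [← A.diff_dflow hZ, hw]
    simp only [map_add, map_smul, dflow_field hZ, A.diff_fieldCoord]
  have hfield : ∀ r : ℝ, ‖a • A.field (A.emb (flow Z r y))‖ ≤ B * |a| := fun r => by
    rw [norm_smul, Real.norm_eq_abs, mul_comm]
    exact mul_le_mul_of_nonneg_right (hBf _) (abs_nonneg _)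
  have hback : ∀ r v, ‖A.diff y v‖ =
      ‖A.diff (flow Z (-r) (flow Z r y)) (dflow Z (-r) (flow Z r y) (dflow Z r y v))‖ := by
    intro r v
    rw [dflow_neg_dflow hZ, flow_neg_flow hZ]
  -- After time t the stable and flow components are still bounded, so the image of u is controlled
  -- by that of w; coming back contracts it by Cε.
  have hu' : ‖A.diff y u‖ ≤ C * ε * (X * ‖A.diff y w‖ + (B + C) * S) := by
    have h1 : ‖A.diff y u‖ ≤ C * ε * ‖A.diff (flow Z t y) (dflow Z t y u)‖ := by
      rw [hback t u]
      exact h.unstable_le t ht _ _ (h.dflow_mem_unstable t y u hu)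
    have h2 : A.diff (flow Z t y) (dflow Z t y u) = A.ambient.deriv t (A.emb y) (A.diff y w) -
        a • A.field (A.emb (flow Z t y)) - A.diff (flow Z t y) (dflow Z t y s) := by
      rw [hmove t]
      abel
    have h3 : ‖A.ambient.deriv t (A.emb y) (A.diff y w)‖ ≤ X * ‖A.diff y w‖ := by
      have := A.ambient.norm_deriv_apply_le (A.emb y) (A.diff y w) t
      rwa [abs_of_nonneg ht] at this
    have h4 : ‖A.diff (flow Z t y) (dflow Z t y s)‖ ≤ C * ‖A.diff y s‖ := by
      refine (h.stable_le t ht y s hs).trans ?_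
      have : C * ε * ‖A.diff y s‖ ≤ C * 1 * ‖A.diff y s‖ := by gcongr
      rw [mul_one] at this
      exact this
    refine h1.trans ?_
    gcongr
    rw [h2]
    refine (norm_sub_le _ _).trans ((add_le_add (norm_sub_le _ _) le_rfl).trans ?_)
    have h5 := hfield t
    have h6 : 0 ≤ ‖A.diff y u‖ := norm_nonneg _
    have h7 : 0 ≤ ‖A.diff y s‖ := norm_nonneg _
    have h8 : 0 ≤ |a| := abs_nonneg _
    nlinarith
  have hs' : ‖A.diff y s‖ ≤ C * ε * (X * ‖A.diff y w‖ + (B + C) * S) := by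
    have h1 : ‖A.diff y s‖ ≤ C * ε * ‖A.diff (flow Z (-t) y) (dflow Z (-t) y s)‖ := by
      rw [hback (-t) s]
      have := h.stable_le t ht _ _ (h.dflow_mem_stable (-t) y s hs)
      rw [neg_neg]
      exact this
    have h2 : A.diff (flow Z (-t) y) (dflow Z (-t) y s) = A.ambient.deriv (-t) (A.emb y) (A.diff y w) -
        a • A.field (A.emb (flow Z (-t) y)) - A.diff (flow Z (-t) y) (dflow Z (-t) y u) := by
      rw [hmove (-t)]
      abel
    have h3 : ‖A.ambient.deriv (-t) (A.emb y) (A.diff y w)‖ ≤ X * ‖A.diff y w‖ := by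
      have := A.ambient.norm_deriv_apply_le (A.emb y) (A.diff y w) (-t)
      rwa [abs_neg, abs_of_nonneg ht] at this
    have h4 : ‖A.diff (flow Z (-t) y) (dflow Z (-t) y u)‖ ≤ C * ‖A.diff y u‖ := by
      refine (h.unstable_le t ht y u hu).trans ?_
      have : C * ε * ‖A.diff y u‖ ≤ C * 1 * ‖A.diff y u‖ := by gcongr
      rw [mul_one] at this
      exact this
    refine h1.trans ?_
    gcongr
    rw [h2]
    refine (norm_sub_le _ _).trans ((add_le_add (norm_sub_le _ _) le_rfl).trans ?_)
    have h5 := hfield (-t)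
    have h6 : 0 ≤ ‖A.diff y u‖ := norm_nonneg _
    have h7 : 0 ≤ ‖A.diff y s‖ := norm_nonneg _
    have h8 : 0 ≤ |a| := abs_nonneg _
    nlinarith
  have ha : |a| ≤ 1 / m * (‖A.diff y w‖ + ‖A.diff y s‖ + ‖A.diff y u‖) := by
    have h1 : a • A.field (A.emb y) = A.diff y w - A.diff y s - A.diff y u := by
      rw [hw]
      simp only [map_add, map_smul, A.diff_fieldCoord]
      abel
    have h2 : |a| * m ≤ ‖A.diff y w‖ + ‖A.diff y s‖ + ‖A.diff y u‖ := by
      calc |a| * m ≤ |a| * ‖A.field (A.emb y)‖ := by gcongr; exact hmf y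
        _ = ‖a • A.field (A.emb y)‖ := by rw [norm_smul, Real.norm_eq_abs]
        _ ≤ _ := by
          rw [h1]
          exact (norm_sub_le _ _).trans (add_le_add (norm_sub_le _ _) le_rfl)
    rw [one_div, inv_mul_eq_div, le_div_iff₀ hm]
    exact h2
  have hm' : 0 < 1 / m := by positivity
  have hSle : S ≤ (1 + 1 / m) * (‖A.diff y s‖ + ‖A.diff y u‖) + 1 / m * ‖A.diff y w‖ := by
    rw [hS]
    linarith
  have hS0 : 0 ≤ S := by positivity
  have h9 : (1 + 1 / m) * (‖A.diff y s‖ + ‖A.diff y u‖) ≤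
      (1 + 1 / m) * (2 * (C * ε * (X * ‖A.diff y w‖ + (B + C) * S))) := by
    gcongr
    linarith
  have h10 : (1 + 1 / m) * (2 * (C * ε * (X * ‖A.diff y w‖ + (B + C) * S))) =
      (1 + 1 / m) * (2 * C * ε * X) * ‖A.diff y w‖ + (q * ε) * S := by
    rw [hq]
    ring
  have h11 : (q * ε) * S ≤ 1 / 2 * S := by gcongr
  linarith

/-- Second order expansion of the flow in time. -/
theorem norm_emb_flow_sub_le (hZ : ContMDiff (𝓡 n) (𝓡 n).tangent ∞
    (fun y => (⟨y, Z y⟩ : TangentBundle (𝓡 n) Y))) {B : ℝ}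
    (hB : ∀ y, ‖A.field (A.emb y)‖ ≤ B) (τ : ℝ) (p : Y) :
    ‖A.emb (flow Z τ p) - A.emb p - τ • A.field (A.emb p)‖ ≤ A.ambient.rate * B * τ ^ 2 := by
  have hd : ∀ s, HasDerivAt (fun s => A.emb (flow Z s p)) (A.field (A.emb (flow Z s p))) s :=
    fun s => A.hasDerivAt_emb_comp (isMIntegralCurve_flow hZ p s)
  have hB0 : 0 ≤ B := (norm_nonneg _).trans (hB p)
  have h1 : ∀ s, ‖A.emb (flow Z s p) - A.emb p‖ ≤ B * |s| := by
    intro s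
    have := convex_univ.norm_image_sub_le_of_norm_hasDerivWithin_le (𝕜 := ℝ)
      (f := fun s => A.emb (flow Z s p)) (C := B) (x := 0) (y := s)
      (fun r _ => (hd r).hasDerivWithinAt) (fun r _ => hB _) (mem_univ _) (mem_univ _)
    simpa [flow_zero hZ] using this
  have hd2 : ∀ s, HasDerivAt (fun s => A.emb (flow Z s p) - s • A.field (A.emb p))
      (A.field (A.emb (flow Z s p)) - A.field (A.emb p)) s := fun s => by
    simpa using! (hd s).sub ((hasDerivAt_id s).smul_const (A.field (A.emb p)))
  have h2 := (convex_uIcc 0 τ).norm_image_sub_le_of_norm_hasDerivWithin_le (𝕜 := ℝ)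
      (f := fun s => A.emb (flow Z s p) - s • A.field (A.emb p))
      (C := A.ambient.rate * (B * |τ|)) (x := 0) (y := τ)
      (fun r _ => (hd2 r).hasDerivWithinAt) (fun r hr => by
        refine (A.ambient.norm_sub_le _ _).trans ?_
        have hr0 := A.ambient.rate_pos
        refine mul_le_mul_of_nonneg_left ((h1 r).trans ?_) hr0.le
        refine mul_le_mul_of_nonneg_left ?_ hB0
        have := abs_sub_left_of_mem_uIcc hr
        simpa using this) left_mem_uIcc right_mem_uIcc
  simp only [flow_zero hZ, zero_smul, sub_zero, Real.norm_eq_abs] at h2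
  have h3 : A.emb (flow Z τ p) - A.emb p - τ • A.field (A.emb p) =
      A.emb (flow Z τ p) - τ • A.field (A.emb p) - A.emb p := by abel
  rw [h3]
  refine h2.trans (le_of_eq ?_)
  rw [← sq_abs τ]
  ring

end FlowEmbedding

end Hyperbolic

/-! ### Quantitative isolation of closed trajectories -/

section Isolation

open Set Metric

variable {n : ℕ} {Y : Type*} [TopologicalSpace Y] [ChartedSpace (EuclideanSpace ℝ (Fin n)) Y]
  [IsManifold (𝓡 n) ∞ Y] {Z : (y : Y) → TangentSpace (𝓡 n) y} [T2Space Y] [CompactSpace Y]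

namespace FlowEmbedding

variable {A : FlowEmbedding Z}
  {Eu Es : Y → Submodule ℝ (EuclideanSpace ℝ (Fin n))} {C θ : ℝ}

/-- On the trajectory of a periodic point there is a point nearest to `x`, where the secant to `x`
is orthogonal to the trajectory. -/
theorem exists_nearest_point (A : FlowEmbedding Z)
    (hZ : ContMDiff (𝓡 n) (𝓡 n).tangent ∞ (fun y => (⟨y, Z y⟩ : TangentBundle (𝓡 n) Y)))
    (x y : Y) {T : ℝ} (hT : 0 < T) (hy : flow Z T y = y) :
    ∃ s, ‖A.emb (flow Z s y) - A.emb x‖ ≤ ‖A.emb y - A.emb x‖ ∧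
      inner ℝ (A.emb (flow Z s y) - A.emb x) (A.field (A.emb (flow Z s y))) = 0 := by
  have hd : ∀ s, HasDerivAt (fun s => A.emb (flow Z s y) - A.emb x)
      (A.field (A.emb (flow Z s y))) s :=
    fun s => (A.hasDerivAt_emb_comp (isMIntegralCurve_flow hZ y s)).sub_const _
  set f : ℝ → ℝ := fun s => ‖A.emb (flow Z s y) - A.emb x‖ ^ 2 with hf
  have hfc : Continuous f := by
    have : Continuous fun s => A.emb (flow Z s y) - A.emb x :=
      continuous_iff_continuousAt.2 fun s => (hd s).continuousAt
    exact this.norm.pow 2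
  -- Periodicity makes the minimum over one period a global one, hence a critical point; the
  -- vanishing derivative is the orthogonality.
  have hper : Function.Periodic f T := fun s => by
    simp only [hf]
    rw [flow_add hZ, hy]
  obtain ⟨s, -, hs⟩ := (isCompact_Icc (a := (0 : ℝ)) (b := T)).exists_isMinOn
    (nonempty_Icc.2 hT.le) hfc.continuousOn
  have hmin : ∀ r, f s ≤ f r := fun r => by
    obtain ⟨r', hr', hrr⟩ := hper.exists_mem_Ico₀ hT r
    rw [hrr]
    exact hs (Ico_subset_Icc_self hr')
  refine ⟨s, ?_, ?_⟩
  · have h0 := hmin 0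
    simp only [hf, flow_zero hZ] at h0
    exact (sq_le_sq₀ (norm_nonneg _) (norm_nonneg _)).1 h0
  · have h1 : HasDerivAt f (2 * inner ℝ (A.emb (flow Z s y) - A.emb x)
        (A.field (A.emb (flow Z s y)))) s := (hd s).norm_sq
    have h2 : IsLocalMin f s := Filter.Eventually.of_forall hmin
    have h3 := h2.hasDerivAt_eq_zero h1
    linarith

set_option maxHeartbeats 1000000 in
/-- Periodic points of long period are isolated on an exponentially small scale: quantitative
form for a point whose secant is orthogonal to its trajectory. -/
theorem IsHyperbolic.exists_isolation_of_orthogonal (h : A.IsHyperbolic Eu Es C θ)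
    (hZ : ContMDiff (𝓡 n) (𝓡 n).tangent ∞ (fun y => (⟨y, Z y⟩ : TangentBundle (𝓡 n) Y))) :
    ∃ Q > 0, ∃ T₀ > 0, ∀ (x y : Y) (T τ : ℝ), T₀ ≤ T → flow Z T x = x → flow Z (τ + T) y = y →
      ‖A.emb y - A.emb x‖ ≤ 1 → inner ℝ (A.emb y - A.emb x) (A.field (A.emb y)) = 0 →
      ‖A.emb y - A.emb x‖ + |τ| ≤
        Q * Real.exp (3 * A.ambient.rate * T) * (‖A.emb y - A.emb x‖ + |τ|) ^ 2 := by
  obtain ⟨B, hB, hBf⟩ := A.exists_field_bound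
  obtain ⟨c, hc, hsec⟩ := A.exists_secant_bound
  obtain ⟨K, hK, hang⟩ := h.exists_angle_bound hZ
  have hθ := h.pos
  have hC0 : 0 < C := zero_lt_one.trans_le h.one_le
  set L := A.ambient.rate with hL
  set M := A.ambient.curv with hM
  have hL0 : 0 < L := A.ambient.rate_pos
  have hM0 : 0 ≤ M := A.ambient.curv_nonneg
  set q := 2 * c + M + L + L * B with hq
  have hq0 : 0 < q := by positivity
  -- T₀ is chosen so that C e^{-θT} ≤ 1/2 for T ≥ T₀. In Q the first two terms come from the
  -- component of w along the field, and 4Kq from the equation for the other components and τ.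
  refine ⟨K * L * (1 + c) + c + 4 * K * q, by positivity, 1 + |Real.log (2 * C)| / θ,
    by positivity, fun x y T τ hT hx hy hw1 hperp => ?_⟩
  have hT0 : 0 ≤ T := le_trans (by positivity) hT
  have hhalf : C * Real.exp (-θ * T) ≤ 1 / 2 := by
    have h1 : Real.log (2 * C) ≤ θ * T := by
      have h2 : |Real.log (2 * C)| / θ ≤ T := by linarith
      rw [div_le_iff₀ hθ] at h2
      linarith [le_abs_self (Real.log (2 * C))]
    have h2 : 2 * C ≤ Real.exp (θ * T) := by
      rw [← Real.log_le_iff_le_exp (by positivity)]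
      exact h1
    rw [neg_mul, Real.exp_neg, ← div_eq_mul_inv, div_le_iff₀ (Real.exp_pos _)]
    linarith
  set w := A.emb y - A.emb x with hw
  obtain ⟨v, hv⟩ := hsec x y
  rw [← hw] at hv
  set r₀ := w - A.diff x v with hr₀
  obtain ⟨a, s, hs, u, hu, hvd⟩ := h.exists_decomp x v
  set P := dflow Z T x with hP
  set X := A.field (A.emb x) with hX
  set D := A.ambient.deriv T (A.emb x) with hD
  set E₁ := Real.exp (L * T) with hE₁
  set E₃ := Real.exp (3 * L * T) with hE₃
  have hE₁pos : 0 < E₁ := Real.exp_pos _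
  have hE₃1 : 1 ≤ E₃ := Real.one_le_exp (by positivity)
  have hE₁₃ : E₁ ≤ E₃ := Real.exp_le_exp.2 (by linarith [mul_nonneg hL0.le hT0])
  set W := ‖w‖ + |τ| with hW
  have hwW : ‖w‖ ≤ W := by rw [hW]; linarith [abs_nonneg τ]
  have hτW : |τ| ≤ W := by rw [hW]; linarith [norm_nonneg w]
  have hW0 : 0 ≤ W := (norm_nonneg _).trans hwW
  -- the equation `w = D w + τ X + O(W²)`
  set p := flow Z T y with hp
  set r₁ := A.emb y - A.emb p - τ • A.field (A.emb p) with hr₁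
  have hr₁le : ‖r₁‖ ≤ L * B * τ ^ 2 := by
    have h1 := norm_emb_flow_sub_le (A := A) hZ hBf τ p
    rw [hp, ← flow_add hZ, hy] at h1
    exact h1
  set r₂ := A.emb p - A.emb x - D w with hr₂
  have hr₂le : ‖r₂‖ ≤ M * E₃ * ‖w‖ ^ 2 := by
    have h1 := A.ambient.norm_map_sub_sub_le (A.emb x) (A.emb y) T
    rw [← A.emb_flow hZ, ← A.emb_flow hZ, hx, abs_of_nonneg hT0] at h1
    exact h1
  set r₃ := A.field (A.emb p) - X with hr₃
  have hr₃le : ‖r₃‖ ≤ L * (E₁ * ‖w‖) := by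
    refine (A.ambient.norm_sub_le _ _).trans ?_
    have h1 := A.ambient.norm_map_sub_le (A.emb x) (A.emb y) T
    rw [← A.emb_flow hZ, ← A.emb_flow hZ, hx, abs_of_nonneg hT0] at h1
    exact mul_le_mul_of_nonneg_left h1 hL0.le
  have hDr₀ : ‖D r₀‖ ≤ E₁ * ‖r₀‖ := by
    have h1 := A.ambient.norm_deriv_apply_le (A.emb x) r₀ T
    rwa [abs_of_nonneg hT0] at h1
  have hdiff : ∀ z, A.diff x (P z) = D (A.diff x z) := fun z => by
    have h1 := A.diff_dflow hZ T x z
    rw [hx] at h1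
    exact h1
  -- All errors are quadratic in W: the secant defect before and after the flow, the Taylor
  -- remainder of the flow, the change of the field from x to p, and the time expansion over τ.
  set R := -r₀ + D r₀ + r₂ + τ • r₃ + r₁ with hR
  have hPs : P s ∈ Es x := by
    have := h.dflow_mem_stable T x s hs
    rwa [hx] at this
  have hPu : P u ∈ Eu x := by
    have := h.dflow_mem_unstable T x u hu
    rwa [hx] at this
  have hPZ : P (fieldCoord Z x) = fieldCoord Z x := by
    have := dflow_field hZ T x
    rwa [hx] at this
  -- P fixes Z, so the coefficient a of v along Z drops out of v - P v and only τ remains in that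
  -- direction. The size of a is recovered below from orthogonality.
  have hmain : A.diff x ((-τ) • fieldCoord Z x + (s - P s) + (u - P u)) = R := by
    have e1 : (-τ) • fieldCoord Z x + (s - P s) + (u - P u) =
        v - P v - τ • fieldCoord Z x := by
      rw [hvd]
      simp only [map_add, map_smul, hPZ]
      module
    rw [e1]
    simp only [map_sub, map_smul, hdiff, A.diff_fieldCoord]
    have e2 : A.diff x v = w - r₀ := by rw [hr₀]; abel
    rw [e2, map_sub, hR, hr₁, hr₂, hr₃, hw, smul_sub]
    abel
  have hRle : ‖R‖ ≤ q * E₃ * W ^ 2 := by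
    have t0 : ‖r₀‖ ≤ c * E₃ * W ^ 2 := by
      calc ‖r₀‖ ≤ c * ‖w‖ ^ 2 := hv
        _ ≤ c * W ^ 2 := by gcongr
        _ ≤ c * E₃ * W ^ 2 := by
          gcongr
          exact le_mul_of_one_le_right hc.le hE₃1
    have t1 : ‖D r₀‖ ≤ c * E₃ * W ^ 2 := by
      calc ‖D r₀‖ ≤ E₁ * ‖r₀‖ := hDr₀
        _ ≤ E₃ * (c * W ^ 2) := by
          gcongr
          exact hv.trans (by gcongr)
        _ = _ := by ring
    have t2 : ‖r₂‖ ≤ M * E₃ * W ^ 2 := hr₂le.trans (by gcongr)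
    have t3 : ‖τ • r₃‖ ≤ L * E₃ * W ^ 2 := by
      rw [norm_smul, Real.norm_eq_abs]
      calc |τ| * ‖r₃‖ ≤ W * (L * (E₃ * W)) := by
            gcongr
            exact hr₃le.trans (by gcongr)
        _ = _ := by ring
    have t4 : ‖r₁‖ ≤ L * B * E₃ * W ^ 2 := by
      calc ‖r₁‖ ≤ L * B * τ ^ 2 := hr₁le
        _ = L * B * |τ| ^ 2 := by rw [sq_abs]
        _ ≤ L * B * W ^ 2 := by gcongr
        _ ≤ _ := mul_le_mul_of_nonneg_right
          (le_mul_of_one_le_right (by positivity) hE₃1) (by positivity)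
    have t5 : ‖R‖ ≤ ‖r₀‖ + ‖D r₀‖ + ‖r₂‖ + ‖τ • r₃‖ + ‖r₁‖ := by
      rw [hR]
      refine (norm_add_le _ _).trans (add_le_add ?_ le_rfl)
      refine (norm_add_le _ _).trans (add_le_add ?_ le_rfl)
      refine (norm_add_le _ _).trans (add_le_add ?_ le_rfl)
      refine (norm_add_le _ _).trans (add_le_add ?_ le_rfl)
      rw [norm_neg]
    have t6 : q * E₃ * W ^ 2 = c * E₃ * W ^ 2 + c * E₃ * W ^ 2 + M * E₃ * W ^ 2 +
        L * E₃ * W ^ 2 + L * B * E₃ * W ^ 2 := by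
      rw [hq]
      ring
    linarith
  have hcomp := hang x (-τ) _ ((Es x).sub_mem hs hPs) _ ((Eu x).sub_mem hu hPu)
  rw [hmain, abs_neg] at hcomp
  -- the hyperbolic components
  have hs2 : ‖A.diff x s‖ ≤ 2 * ‖A.diff x (s - P s)‖ := by
    have h1 : ‖A.diff x (P s)‖ ≤ 1 / 2 * ‖A.diff x s‖ := by
      have h2 := h.stable_le T hT0 x s hs
      rw [hx] at h2
      exact h2.trans (mul_le_mul_of_nonneg_right hhalf (norm_nonneg _))
    have h3 : ‖A.diff x s‖ ≤ ‖A.diff x (s - P s)‖ + ‖A.diff x (P s)‖ := by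
      rw [map_sub]
      exact norm_le_norm_sub_add _ _
    linarith
  -- Returning by time -T halves norms on the unstable space, so P at least doubles them there.
  have hu2 : ‖A.diff x u‖ ≤ ‖A.diff x (u - P u)‖ := by
    have h1 : ‖A.diff x u‖ ≤ 1 / 2 * ‖A.diff x (P u)‖ := by
      have h2 := h.unstable_le T hT0 _ _ (h.dflow_mem_unstable T x u hu)
      rw [dflow_neg_dflow hZ, flow_neg_flow hZ, hx] at h2
      exact h2.trans (mul_le_mul_of_nonneg_right hhalf (norm_nonneg _))
    have h3 : ‖A.diff x (P u)‖ ≤ ‖A.diff x u‖ + ‖A.diff x (u - P u)‖ := by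
      rw [map_sub]
      exact norm_le_norm_add_norm_sub _ _
    linarith [norm_nonneg (A.diff x (u - P u))]
  have hdv : A.diff x v = a • X + A.diff x s + A.diff x u := by
    rw [hvd]
    simp only [map_add, map_smul, A.diff_fieldCoord, hX]
  -- Since ‖w‖ ≤ 1 the quadratic secant defect is at most c‖w‖, so v has size at most (1 + c)‖w‖ and
  -- the angle bound applies.
  have ha : |a| ≤ K * (1 + c) * ‖w‖ := by
    have h1 := hang x a s hs u hu
    rw [← hvd] at h1
    have h2 : ‖A.diff x v‖ ≤ (1 + c) * ‖w‖ := by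
      have h3 : A.diff x v = w - r₀ := by rw [hr₀]; abel
      rw [h3]
      refine (norm_sub_le _ _).trans ?_
      have h4 : ‖w‖ ^ 2 ≤ ‖w‖ := pow_le_of_le_one (norm_nonneg _) hw1 two_ne_zero
      have h5 := mul_le_mul_of_nonneg_left h4 hc.le
      linarith
    calc |a| ≤ |a| + ‖A.diff x s‖ + ‖A.diff x u‖ := by
          linarith [norm_nonneg (A.diff x s), norm_nonneg (A.diff x u)]
      _ ≤ K * ‖A.diff x v‖ := h1
      _ ≤ K * ((1 + c) * ‖w‖) := by gcongr
      _ = _ := by ring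
  -- Orthogonality holds for the field at y; replacing it by the field at x costs L‖w‖, so ⟨w, X⟩ =
  -- O(‖w‖²). Pairing w = aX + s + u + r₀, read in the ambient space, with w and dividing by ‖w‖
  -- leaves only s, u and quadratic terms.
  have hwle : ‖w‖ ≤ (K * L * (1 + c) + c) * ‖w‖ ^ 2 + ‖A.diff x s‖ + ‖A.diff x u‖ := by
    rcases eq_or_ne w 0 with h0 | h0
    · rw [h0, norm_zero]
      positivity
    have hpos : 0 < ‖w‖ := norm_pos_iff.2 h0
    have h1 : inner ℝ w X ≤ L * ‖w‖ ^ 2 ∧ -(L * ‖w‖ ^ 2) ≤ inner ℝ w X := by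
      have h2 : inner ℝ w X = -inner ℝ w (A.field (A.emb y) - X) := by
        rw [inner_sub_right, hperp]
        ring
      have h3 : |inner ℝ w (A.field (A.emb y) - X)| ≤ ‖w‖ * (L * ‖w‖) :=
        (abs_real_inner_le_norm _ _).trans
          (mul_le_mul_of_nonneg_left (A.ambient.norm_sub_le _ _) (norm_nonneg _))
      have h4 := abs_le.1 h3
      have h5 : ‖w‖ * (L * ‖w‖) = L * ‖w‖ ^ 2 := by ring
      rw [h5] at h4
      rw [h2]
      constructor <;> linarith
    have h5 : ‖w‖ ^ 2 = a * inner ℝ w X + inner ℝ w (A.diff x s + A.diff x u + r₀) := by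
      rw [← real_inner_self_eq_norm_sq, ← real_inner_smul_right, ← inner_add_right]
      congr 1
      rw [hr₀, hdv]
      abel
    have h6 : a * inner ℝ w X ≤ |a| * (L * ‖w‖ ^ 2) := by
      refine (le_abs_self _).trans ?_
      rw [abs_mul]
      gcongr
      exact abs_le.2 ⟨h1.2, h1.1⟩
    have h7 : inner ℝ w (A.diff x s + A.diff x u + r₀) ≤
        ‖w‖ * (‖A.diff x s‖ + ‖A.diff x u‖ + c * ‖w‖ ^ 2) := by
      refine (real_inner_le_norm _ _).trans ?_
      gcongr
      refine (norm_add_le _ _).trans (add_le_add (norm_add_le _ _) hv)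
    have h8 : |a| * (L * ‖w‖ ^ 2) ≤ K * (1 + c) * ‖w‖ * (L * ‖w‖ ^ 2) := by gcongr
    have h9 : ‖w‖ * ‖w‖ ≤
        ‖w‖ * ((K * L * (1 + c) + c) * ‖w‖ ^ 2 + ‖A.diff x s‖ + ‖A.diff x u‖) := by
      calc ‖w‖ * ‖w‖ = ‖w‖ ^ 2 := by ring
        _ ≤ K * (1 + c) * ‖w‖ * (L * ‖w‖ ^ 2) +
            ‖w‖ * (‖A.diff x s‖ + ‖A.diff x u‖ + c * ‖w‖ ^ 2) := by linarith
        _ = _ := by ring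
    exact le_of_mul_le_mul_left h9 hpos
  have hfin : (K * L * (1 + c) + c) * ‖w‖ ^ 2 ≤ (K * L * (1 + c) + c) * E₃ * W ^ 2 := by
    calc (K * L * (1 + c) + c) * ‖w‖ ^ 2 ≤ (K * L * (1 + c) + c) * W ^ 2 := by gcongr
      _ ≤ _ := by
        gcongr
        exact le_mul_of_one_le_right (by positivity) hE₃1
  have hKR : K * ‖R‖ ≤ K * (q * E₃ * W ^ 2) := by gcongr
  have e : (K * L * (1 + c) + c + 4 * K * q) * E₃ * W ^ 2 =
      (K * L * (1 + c) + c) * E₃ * W ^ 2 + 4 * (K * (q * E₃ * W ^ 2)) := by ring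
  rw [e]
  have n1 := norm_nonneg (A.diff x (s - P s))
  have n2 := norm_nonneg (A.diff x (u - P u))
  have n3 := abs_nonneg τ
  have hK0 : 0 ≤ K * ‖R‖ := by positivity
  change ‖w‖ + |τ| ≤ _
  linarith

/-- Closed trajectories are isolated on an exponentially small scale. -/
theorem IsHyperbolic.exists_isolation (h : A.IsHyperbolic Eu Es C θ)
    (hZ : ContMDiff (𝓡 n) (𝓡 n).tangent ∞ (fun y => (⟨y, Z y⟩ : TangentBundle (𝓡 n) Y))) :
    ∃ η > 0, ∃ c > 0, ∃ T₀ > 0, ∀ (x y : Y) (T T' : ℝ), T₀ ≤ T → 0 < T' → flow Z T x = x →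
      flow Z T' y = y → ‖A.emb y - A.emb x‖ ≤ η * Real.exp (-c * T) →
      |T' - T| ≤ η * Real.exp (-c * T) → ∃ s, flow Z s y = x := by
  obtain ⟨Q, hQ, T₀, hT₀, hiso⟩ := h.exists_isolation_of_orthogonal hZ
  have hL0 := A.ambient.rate_pos
  -- The bound 1 keeps ‖w‖ ≤ 1; the bound 1/(4Q) is half of the admissible 1/(2Q), because W is a
  -- sum of two terms.
  refine ⟨min 1 (1 / (4 * Q)), by positivity, 3 * A.ambient.rate, by positivity, T₀, hT₀,
    fun x y T T' hT hT' hx hy hxy hTT => ?_⟩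
  obtain ⟨s, hs1, hs2⟩ := A.exists_nearest_point hZ x y hT' hy
  refine ⟨s, ?_⟩
  have hTpos : 0 < T := hT₀.trans_le hT
  set ε := Real.exp (-(3 * A.ambient.rate) * T) with hε
  have hε0 : 0 < ε := Real.exp_pos _
  have hε1 : ε ≤ 1 := Real.exp_le_one_iff.2 (by nlinarith [mul_pos hL0 hTpos])
  have hη : min 1 (1 / (4 * Q)) * ε ≤ 1 / (4 * Q) * ε := by
    gcongr
    exact min_le_right _ _
  have hη1 : min 1 (1 / (4 * Q)) * ε ≤ 1 := by
    calc min 1 (1 / (4 * Q)) * ε ≤ 1 * 1 := by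
          gcongr
          exact min_le_left _ _
      _ = 1 := one_mul 1
  have hper : flow Z (T' - T + T) (flow Z s y) = flow Z s y := by
    rw [sub_add_cancel, ← flow_add hZ, add_comm, flow_add hZ, hy]
  have hmain := hiso x (flow Z s y) T (T' - T) hT hx hper ((hs1.trans hxy).trans hη1) hs2
  set W := ‖A.emb (flow Z s y) - A.emb x‖ + |T' - T| with hW
  have hW0 : 0 ≤ W := by positivity
  have hWle : W ≤ 1 / (2 * Q) * ε := by
    have e : 1 / (2 * Q) * ε = 1 / (4 * Q) * ε + 1 / (4 * Q) * ε := by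
      field_simp
      ring
    rw [e]
    linarith [hs1.trans (hxy.trans hη), hTT.trans hη]
  have hX : Real.exp (3 * A.ambient.rate * T) * ε = 1 := by
    rw [hε, ← Real.exp_add]
    simp
  -- Below the scale e^{-3LT}/(2Q) the quadratic inequality forces W = 0, so the nearest point is x
  -- itself.
  have hzero : W ≤ 1 / 2 * W := by
    calc W ≤ Q * Real.exp (3 * A.ambient.rate * T) * W ^ 2 := hmain
      _ = Q * Real.exp (3 * A.ambient.rate * T) * W * W := by ring
      _ ≤ Q * Real.exp (3 * A.ambient.rate * T) * (1 / (2 * Q) * ε) * W := by gcongr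
      _ = (Q * (1 / (2 * Q))) * (Real.exp (3 * A.ambient.rate * T) * ε) * W := by ring
      _ = 1 / 2 * W := by
        rw [hX]
        field_simp
  have hw0 : ‖A.emb (flow Z s y) - A.emb x‖ = 0 := by
    have h1 := norm_nonneg (A.emb (flow Z s y) - A.emb x)
    have h2 := abs_nonneg (T' - T)
    linarith
  exact A.isClosedEmbedding.injective (sub_eq_zero.1 (norm_eq_zero.1 hw0))

end FlowEmbedding

end Isolation

/-! ### Counting closed trajectories -/

section Packing

open Set Metric MeasureTheory

/-- A packing estimate: the volumes of disjoint balls in a bounded region are summable. -/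
theorem summable_pow_of_disjoint_balls {P : Type*} [NormedAddCommGroup P] [NormedSpace ℝ P]
    [FiniteDimensional ℝ P] {Γ : Type*} {q : Γ → P} {r : Γ → ℝ} {R : ℝ}
    (hr : ∀ γ, 0 < r γ) (hr1 : ∀ γ, r γ ≤ 1) (hq : ∀ γ, ‖q γ‖ ≤ R)
    (hsep : ∀ γ γ', γ ≠ γ' → r γ + r γ' ≤ dist (q γ) (q γ')) :
    Summable fun γ => r γ ^ Module.finrank ℝ P := by
  borelize P
  set μ : Measure P := Measure.addHaar with hμ
  set d := Module.finrank ℝ P with hd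
  have hfin : μ (ball 0 (R + 2)) ≠ ⊤ := measure_ball_lt_top.ne
  have h1 : μ (ball 0 1) ≠ ⊤ := measure_ball_lt_top.ne
  have h1' : 0 < (μ (ball 0 1)).toReal :=
    ENNReal.toReal_pos (measure_ball_pos μ 0 one_pos).ne' h1
  refine summable_of_sum_le (c := (μ (ball 0 (R + 2))).toReal / (μ (ball 0 1)).toReal)
    (fun γ => pow_nonneg (hr γ).le _) fun s => ?_
  have hball : ∀ γ, μ (ball (q γ) (r γ)) = ENNReal.ofReal (r γ ^ d) * μ (ball 0 1) := fun γ =>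
    Measure.addHaar_ball_of_pos μ (q γ) (hr γ)
  have hdis : (s : Set Γ).PairwiseDisjoint fun γ => ball (q γ) (r γ) := fun γ _ γ' _ hne =>
    ball_disjoint_ball (hsep γ γ' hne)
  have hsub : (⋃ γ ∈ s, ball (q γ) (r γ)) ⊆ ball 0 (R + 2) := by
    refine iUnion₂_subset fun γ _ z hz => ?_
    rw [mem_ball_zero_iff]
    have h2 : ‖z - q γ‖ < r γ := by simpa [dist_eq_norm] using hz
    have h3 := norm_le_norm_add_norm_sub' z (q γ)
    linarith [hq γ, hr1 γ]
  have hsum : ∑ γ ∈ s, ENNReal.ofReal (r γ ^ d) * μ (ball 0 1) ≤ μ (ball 0 (R + 2)) := by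
    calc ∑ γ ∈ s, ENNReal.ofReal (r γ ^ d) * μ (ball 0 1) = ∑ γ ∈ s, μ (ball (q γ) (r γ)) :=
          Finset.sum_congr rfl fun γ _ => (hball γ).symm
      _ = μ (⋃ γ ∈ s, ball (q γ) (r γ)) :=
          (measure_biUnion_finset hdis fun γ _ => measurableSet_ball).symm
      _ ≤ _ := measure_mono hsub
  rw [le_div_iff₀ h1']
  have h4 := ENNReal.toReal_mono hfin hsum
  rw [← Finset.sum_mul, ENNReal.toReal_mul,
    ← ENNReal.ofReal_sum_of_nonneg fun γ _ => pow_nonneg (hr γ).le _,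
    ENNReal.toReal_ofReal (Finset.sum_nonneg fun γ _ => pow_nonneg (hr γ).le _)] at h4
  exact h4

/-- Exponential counting from exponential separation. -/
theorem summable_exp_of_separated {E : Type*} [NormedAddCommGroup E] [NormedSpace ℝ E]
    [FiniteDimensional ℝ E] {Γ : Type*} {p : Γ → E} {T : Γ → ℝ} {R η c : ℝ} (hη : 0 < η)
    (hc : 0 < c) (hT : ∀ γ, 0 ≤ T γ) (hp : ∀ γ, ‖p γ‖ ≤ R)
    (hsep : ∀ γ γ', ‖p γ' - p γ‖ ≤ η * Real.exp (-c * T γ) →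
      |T γ' - T γ| ≤ η * Real.exp (-c * T γ) → γ = γ') :
    ∃ b > 0, Summable fun γ => Real.exp (-b * T γ) := by
  set κ := min (η / 4) (1 / 4) with hκ
  have hκ0 : 0 < κ := by positivity
  have hκη : 4 * κ ≤ η := by linarith [min_le_left (η / 4) (1 / 4)]
  have hκ1 : 4 * κ ≤ 1 := by linarith [min_le_right (η / 4) (1 / 4)]
  -- Periods are recorded through the bounded coordinate e^{-T}, so that all centres lie in a
  -- bounded region of E × ℝ. A change Δ of T alters that coordinate by about e^{-T}Δ, which is why
  -- the radius carries an extra factor e^{-T}.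
  set r : Γ → ℝ := fun γ => κ * Real.exp (-(c + 1) * T γ) with hr
  have hrpos : ∀ γ, 0 < r γ := fun γ => by positivity
  have hexp1 : ∀ γ, Real.exp (-(c + 1) * T γ) ≤ 1 := fun γ =>
    Real.exp_le_one_iff.2 (by nlinarith [hT γ])
  have hclose : ∀ γ γ', T γ ≤ T γ' →
      dist (p γ, Real.exp (-T γ)) (p γ', Real.exp (-T γ')) < r γ + r γ' → γ = γ' := by
    intro γ γ' hle hdist
    have hrle : r γ' ≤ r γ := by
      refine mul_le_mul_of_nonneg_left (Real.exp_le_exp.2 ?_) hκ0.le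
      exact mul_le_mul_of_nonpos_left hle (by linarith)
    have hexp : Real.exp (-(c + 1) * T γ) = Real.exp (-c * T γ) * Real.exp (-T γ) := by
      rw [← Real.exp_add]
      congr 1
      ring
    have he1 : Real.exp (-T γ) ≤ 1 := Real.exp_le_one_iff.2 (by linarith [hT γ])
    have hec : Real.exp (-c * T γ) ≤ 1 := Real.exp_le_one_iff.2 (by nlinarith [hT γ])
    have hec0 : 0 < Real.exp (-c * T γ) := Real.exp_pos _
    have he0 : 0 < Real.exp (-T γ) := Real.exp_pos _
    rw [Prod.dist_eq, max_lt_iff] at hdist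
    simp only at hdist
    have h2 : r γ + r γ' ≤ 2 * κ * Real.exp (-c * T γ) * Real.exp (-T γ) := by
      have : r γ = κ * Real.exp (-c * T γ) * Real.exp (-T γ) := by
        simp only [hr, hexp]
        ring
      linarith
    refine hsep γ γ' ?_ ?_
    · rw [← dist_eq_norm, dist_comm]
      refine (hdist.1.le.trans h2).trans ?_
      calc 2 * κ * Real.exp (-c * T γ) * Real.exp (-T γ) ≤ 2 * κ * Real.exp (-c * T γ) * 1 := by
            gcongr
        _ ≤ η * Real.exp (-c * T γ) := by
            rw [mul_one]
            gcongr
            linarith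
    · set Δ := T γ' - T γ with hΔ
      have hΔ0 : 0 ≤ Δ := by linarith
      rw [abs_of_nonneg hΔ0]
      have h3 : Real.exp (-T γ') = Real.exp (-T γ) * Real.exp (-Δ) := by
        rw [← Real.exp_add]
        congr 1
        rw [hΔ]
        ring
      have h4 : Real.exp (-T γ) * (1 - Real.exp (-Δ)) <
          Real.exp (-T γ) * (2 * κ * Real.exp (-c * T γ)) := by
        have h5 := (hdist.2).trans_le h2
        rw [Real.dist_eq, h3] at h5
        have h6 := (le_abs_self _).trans_lt h5
        linarith
      have h7 : 1 - Real.exp (-Δ) < 2 * κ * Real.exp (-c * T γ) := lt_of_mul_lt_mul_left h4 he0.le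
      -- From 1 + Δ ≤ e^Δ, the bound 1 - e^{-Δ} < ε becomes (1 - ε)(1 + Δ) ≤ 1, hence Δ ≤ 2ε when ε
      -- ≤ 1/2.
      have h8 : Real.exp (-Δ) * (1 + Δ) ≤ 1 := by
        have h9 : Real.exp (-Δ) * (1 + Δ) ≤ Real.exp (-Δ) * Real.exp Δ := by
          gcongr
          linarith [Real.add_one_le_exp Δ]
        rwa [← Real.exp_add, neg_add_cancel, Real.exp_zero] at h9
      set ε := 2 * κ * Real.exp (-c * T γ) with hε
      have hε2 : ε ≤ 1 / 2 := by
        calc ε ≤ 2 * κ * 1 := by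
              rw [hε]
              gcongr
          _ ≤ 1 / 2 := by linarith
      have h10 : (1 - ε) * (1 + Δ) ≤ 1 := by
        refine le_trans ?_ h8
        gcongr
        linarith
      have h11 : Δ ≤ 2 * ε := by nlinarith
      calc Δ ≤ 2 * ε := h11
        _ = 4 * κ * Real.exp (-c * T γ) := by rw [hε]; ring
        _ ≤ _ := by gcongr
  have hS := summable_pow_of_disjoint_balls (P := E × ℝ) (q := fun γ => (p γ, Real.exp (-T γ)))
    (r := r) (R := max R 1) hrpos
    (fun γ => by
      have := hexp1 γ
      simp only [hr]
      nlinarith)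
    (fun γ => by
      refine norm_prod_le_iff.2 ⟨(hp γ).trans (le_max_left _ _), ?_⟩
      refine le_trans ?_ (le_max_right _ _)
      rw [Real.norm_of_nonneg (Real.exp_pos _).le]
      exact Real.exp_le_one_iff.2 (by linarith [hT γ]))
    (fun γ γ' hne => by
      by_contra! hlt
      rcases le_total (T γ) (T γ') with hle | hle
      · exact hne (hclose γ γ' hle hlt)
      · rw [dist_comm, add_comm] at hlt
        exact hne (hclose γ' γ hle hlt).symm)
  set d := Module.finrank ℝ (E × ℝ) with hd
  have hd0 : 0 < d := Module.finrank_pos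
  refine ⟨d * (c + 1), by positivity, ?_⟩
  refine (hS.mul_left ((κ ^ d)⁻¹)).congr fun γ => ?_
  simp only [hr]
  rw [mul_pow, ← mul_assoc, inv_mul_cancel₀ (by positivity), one_mul, ← Real.exp_nat_mul]
  congr 1
  ring

end Packing

/-! ### Minimal periods and the number of closed trajectories -/

section Periods

open Set

variable {n : ℕ} {Y : Type*} [TopologicalSpace Y] [ChartedSpace (EuclideanSpace ℝ (Fin n)) Y]
  [IsManifold (𝓡 n) ∞ Y] {Z : (y : Y) → TangentSpace (𝓡 n) y} [T2Space Y] [CompactSpace Y]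
  (hZ : ContMDiff (𝓡 n) (𝓡 n).tangent ∞ (fun y => (⟨y, Z y⟩ : TangentBundle (𝓡 n) Y)))

include hZ

theorem flow_neg_eq_self_iff (t : ℝ) (y : Y) : flow Z (-t) y = y ↔ flow Z t y = y := by
  constructor <;> intro h
  · rw [← h, flow_flow_neg hZ, h]
  · rw [← h, flow_neg_flow hZ, h]

theorem flow_flow_eq_self_iff (s t : ℝ) (y : Y) :
    flow Z t (flow Z s y) = flow Z s y ↔ flow Z t y = y := by
  rw [← flow_add hZ, add_comm, flow_add hZ]
  constructor <;> intro h
  · rw [← flow_neg_flow hZ s (flow Z t y), h, flow_neg_flow hZ]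
  · rw [h]

/-- The trajectory leaves y with nonzero velocity, so periods below some δ are excluded. The set of
positive periods is then closed and its infimum is attained. -/
theorem isPeriod_period (hne : ∀ y, Z y ≠ 0) {y : Y} (hy : y ∈ periodicPoints Z) :
    0 < period Z y ∧ flow Z (period Z y) y = y := by
  obtain ⟨A⟩ := FlowEmbedding.nonempty hZ
  have hd : HasDerivAt (fun t => A.emb (flow Z t y)) (A.field (A.emb (flow Z 0 y))) 0 :=
    A.hasDerivAt_emb_comp (isMIntegralCurve_flow hZ y 0)
  have hd0 : A.field (A.emb (flow Z 0 y)) ≠ 0 := by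
    rw [flow_zero hZ, ← A.diff_field]
    exact fun h => hne y (A.injective_diff y (h.trans (map_zero _).symm))
  have hev := hd.eventually_ne (c := A.emb y) hd0
  rw [eventually_nhdsWithin_iff, Metric.eventually_nhds_iff] at hev
  obtain ⟨δ, hδ, hδ'⟩ := hev
  have hset : {t | 0 < t ∧ flow Z (-t) y = y} = Ici δ ∩ {t | flow Z (-t) y = y} := by
    ext t
    refine ⟨fun h => ⟨?_, h.2⟩, fun h => ⟨hδ.trans_le h.1, h.2⟩⟩
    by_contra! hlt
    have h1 : dist t 0 < δ := by
      rw [Real.dist_eq, sub_zero, abs_of_pos h.1]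
      exact not_le.1 hlt
    refine hδ' h1 h.1.ne' ?_
    rw [(flow_neg_eq_self_iff hZ t y).1 h.2]
  have hclosed : IsClosed {t | 0 < t ∧ flow Z (-t) y = y} := by
    rw [hset]
    exact isClosed_Ici.inter (isClosed_eq ((continuous_flow_time hZ y).comp continuous_neg)
      continuous_const)
  have hmem := hclosed.csInf_mem hy ⟨0, fun t ht => ht.1.le⟩
  exact ⟨hmem.1, (flow_neg_eq_self_iff hZ _ y).1 hmem.2⟩

theorem period_flow (s : ℝ) (y : Y) : period Z (flow Z s y) = period Z y := by
  simp only [period, flow_flow_eq_self_iff hZ]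

theorem period_neg_field (y : Y) : period (-Z) y = period Z y := by
  simp only [period, flow_neg hZ, flow_neg_eq_self_iff hZ]

theorem periodicPoints_neg_field : periodicPoints (-Z) = periodicPoints Z := by
  ext y
  simp only [periodicPoints, flow_neg hZ, flow_neg_eq_self_iff hZ]

theorem range_flow_flow (s : ℝ) (y : Y) :
    range (fun t => flow Z t (flow Z s y)) = range fun t => flow Z t y := by
  ext z
  constructor
  · rintro ⟨t, rfl⟩
    exact ⟨t + s, flow_add hZ t s y⟩
  · rintro ⟨t, rfl⟩
    refine ⟨t - s, ?_⟩
    simp only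
    rw [← flow_add hZ, sub_add_cancel]

theorem flow_nat_mul_eq_self {T : ℝ} {y : Y} (h : flow Z T y = y) (m : ℕ) :
    flow Z (m * T) y = y := by
  induction m with
  | zero => simp [flow_zero hZ]
  | succ k ih =>
    rw [Nat.cast_succ, add_mul, one_mul, flow_add hZ, h, ih]

omit hZ [T2Space Y] [CompactSpace Y] in
theorem PrimitiveOrbit.point_mem (γ : PrimitiveOrbit Z) : γ.point ∈ periodicPoints Z :=
  γ.2.choose_spec.1

omit hZ [T2Space Y] [CompactSpace Y] in
theorem PrimitiveOrbit.eq_range (γ : PrimitiveOrbit Z) :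
    γ.1 = range fun t : ℝ => flow Z t γ.point := γ.2.choose_spec.2

/-- The exponential growth of the number of closed trajectories. -/
theorem exists_summable_exp_period (hA : IsAnosov Z) :
    ∃ b > 0, Summable fun γ : PrimitiveOrbit Z => Real.exp (-b * period Z γ.point) := by
  obtain ⟨Es, Eu, hsplit⟩ := hA
  obtain ⟨A⟩ := FlowEmbedding.nonempty hZ
  obtain ⟨C, θ, hyp⟩ := hsplit.isHyperbolic A
  obtain ⟨η, hη, c, hc, T₀, hT₀, hiso⟩ := hyp.exists_isolation hZ
  have hper := fun γ : PrimitiveOrbit Z => isPeriod_period hZ hsplit.ne_zero γ.point_mem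
  -- Isolation is known only for periods at least T₀, so each primitive period is replaced by its
  -- first multiple reaching T₀. This adds at most T₀, hence only a constant factor in the sum.
  set m : PrimitiveOrbit Z → ℕ := fun γ => ⌈T₀ / period Z γ.point⌉₊ with hm
  set T : PrimitiveOrbit Z → ℝ := fun γ => m γ * period Z γ.point with hT
  have hTlow : ∀ γ, T₀ ≤ T γ := fun γ => by
    have h1 := Nat.le_ceil (T₀ / period Z γ.point)
    rwa [div_le_iff₀ (hper γ).1] at h1
  have hThigh : ∀ γ, T γ ≤ T₀ + period Z γ.point := fun γ => by
    have h1 := (Nat.ceil_lt_add_one (div_nonneg hT₀.le (hper γ).1.le)).le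
    have h2 := mul_le_mul_of_nonneg_right h1 (hper γ).1.le
    rw [add_mul, one_mul, div_mul_cancel₀ _ (hper γ).1.ne'] at h2
    exact h2
  have hflow : ∀ γ, flow Z (T γ) γ.point = γ.point := fun γ =>
    flow_nat_mul_eq_self hZ (hper γ).2 (m γ)
  obtain ⟨R, hR⟩ := (isCompact_range A.isClosedEmbedding.continuous).isBounded.exists_norm_le
  obtain ⟨b, hb, hsum⟩ := summable_exp_of_separated (p := fun γ : PrimitiveOrbit Z => A.emb γ.point)
    (T := T) hη hc (fun γ => hT₀.le.trans (hTlow γ)) (fun γ => hR _ ⟨_, rfl⟩)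
    (fun γ γ' h1 h2 => by
      obtain ⟨s, hs⟩ := hiso γ.point γ'.point (T γ) (T γ') (hTlow γ)
        (hT₀.trans_le (hTlow γ')) (hflow γ) (hflow γ') h1 h2
      apply Subtype.ext
      rw [γ.eq_range, γ'.eq_range, ← hs, range_flow_flow hZ])
  refine ⟨b, hb, Summable.of_nonneg_of_le (fun γ => (Real.exp_pos _).le) (fun γ => ?_)
    (hsum.mul_left (Real.exp (b * T₀)))⟩
  rw [← Real.exp_add]
  apply Real.exp_le_exp.2
  nlinarith [hThigh γ]

end Periods

/-! ### Parallel transport in flat bundles -/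

namespace FlatVectorBundle

variable {Y : Type*} [TopologicalSpace Y] {V : Type*} [NormedAddCommGroup V] [NormedSpace ℂ V]
  {ι : Type*} (F : FlatVectorBundle Y V ι) {c : ℝ → Y}

theorem coordChange_coordChange {i j : ι} {y : Y} (hi : y ∈ F.baseSet i) (hj : y ∈ F.baseSet j)
    (v : V) : F.coordChange j i y (F.coordChange i j y v) = v := by
  rw [F.coordChange_comp i j i y ⟨⟨hi, hj⟩, hi⟩, F.coordChange_self i y hi]

theorem injective_coordChange {i j : ι} {y : Y} (hi : y ∈ F.baseSet i) (hj : y ∈ F.baseSet j) :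
    Function.Injective (F.coordChange i j y) :=
  Function.LeftInverse.injective (F.coordChange_coordChange hi hj)

/-- Local constancy of the coordinates in one trivialization around each time suffices for a field
along a curve to be parallel. -/
theorem isParallelAlong_of_exists (hc : Continuous c) {s : ℝ → V}
    (h : ∀ t, ∃ i, c t ∈ F.baseSet i ∧ ∀ᶠ t' in 𝓝 t,
      F.coordChange (F.indexAt (c t')) i (c t') (s t') =
        F.coordChange (F.indexAt (c t)) i (c t) (s t)) : F.IsParallelAlong c s := by
  intro t j hj
  obtain ⟨i, hi, h⟩ := h t
  filter_upwards [h, hc.continuousAt.eventually (F.locallyConstant i j (c t) ⟨hi, hj⟩),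
    hc.continuousAt.eventually ((F.isOpen_baseSet i).mem_nhds hi),
    hc.continuousAt.eventually ((F.isOpen_baseSet j).mem_nhds hj)] with t' h1 h2 h3 h4
  rw [← F.coordChange_comp _ i j _ ⟨⟨F.mem_baseSet_at _, h3⟩, h4⟩,
    ← F.coordChange_comp _ i j _ ⟨⟨F.mem_baseSet_at _, hi⟩, hj⟩, h1, h2]

variable {F}

theorem IsParallelAlong.add {s s' : ℝ → V} (h : F.IsParallelAlong c s)
    (h' : F.IsParallelAlong c s') : F.IsParallelAlong c fun t => s t + s' t := by
  intro t i hi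
  filter_upwards [h t i hi, h' t i hi] with t' h1 h2
  rw [map_add, map_add, h1, h2]

theorem IsParallelAlong.smul {s : ℝ → V} (h : F.IsParallelAlong c s) (a : ℂ) :
    F.IsParallelAlong c fun t => a • s t := by
  intro t i hi
  filter_upwards [h t i hi] with t' h1
  rw [map_smul, map_smul, h1]

theorem IsParallelAlong.comp {s : ℝ → V} (h : F.IsParallelAlong c s) {f : ℝ → ℝ}
    (hf : Continuous f) : F.IsParallelAlong (fun t => c (f t)) fun t => s (f t) :=
  fun t i hi => hf.continuousAt.eventually (h (f t) i hi)

/-- On an interval where the curve stays in the domain of a trivialization, the coordinates of a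
parallel field are constant. -/
theorem IsParallelAlong.coord_eq {s : ℝ → V} (h : F.IsParallelAlong c s) {J : Set ℝ}
    (hJ : IsPreconnected J) {i : ι} (hi : ∀ t ∈ J, c t ∈ F.baseSet i) {a b : ℝ} (ha : a ∈ J)
    (hb : b ∈ J) : F.coordChange (F.indexAt (c a)) i (c a) (s a) =
      F.coordChange (F.indexAt (c b)) i (c b) (s b) := by
  -- With the discrete topology on the fibre, locally constant coordinates are continuous, hence
  -- constant on a preconnected set.
  have hcont : ContinuousOn (fun t => WithTopology.toTopology ⊥
      (F.coordChange (F.indexAt (c t)) i (c t) (s t))) J := fun t ht =>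
    (continuousAt_const.congr ((h t i (hi t ht)).mono fun t' h' => by
      simp only [h']; rfl)).continuousWithinAt
  simpa using hJ.constant hcont ha hb

/-- Transition maps are injective, so whether two parallel fields agree is locally constant in time:
the agreement set is clopen. -/
theorem IsParallelAlong.eq_of_eq (hc : Continuous c) {s s' : ℝ → V} (h : F.IsParallelAlong c s)
    (h' : F.IsParallelAlong c s') {t₀ : ℝ} (h₀ : s t₀ = s' t₀) : s = s' := by
  have hloc : ∀ t, ∀ᶠ t' in 𝓝 t, (s t' = s' t' ↔ s t = s' t) := by
    intro t
    have hi := F.mem_baseSet_at (c t)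
    filter_upwards [h t _ hi, h' t _ hi,
      hc.continuousAt.eventually ((F.isOpen_baseSet _).mem_nhds hi)] with t' h1 h2 h3
    rw [← (F.injective_coordChange (F.mem_baseSet_at (c t')) h3).eq_iff, h1, h2,
      (F.injective_coordChange hi hi).eq_iff]
  have hcl : IsClopen {t | s t = s' t} := by
    refine ⟨⟨isOpen_iff_mem_nhds.2 fun t ht => ?_⟩, isOpen_iff_mem_nhds.2 fun t ht => ?_⟩
    · filter_upwards [hloc t] with t' h3 h4
      exact ht (h3.1 h4)
    · filter_upwards [hloc t] with t' h3
      exact h3.2 ht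
  have := hcl.eq_univ ⟨t₀, h₀⟩
  funext t
  exact (this ▸ Set.mem_univ t : t ∈ {t | s t = s' t})

variable (F)

/-- The total space of a flat bundle, with discrete fibres. -/
def discreteCore : FiberBundleCore ι Y (WithDiscreteTopology V) where
  baseSet := F.baseSet
  isOpen_baseSet := F.isOpen_baseSet
  indexAt := F.indexAt
  mem_baseSet_at := F.mem_baseSet_at
  coordChange i j y v := .toTopology _ (F.coordChange i j y v.ofTopology)
  coordChange_self i y hy v := by simp [F.coordChange_self i y hy]
  continuousOn_coordChange i j := by
    rintro ⟨y, v⟩ ⟨hy, -⟩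
    apply ContinuousAt.continuousWithinAt
    apply (continuousAt_const (y := WithTopology.toTopology ⊥ (F.coordChange i j y v.ofTopology))).congr
    have h : ∀ᶠ p : Y × WithDiscreteTopology V in 𝓝 (y, v), p.2 = v := by
      have := (continuous_snd (X := Y) (Y := WithDiscreteTopology V)).continuousAt (x := (y, v))
      exact this.eventually (p := fun w => w = v) (by simp [nhds_discrete])
    filter_upwards [continuous_fst.continuousAt.eventually (F.locallyConstant i j y hy), h]
      with p h1 h2
    rw [h1, h2]
  coordChange_comp i j k y hy v := by simp [F.coordChange_comp i j k y hy]

/-- The coordinate of a point of the total space in the preferred trivialization. -/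
def fibreCoord (p : F.discreteCore.TotalSpace) : V :=
  WithTopology.ofTopology (show WithDiscreteTopology V from p.2)

/-- With discrete fibres the total space is a covering of Y, and parallel fields are its lifts of
the curve; path lifting gives existence for all times. -/
theorem exists_isParallelAlong (hc : Continuous c) (v : V) :
    ∃ s : ℝ → V, s 0 = v ∧ F.IsParallelAlong c s := by
  have hcov : IsCoveringMap (Bundle.TotalSpace.proj : F.discreteCore.TotalSpace → Y) :=
    FiberBundle.isCoveringMap
  obtain ⟨G, ⟨hG0, hG⟩, -⟩ := hcov.existsUnique_continuousMap_lifts ⟨c, hc⟩ 0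
    (⟨c 0, WithTopology.toTopology ⊥ v⟩ : F.discreteCore.TotalSpace) rfl
  have hG' : ∀ t, (G t).1 = c t := fun t => congrFun hG t
  refine ⟨fun t => F.fibreCoord (G t), congrArg F.fibreCoord hG0, fun t i hi => ?_⟩
  have hcont : ContinuousAt (fun t' => (F.discreteCore.localTriv i (G t')).2) t := by
    refine continuous_snd.continuousAt.comp
      (((F.discreteCore.localTriv i).continuousAt ?_).comp G.continuous.continuousAt)
    rw [FiberBundleCore.mem_localTriv_source, hG']
    exact hi
  have h := hcont.eventually (p := fun w => w = (F.discreteCore.localTriv i (G t)).2)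
    (by simp [nhds_discrete])
  filter_upwards [h] with t' ht'
  simp only [FiberBundleCore.localTriv_apply] at ht'
  have h2 := congrArg WithTopology.ofTopology ht'
  rw [← hG', ← hG']
  exact h2

/-- Parallel transport along a continuous curve. -/
theorem exists_transport (hc : Continuous c) :
    ∃ P : ℝ → V →ₗ[ℂ] V, P 0 = LinearMap.id ∧ ∀ v, F.IsParallelAlong c (fun t => P t v) := by
  choose s h0 hs using F.exists_isParallelAlong hc
  refine ⟨fun t =>
    { toFun := fun v => s v t
      map_add' := fun v w => ?_
      map_smul' := fun a v => ?_ }, ?_, hs⟩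
  -- Linearity follows from uniqueness: sums and multiples of parallel fields are parallel.
  · exact congrFun ((hs (v + w)).eq_of_eq hc ((hs v).add (hs w)) (t₀ := 0) (by simp [h0])) t
  · exact congrFun ((hs (a • v)).eq_of_eq hc ((hs v).smul a) (t₀ := 0) (by simp [h0])) t
  · ext v
    exact h0 v

theorem transport_zero (hc : Continuous c) : F.transport c 0 = LinearMap.id := by
  rw [transport, dif_pos (F.exists_transport hc)]
  exact (F.exists_transport hc).choose_spec.1

theorem isParallelAlong_transport (hc : Continuous c) (v : V) :
    F.IsParallelAlong c fun t => F.transport c t v := by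
  simp only [transport, dif_pos (F.exists_transport hc)]
  exact (F.exists_transport hc).choose_spec.2 v

-- `transport` is a choice, but uniqueness determines it. Exhibiting a parallel field thus computes
-- the lift of the flow.
variable {F} in
theorem IsParallelAlong.eq_transport (hc : Continuous c) {s : ℝ → V} (h : F.IsParallelAlong c s)
    (t : ℝ) : s t = F.transport c t (s 0) :=
  congrFun (h.eq_of_eq hc (F.isParallelAlong_transport hc (s 0)) (t₀ := 0)
    (by rw [F.transport_zero hc]; rfl)) t

theorem transport_add (hc : Continuous c) (s t : ℝ) :
    F.transport c (s + t) = F.transport (fun r => c (r + t)) s ∘ₗ F.transport c t := by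
  ext v
  have hf : Continuous fun r : ℝ => r + t := by fun_prop
  have h := ((F.isParallelAlong_transport hc v).comp hf).eq_transport (hc.comp hf) s
  simpa [Function.comp_def] using h

end FlatVectorBundle

/-! ### The lift of the flow -/

section FlowLift

variable {n : ℕ} {Y : Type*} [TopologicalSpace Y] [ChartedSpace (EuclideanSpace ℝ (Fin n)) Y]
  [IsManifold (𝓡 n) ∞ Y] [T2Space Y] [CompactSpace Y] {Z : (y : Y) → TangentSpace (𝓡 n) y}
  (hZ : ContMDiff (𝓡 n) (𝓡 n).tangent ∞ (fun y => (⟨y, Z y⟩ : TangentBundle (𝓡 n) Y)))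
  {V : Type*} [NormedAddCommGroup V] [NormedSpace ℂ V] {ι : Type*} (F : FlatVectorBundle Y V ι)

include hZ

theorem flowLift_zero (y : Y) : flowLift Z F 0 y = LinearMap.id :=
  F.transport_zero (continuous_flow_time hZ y)

theorem flowLift_add (s t : ℝ) (y : Y) :
    flowLift Z F (s + t) y = flowLift Z F s (flow Z t y) ∘ₗ flowLift Z F t y := by
  simp only [flowLift]
  rw [F.transport_add (continuous_flow_time hZ y)]
  simp only [flow_add hZ]

theorem flowLift_add_apply (s t : ℝ) (y : Y) (v : V) :
    flowLift Z F (s + t) y v = flowLift Z F s (flow Z t y) (flowLift Z F t y v) := by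
  rw [flowLift_add hZ]
  rfl

theorem flowLift_neg_flowLift (t : ℝ) (y : Y) (v : V) :
    flowLift Z F (-t) (flow Z t y) (flowLift Z F t y v) = v := by
  rw [← flowLift_add_apply hZ, neg_add_cancel, flowLift_zero hZ]
  rfl

/-- The lift of the flow as an isomorphism between fibres. -/
def flowLiftEquiv (t : ℝ) (y : Y) : V ≃ₗ[ℂ] V :=
  LinearEquiv.ofLinearMap (flowLift Z F t y) (flowLift Z F (-t) (flow Z t y))
    (by
      ext v
      have := flowLift_neg_flowLift hZ F (-t) (flow Z t y) v
      rwa [flow_neg_flow hZ, neg_neg] at this)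
    (by
      ext v
      exact flowLift_neg_flowLift hZ F t y v)

/-- Moving the base point along a closed trajectory conjugates the holonomy. -/
theorem flowLift_conj {T : ℝ} {y : Y} (hT : flow Z T y = y) (s : ℝ) :
    flowLift Z F T (flow Z s y) = (flowLiftEquiv hZ F s y).conj (flowLift Z F T y) := by
  ext v
  obtain ⟨w, rfl⟩ := (flowLiftEquiv hZ F s y).surjective v
  rw [LinearEquiv.conj_apply_apply, LinearEquiv.symm_apply_apply]
  change flowLift Z F T (flow Z s y) (flowLift Z F s y w) =
    flowLift Z F s y (flowLift Z F T y w)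
  rw [← flowLift_add_apply hZ, add_comm, flowLift_add_apply hZ, hT]

end FlowLift

/-! ### Growth of the holonomy -/

section Growth

open Filter

variable {n : ℕ} {Y : Type*} [TopologicalSpace Y] [ChartedSpace (EuclideanSpace ℝ (Fin n)) Y]
  [IsManifold (𝓡 n) ∞ Y] [T2Space Y] [CompactSpace Y] {Z : (y : Y) → TangentSpace (𝓡 n) y}
  (hZ : ContMDiff (𝓡 n) (𝓡 n).tangent ∞ (fun y => (⟨y, Z y⟩ : TangentBundle (𝓡 n) Y)))
  {V : Type*} [NormedAddCommGroup V] [NormedSpace ℂ V] {ι : Type*} (F : FlatVectorBundle Y V ι)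

include hZ

/-- The expansion of the flow in time is uniform in the base point, which gives joint continuity at
time zero. -/
theorem tendsto_flow_zero (y : Y) :
    Tendsto (fun p : ℝ × Y => flow Z p.1 p.2) (𝓝 (0, y)) (𝓝 y) := by
  obtain ⟨A⟩ := FlowEmbedding.nonempty hZ
  obtain ⟨B, -, hB⟩ := A.exists_field_bound
  rw [A.isClosedEmbedding.isEmbedding.tendsto_nhds_iff, tendsto_iff_norm_sub_tendsto_zero]
  have hle : ∀ p : ℝ × Y, ‖A.emb (flow Z p.1 p.2) - A.emb y‖ ≤
      A.ambient.rate * B * p.1 ^ 2 + |p.1| * B + ‖A.emb p.2 - A.emb y‖ := by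
    intro p
    have h1 := A.norm_emb_flow_sub_le hZ hB p.1 p.2
    have h2 : ‖p.1 • A.field (A.emb p.2)‖ ≤ |p.1| * B := by
      rw [norm_smul, Real.norm_eq_abs]
      exact mul_le_mul_of_nonneg_left (hB _) (abs_nonneg _)
    have h3 : A.emb (flow Z p.1 p.2) - A.emb y = (A.emb (flow Z p.1 p.2) - A.emb p.2 -
        p.1 • A.field (A.emb p.2)) + p.1 • A.field (A.emb p.2) + (A.emb p.2 - A.emb y) := by abel
    rw [h3]
    exact norm_add₃_le.trans (by gcongr)
  refine squeeze_zero (fun _ => norm_nonneg _) hle ?_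
  have hemb := A.isClosedEmbedding.continuous
  have hcont : Continuous fun p : ℝ × Y =>
      A.ambient.rate * B * p.1 ^ 2 + |p.1| * B + ‖A.emb p.2 - A.emb y‖ := by fun_prop
  simpa using hcont.tendsto (0, y)

/-- There are finitely many flat trivializations such that the trajectory of every point stays, for
a uniform time, in a fixed compact part of the domain of one of them. -/
theorem exists_uniform_trivializations : ∃ (t : Finset Y) (K : Y → Set Y) (δ : ℝ), 0 < δ ∧
    (∀ p, IsCompact (K p) ∧ K p ⊆ F.baseSet (F.indexAt p)) ∧
    ∀ y, ∃ p ∈ t, ∀ s, |s| ≤ δ → flow Z s y ∈ K p := by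
  have hK : ∀ p : Y, ∃ K ∈ 𝓝 p, K ⊆ F.baseSet (F.indexAt p) ∧ IsCompact K := fun p =>
    local_compact_nhds ((F.isOpen_baseSet _).mem_nhds (F.mem_baseSet_at p))
  choose K hKp hKs hKc using hK
  have hN : ∀ p : Y, ∃ δ > 0, ∃ N ∈ 𝓝 p, ∀ s, |s| ≤ δ → ∀ y ∈ N, flow Z s y ∈ K p := by
    intro p
    have h := (tendsto_flow_zero hZ p).eventually (hKp p)
    rw [nhds_prod_eq, eventually_prod_iff] at h
    obtain ⟨pa, ha, pb, hb, h⟩ := h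
    obtain ⟨δ, hδ, hδ'⟩ := Metric.eventually_nhds_iff.1 ha
    refine ⟨δ / 2, half_pos hδ, {y | pb y}, hb, fun s hs y hy => h (hδ' ?_) hy⟩
    simp only [dist_zero_right, Real.norm_eq_abs]
    linarith
  choose δ hδ N hN hKN using hN
  obtain ⟨t, -, ht⟩ := isCompact_univ.elim_nhds_subcover N fun p _ => hN p
  obtain ⟨ε, hε, hε'⟩ : ∃ ε > 0, ∀ p ∈ t, ε ≤ δ p := by
    rcases t.eq_empty_or_nonempty with rfl | hne
    · exact ⟨1, one_pos, by simp⟩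
    · obtain ⟨q, hq, hq'⟩ := t.exists_min_image δ hne
      exact ⟨δ q, hδ q, hq'⟩
  refine ⟨t, K, ε, hε, fun p => ⟨hKc p, hKs p⟩, fun y => ?_⟩
  obtain ⟨p, hp, hy⟩ := Set.mem_iUnion₂.1 (ht (Set.mem_univ y))
  exact ⟨p, hp, fun s hs => hKN p s (hs.trans (hε' p hp)) y hy⟩

/-- The holonomy along closed trajectories grows at most exponentially with the period, up to
conjugation. -/
theorem exists_flowLift_bound : ∃ C > (0 : ℝ), ∃ κ : ℝ, ∀ y : Y, ∀ T > 0, flow Z T y = y →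
    ∃ Q : V ≃ₗ[ℂ] V, ∀ v, ‖Q.conj (flowLift Z F T y) v‖ ≤ C * Real.exp (κ * T) * ‖v‖ := by
  obtain ⟨t, K, δ, hδ, hK, hcov⟩ := exists_uniform_trivializations hZ F
  choose j hjt hj using hcov
  have hj0 : ∀ y, y ∈ K (j y) := fun y => by
    simpa [flow_zero hZ] using hj y 0 (by simpa using hδ.le)
  have hjb : ∀ y, y ∈ F.baseSet (F.indexAt (j y)) := fun y => (hK _).2 (hj0 y)
  -- Only finitely many transition functions occur, each on a compact set where it is continuous.
  obtain ⟨M, hM1, hM⟩ : ∃ M ≥ (1 : ℝ), ∀ p ∈ t, ∀ q ∈ t, ∀ y ∈ K p ∩ K q,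
      ‖F.coordChange (F.indexAt p) (F.indexAt q) y‖ ≤ M := by
    have : ∀ p q, ∃ M, ∀ y ∈ K p ∩ K q, ‖F.coordChange (F.indexAt p) (F.indexAt q) y‖ ≤ M :=
      fun p q => ((hK p).1.inter (hK q).1).exists_bound_of_continuousOn
        ((F.continuousOn_coordChange _ _).mono (Set.inter_subset_inter (hK p).2 (hK q).2))
    choose M hM using this
    refine ⟨1 + ∑ p ∈ t, ∑ q ∈ t, |M p q|, le_add_of_nonneg_right (by positivity), ?_⟩
    intro p hp q hq y hy
    calc _ ≤ M p q := hM p q y hy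
      _ ≤ |M p q| := le_abs_self _
      _ ≤ ∑ q ∈ t, |M p q| := Finset.single_le_sum (f := fun q => |M p q|)
          (fun _ _ => abs_nonneg _) hq
      _ ≤ ∑ p ∈ t, ∑ q ∈ t, |M p q| := Finset.single_le_sum
          (f := fun p => ∑ q ∈ t, |M p q|) (fun _ _ => by positivity) hp
      _ ≤ _ := by linarith
  have hM0 : 0 < M := by linarith
  let Q : Y → V ≃ₗ[ℂ] V := fun y =>
    LinearEquiv.ofLinearMap (F.coordChange (F.indexAt y) (F.indexAt (j y)) y).toLinearMap
      (F.coordChange (F.indexAt (j y)) (F.indexAt y) y).toLinearMap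
      (by ext v; exact F.coordChange_coordChange (hjb y) (F.mem_baseSet_at y) v)
      (by ext v; exact F.coordChange_coordChange (F.mem_baseSet_at y) (hjb y) v)
  -- For time δ the trajectory stays in the domain chosen at its start, where coordinates of
  -- parallel fields are constant; the only cost is one change of trivialization at the end.
  have hstep : ∀ y, ∀ s, 0 ≤ s → s ≤ δ → ∀ v,
      ‖Q (flow Z s y) (flowLift Z F s y v)‖ ≤ M * ‖Q y v‖ := by
    intro y s hs hsδ v
    have hin : ∀ r ∈ Set.Icc 0 s, flow Z r y ∈ F.baseSet (F.indexAt (j y)) := fun r hr =>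
      (hK _).2 (hj y r (by rw [abs_of_nonneg hr.1]; exact hr.2.trans hsδ))
    have h := (F.isParallelAlong_transport (continuous_flow_time hZ y) v).coord_eq
      isPreconnected_Icc hin (Set.right_mem_Icc.2 hs) (Set.left_mem_Icc.2 hs)
    simp only [F.transport_zero (continuous_flow_time hZ y), LinearMap.id_apply, flow_zero hZ] at h
    have h1 : Q (flow Z s y) (flowLift Z F s y v) =
        F.coordChange (F.indexAt (j y)) (F.indexAt (j (flow Z s y))) (flow Z s y) (Q y v) := by
      change F.coordChange _ _ _ _ = F.coordChange _ _ _ (F.coordChange _ _ _ v)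
      rw [← h, F.coordChange_comp _ _ _ _ ⟨⟨F.mem_baseSet_at _, hin s (Set.right_mem_Icc.2 hs)⟩,
        hjb _⟩]
      rfl
    rw [h1]
    refine (ContinuousLinearMap.le_opNorm _ _).trans (mul_le_mul_of_nonneg_right ?_ (norm_nonneg _))
    exact hM _ (hjt y) _ (hjt _) _ ⟨hj y s (by rwa [abs_of_nonneg hs]), hj0 _⟩
  have hiter : ∀ y, ∀ s, 0 ≤ s → s ≤ δ → ∀ (m : ℕ) v,
      ‖Q (flow Z (m * s) y) (flowLift Z F (m * s) y v)‖ ≤ M ^ m * ‖Q y v‖ := by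
    intro y s hs hsδ m v
    induction m with
    | zero => simp [flow_zero hZ, flowLift_zero hZ]
    | succ m ih =>
      have hm : ((m + 1 : ℕ) : ℝ) * s = s + m * s := by push_cast; ring
      rw [hm, flow_add hZ, flowLift_add_apply hZ, pow_succ', mul_assoc]
      exact (hstep _ s hs hsδ _).trans (mul_le_mul_of_nonneg_left ih hM0.le)
  refine ⟨M, hM0, Real.log M / δ, fun y T hT hy => ⟨Q y, fun v => ?_⟩⟩
  -- At most T/δ + 1 steps are taken, so the growth is at most M e^{(log M/δ)T}. The trajectory
  -- closes up, so `Q y` occurs at both ends and the result is a conjugate of the holonomy.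
  set m := ⌈T / δ⌉₊ with hm
  have hm0 : (0 : ℝ) < m := Nat.cast_pos.2 (Nat.ceil_pos.2 (div_pos hT hδ))
  have hmT : (m : ℝ) * (T / m) = T := by field_simp
  have hTm : T / m ≤ δ := by
    rw [div_le_iff₀ hm0, mul_comm, ← div_le_iff₀ hδ]
    exact Nat.le_ceil _
  have h := hiter y (T / m) (by positivity) hTm m ((Q y).symm v)
  rw [hmT, hy, LinearEquiv.apply_symm_apply] at h
  rw [LinearEquiv.conj_apply_apply]
  refine h.trans (mul_le_mul_of_nonneg_right ?_ (norm_nonneg _))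
  calc M ^ m = Real.exp (Real.log M * m) := by
        rw [mul_comm, Real.exp_nat_mul, Real.exp_log hM0]
    _ ≤ Real.exp (Real.log M * (T / δ + 1)) := by
        have := Real.log_nonneg hM1
        gcongr
        exact (Nat.ceil_lt_add_one (by positivity)).le
    _ = M * Real.exp (Real.log M / δ * T) := by
        rw [mul_add, mul_one, Real.exp_add, Real.exp_log hM0, mul_comm]
        congr 2
        ring

end Growth

/-! ### Holonomy of the dual bundle twisted by the orientation bundle -/

section Dual

open Filter

variable {n : ℕ} {Y : Type*} [TopologicalSpace Y] [ChartedSpace (EuclideanSpace ℝ (Fin n)) Y]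
  [IsManifold (𝓡 n) ∞ Y] [T2Space Y] [CompactSpace Y] {Z : (y : Y) → TangentSpace (𝓡 n) y}
  (hZ : ContMDiff (𝓡 n) (𝓡 n).tangent ∞ (fun y => (⟨y, Z y⟩ : TangentBundle (𝓡 n) Y)))

include hZ

theorem det_dflow_ne_zero (t : ℝ) (y : Y) : LinearMap.det (dflow Z t y).toLinearMap ≠ 0 := by
  have h := injective_dflow hZ t y
  have h2 : LinearMap.ker (dflow Z t y).toLinearMap = ⊥ := LinearMap.ker_eq_bot.2 h
  intro h0
  exact (LinearMap.bot_lt_ker_of_det_eq_zero h0).ne' h2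

/-- The sign of the Jacobian of the flow is parallel for the orientation bundle. -/
theorem eventually_orientationSign_mul_sign_det (t : ℝ) (y : Y) : ∀ᶠ t' in 𝓝 t,
    orientationSign (achart (EuclideanSpace ℝ (Fin n)) (flow Z t' y))
        (achart (EuclideanSpace ℝ (Fin n)) (flow Z t y)) (flow Z t' y) *
        (SignType.sign (LinearMap.det (dflow Z t' y).toLinearMap) : ℝ) =
      orientationSign (achart (EuclideanSpace ℝ (Fin n)) (flow Z t y))
        (achart (EuclideanSpace ℝ (Fin n)) (flow Z t y)) (flow Z t y) *
        (SignType.sign (LinearMap.det (dflow Z t y).toLinearMap) : ℝ) := by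
  obtain ⟨A⟩ := FlowEmbedding.nonempty hZ
  set p := flow Z t y with hp
  obtain ⟨G, hG, hGe⟩ := exists_local_leftInverse (E := EuclideanSpace ℝ (Fin A.N))
    A.contMDiff_emb (A.injective_mfderiv p)
  have hflow := (continuous_flow_time hZ y).continuousAt (x := t)
  have hd : ∀ᶠ x in 𝓝 (A.emb p), DifferentiableAt ℝ G x := by
    filter_upwards [hG.eventually (by simp)] with x hx
    exact hx.differentiableAt (by simp)
  have hemb : ContinuousAt A.emb p := A.isClosedEmbedding.continuous.continuousAt
  have hcoord : ∀ᶠ y' in 𝓝 p, tangentCoordChange (𝓡 n) y' p y' =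
      (fderiv ℝ G (A.emb y')).comp (A.diff y') := by
    filter_upwards [hGe.eventually_nhds, hemb.eventually hd,
      (chartAt (EuclideanSpace ℝ (Fin n)) p).open_source.mem_nhds
        (mem_chart_source (EuclideanSpace ℝ (Fin n)) p)] with y' h1 h2 h3
    have h4 := mfderiv_chartAt_eq_tangentCoordChange (I := 𝓡 n) h3
    have h5 : HasMFDerivAt (𝓡 n) (𝓡 n) (G ∘ A.emb) y' ((fderiv ℝ G (A.emb y')).comp (A.diff y')) :=
      h2.hasFDerivAt.hasMFDerivAt.comp y' (A.hasMFDerivAt_emb y')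
    rw [← h4]
    exact ((h5.congr_of_eventuallyEq (h1.mono fun z hz => hz.symm))).mfderiv
  have hprod : ∀ t', orientationSign (achart (EuclideanSpace ℝ (Fin n)) (flow Z t' y))
        (achart (EuclideanSpace ℝ (Fin n)) p) (flow Z t' y) *
        (SignType.sign (LinearMap.det (dflow Z t' y).toLinearMap) : ℝ) =
      (SignType.sign (LinearMap.det ((tangentCoordChange (𝓡 n) (flow Z t' y) p
        (flow Z t' y)).comp (dflow Z t' y)).toLinearMap) : ℝ) := by
    intro t'
    rw [ContinuousLinearMap.toLinearMap_comp, LinearMap.det_comp, sign_mul]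
    simp [orientationSign]
  -- This is the Jacobian of the flow with the target read in the fixed chart at p. It is continuous
  -- in time and nonzero at t, so its sign is locally constant.
  set f : ℝ → ℝ := fun t' => LinearMap.det (((fderiv ℝ G (A.emb (flow Z t' y))).comp
    ((A.ambient.deriv t' (A.emb y)).comp (A.diff y))).toLinearMap) with hf
  have hcomp : ∀ᶠ t' in 𝓝 t, (tangentCoordChange (𝓡 n) (flow Z t' y) p
        (flow Z t' y)).comp (dflow Z t' y) = (fderiv ℝ G (A.emb (flow Z t' y))).comp
    ((A.ambient.deriv t' (A.emb y)).comp (A.diff y)) := by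
    filter_upwards [hflow.eventually hcoord] with t' h
    rw [h]
    ext1 v
    simp only [ContinuousLinearMap.comp_apply]
    rw [A.diff_dflow hZ]
  have hfc : ContinuousAt f t := by
    have h1 : ContinuousAt (fderiv ℝ G) (A.emb p) :=
      (hG.fderiv_right (m := 1) (by norm_num)).continuousAt
    have h2 : ContinuousAt (fun t' => fderiv ℝ G (A.emb (flow Z t' y))) t :=
      ContinuousAt.comp (f := fun t' => A.emb (flow Z t' y)) h1
        (ContinuousAt.comp (f := fun t' => flow Z t' y) hemb hflow)
    exact (ContinuousLinearMap.continuous_det (E := EuclideanSpace ℝ (Fin n))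
      (𝕜 := ℝ)).continuousAt.comp (h2.clm_comp
        ((A.ambient.continuous_deriv (A.emb y)).continuousAt.clm_comp continuousAt_const))
  have hf0 : f t ≠ 0 := by
    have h := hcomp.self_of_nhds
    simp only [hf]
    rw [← h, ContinuousLinearMap.toLinearMap_comp, LinearMap.det_comp]
    refine mul_ne_zero ?_ (det_dflow_ne_zero hZ t y)
    have h1 : (tangentCoordChange (𝓡 n) p p p).toLinearMap = LinearMap.id := by
      ext1 v
      exact tangentCoordChange_self (by simp)
    rw [← hp, h1]
    simp
  have hs : ∀ᶠ t' in 𝓝 t, SignType.sign (f t') = SignType.sign (f t) := by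
    rcases lt_or_gt_of_ne hf0 with h | h
    · filter_upwards [hfc.eventually_lt_const h] with y' hy'
      rw [sign_neg hy', sign_neg h]
    · filter_upwards [hfc.eventually_const_lt h] with y' hy'
      rw [sign_pos hy', sign_pos h]
  filter_upwards [hs, hcomp] with t' h1 h2
  have h3 := hprod t
  rw [hprod t', h2]
  rw [← hp] at h3
  rw [h3, hp, hcomp.self_of_nhds]
  simp only [hf] at h1
  rw [h1]

variable {V : Type*} [NormedAddCommGroup V] [NormedSpace ℂ V] [FiniteDimensional ℂ V] {ι : Type*}
  (F : FlatVectorBundle Y V ι)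

/-- Pulling back a covector at `y` along the trajectory through `y`, and multiplying by the sign of
the Jacobian of the flow, gives a parallel section of `F* ⊗ o(TY)`. -/
theorem isParallelAlong_dual_tensorOrientation (y : Y) (ξ : V →L[ℂ] ℂ) :
    (F.dual.tensorOrientation n).IsParallelAlong (fun t => flow Z t y) fun t =>
      ((SignType.sign (LinearMap.det (dflow Z t y).toLinearMap) : ℝ) : ℂ) •
        ξ.comp (LinearMap.toContinuousLinearMap (flowLift Z F (-t) (flow Z t y))) := by
  refine FlatVectorBundle.isParallelAlong_of_exists _ (continuous_flow_time hZ y) fun t => ?_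
  refine ⟨(F.dual.tensorOrientation n).indexAt (flow Z t y),
    (F.dual.tensorOrientation n).mem_baseSet_at _, ?_⟩
  have hopen : ∀ᶠ t' in 𝓝 t, flow Z t' y ∈ F.baseSet (F.indexAt (flow Z t y)) :=
    (continuous_flow_time hZ y).continuousAt.eventually
      ((F.isOpen_baseSet _).mem_nhds (F.mem_baseSet_at _))
  obtain ⟨ε, hε, hball⟩ := Metric.eventually_nhds_iff_ball.1 hopen
  filter_upwards [eventually_orientationSign_mul_sign_det hZ t y, Metric.ball_mem_nhds t hε]
    with t' h1 ht'
  have hcov : ∀ r, ∀ w : V,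
      flowLift Z F (-r) (flow Z r y) (flowLift Z F r y w) = w := fun r w =>
    flowLift_neg_flowLift hZ F r y w
  -- Vectors with fixed coordinates w in the trivialization at `flow Z t y` form a parallel field
  -- nearby, so carrying them back to y gives the same vector.
  have h2 : ∀ w : V, flowLift Z F (-t') (flow Z t' y)
      (F.coordChange (F.indexAt (flow Z t y)) (F.indexAt (flow Z t' y)) (flow Z t' y) w) =
      flowLift Z F (-t) (flow Z t y)
      (F.coordChange (F.indexAt (flow Z t y)) (F.indexAt (flow Z t y)) (flow Z t y) w) := by
    intro w
    rw [F.coordChange_self _ _ (F.mem_baseSet_at _)]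
    obtain ⟨u, rfl⟩ := (flowLiftEquiv hZ F t y).surjective w
    change _ = flowLift Z F (-t) (flow Z t y) (flowLift Z F t y u)
    rw [hcov]
    have h3 := (F.isParallelAlong_transport (continuous_flow_time hZ y) u).coord_eq
      (convex_ball t ε).isPreconnected hball (Metric.mem_ball_self hε) ht'
    rw [F.coordChange_self _ _ (F.mem_baseSet_at _)] at h3
    change flowLift Z F (-t') (flow Z t' y) (F.coordChange _ _ _ (F.transport _ t u)) = u
    rw [h3, F.coordChange_coordChange (F.mem_baseSet_at _) (hball t' ht')]
    exact hcov t' u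
  ext w
  have h4 := congrArg (fun x : ℝ => (x : ℂ)) h1
  simp only [Complex.ofReal_mul] at h4
  have h5 := congrArg ξ (h2 w)
  change (_ : ℂ) * ((_ : ℂ) * ξ _) = (_ : ℂ) * ((_ : ℂ) * ξ _)
  rw [← mul_assoc, ← mul_assoc]
  exact congrArg₂ (· * ·) h4 h5

/-- At a periodic point the parallel sections just found give the holonomy of F* ⊗ o(TY) as a sign
times the transpose of the inverse holonomy of F; determinants are invariant under transposition. -/
theorem det_id_sub_smul_flowLift_dual {T : ℝ} {y : Y} (hT : flow Z T y = y) (a : ℂ) :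
    LinearMap.det (LinearMap.id - a • flowLift Z (F.dual.tensorOrientation n) T y) =
      LinearMap.det (LinearMap.id - (a *
        ((SignType.sign (LinearMap.det (dflow Z T y).toLinearMap) : ℝ) : ℂ)) •
          flowLift Z F (-T) y) := by
  set σ := ((SignType.sign (LinearMap.det (dflow Z T y).toLinearMap) : ℝ) : ℂ) with hσ
  have h : ∀ ξ : V →L[ℂ] ℂ, flowLift Z (F.dual.tensorOrientation n) T y ξ =
      σ • ξ.comp (LinearMap.toContinuousLinearMap (flowLift Z F (-T) y)) := by
    intro ξ
    have h1 := (isParallelAlong_dual_tensorOrientation hZ F y ξ).eq_transport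
      (continuous_flow_time hZ y) T
    simp only [neg_zero, flowLift_zero hZ, dflow_zero hZ, hT] at h1
    rw [hσ, h1, flowLift]
    congr 1
    ext w
    simp
  rw [← LinearMap.det_dualMap (LinearMap.id - (a * σ) • flowLift Z F (-T) y),
    ← LinearMap.det_conj _ (LinearMap.toContinuousLinearMap : (V →ₗ[ℂ] ℂ) ≃ₗ[ℂ] V →L[ℂ] ℂ)]
  congr 1
  ext ξ w
  simp [h, mul_assoc]

-- Applied to -Z, this turns the inverse holonomy produced by dualizing back into the holonomy of Z.
omit [FiniteDimensional ℂ V] in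
theorem flowLift_neg_field (t : ℝ) (y : Y) : flowLift (-Z) F (-t) y = flowLift Z F t y := by
  ext v
  have h := ((F.isParallelAlong_transport (continuous_flow_time hZ y) v).comp
    continuous_neg).eq_transport ((continuous_flow_time hZ y).comp continuous_neg) (-t)
  simp only [neg_neg, neg_zero, F.transport_zero (continuous_flow_time hZ y),
    LinearMap.id_apply] at h
  simp only [flowLift, flow_neg hZ]
  exact h.symm

end Dual

/-! ### Determinants on invariant subspaces -/

section DetOn

variable {E : Type*} [AddCommGroup E] [Module ℝ E]

theorem detOn_of_forall_mem {W : Submodule ℝ E} {D : E →ₗ[ℝ] E} (h : ∀ v ∈ W, D v ∈ W) :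
    detOn W D = LinearMap.det (D.restrict h) := dif_pos h

theorem detOn_map_conj (W : Submodule ℝ E) (D : E →ₗ[ℝ] E) (e : E ≃ₗ[ℝ] E)
    (h : ∀ v ∈ W, D v ∈ W) : detOn (W.map e.toLinearMap) (e.conj D) = detOn W D := by
  have h' : ∀ v ∈ W.map e.toLinearMap, e.conj D v ∈ W.map e.toLinearMap := by
    rintro _ ⟨w, hw, rfl⟩
    exact ⟨D w, h w hw, by simp [LinearEquiv.conj_apply_apply]⟩
  rw [detOn_of_forall_mem h', detOn_of_forall_mem h, ← LinearMap.det_conj _ (e.submoduleMap W)]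
  congr 1

theorem detOn_mul_detOn {W : Submodule ℝ E} {D D' : E →ₗ[ℝ] E} (h : ∀ v ∈ W, D v ∈ W)
    (h' : ∀ v ∈ W, D' v ∈ W) (hDD : ∀ v, D' (D v) = v) : detOn W D' * detOn W D = 1 := by
  rw [detOn_of_forall_mem h, detOn_of_forall_mem h', ← LinearMap.det_comp]
  have : D'.restrict h' ∘ₗ D.restrict h = LinearMap.id := by
    ext v
    simp [LinearMap.restrict_apply, hDD]
  rw [this, LinearMap.det_id]

theorem detOn_sup [FiniteDimensional ℝ E] {U W : Submodule ℝ E} {D : E →ₗ[ℝ] E}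
    (hUW : Disjoint U W) (hU : ∀ v ∈ U, D v ∈ U) (hW : ∀ v ∈ W, D v ∈ W) :
    detOn (U ⊔ W) D = detOn U D * detOn W D := by
  have hs : ∀ v ∈ U ⊔ W, D v ∈ U ⊔ W := by
    intro v hv
    obtain ⟨u, hu, w, hw, rfl⟩ := Submodule.mem_sup.1 hv
    rw [map_add]
    exact Submodule.add_mem_sup (hU u hu) (hW w hw)
  rw [detOn_of_forall_mem hU, detOn_of_forall_mem hW, detOn_of_forall_mem hs,
    ← LinearMap.det_prodMap]
  let f : U × W →ₗ[ℝ] ↥(U ⊔ W) :=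
    (Submodule.inclusion le_sup_left).coprod (Submodule.inclusion le_sup_right)
  have hf : Function.Bijective f := by
    constructor
    · rw [← LinearMap.ker_eq_bot, LinearMap.ker_eq_bot']
      rintro ⟨u, w⟩ h
      have h1 : (u : E) + w = 0 := congrArg Subtype.val h
      have h2 : (u : E) ∈ W := by
        rw [eq_neg_of_add_eq_zero_left h1]
        exact W.neg_mem w.2
      have h3 : (u : E) = 0 := Submodule.disjoint_def.1 hUW u u.2 h2
      have h4 : (w : E) = 0 := by simpa [h3] using h1
      simpa using And.intro h3 h4
    · rintro ⟨v, hv⟩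
      obtain ⟨u, hu, w, hw, rfl⟩ := Submodule.mem_sup.1 hv
      exact ⟨(⟨u, hu⟩, ⟨w, hw⟩), rfl⟩
  rw [← LinearMap.det_conj _ (LinearEquiv.ofBijective f hf)]
  congr 1
  ext v
  obtain ⟨⟨u, w⟩, rfl⟩ := (LinearEquiv.ofBijective f hf).surjective v
  simp only [LinearMap.comp_apply, LinearEquiv.coe_coe, LinearEquiv.symm_apply_apply]
  simp [f, LinearMap.restrict_apply]

theorem detOn_top (D : E →ₗ[ℝ] E) : detOn ⊤ D = LinearMap.det D := by
  rw [detOn_of_forall_mem fun _ _ => Submodule.mem_top,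
    ← LinearMap.det_conj D Submodule.topEquiv.symm]
  congr 1

theorem detOn_span_singleton {z : E} {D : E →ₗ[ℝ] E} (h : D z = z) :
    detOn (Submodule.span ℝ {z}) D = 1 := by
  have h1 : ∀ v ∈ Submodule.span ℝ {z}, D v = v := by
    intro v hv
    obtain ⟨a, rfl⟩ := Submodule.mem_span_singleton.1 hv
    rw [map_smul, h]
  rw [detOn_of_forall_mem fun v hv => (h1 v hv).symm ▸ hv]
  have : D.restrict (fun v (hv : v ∈ Submodule.span ℝ {z}) => (h1 v hv).symm ▸ hv) =
      LinearMap.id := by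
    ext ⟨v, hv⟩
    exact h1 v hv
  rw [this, LinearMap.det_id]

end DetOn

/-! ### Reversal of an Anosov flow -/

section Reversal

open Filter

variable {n : ℕ} {Y : Type*} [TopologicalSpace Y] [ChartedSpace (EuclideanSpace ℝ (Fin n)) Y]
  [IsManifold (𝓡 n) ∞ Y] [T2Space Y] [CompactSpace Y] {Z : (y : Y) → TangentSpace (𝓡 n) y}
  (hZ : ContMDiff (𝓡 n) (𝓡 n).tangent ∞ (fun y => (⟨y, Z y⟩ : TangentBundle (𝓡 n) Y)))

theorem length_congr (g : Bundle.ContMDiffRiemannianMetric (𝓡 n) ∞ (EuclideanSpace ℝ (Fin n))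
    (fun y : Y => TangentSpace (𝓡 n) y)) {p q : Y} {v w : EuclideanSpace ℝ (Fin n)}
    (h : p = q) (h' : v = w) : length g p v = length g q w := by
  subst h h'
  rfl

include hZ

/-- Reversing time exchanges the stable and the unstable bundle. -/
theorem IsAnosovSplitting.neg {Eu Es : (y : Y) → Submodule ℝ (TangentSpace (𝓡 n) y)}
    (h : IsAnosovSplitting Z Eu Es) : IsAnosovSplitting (-Z) Es Eu := by
  have hmap : ∀ W : Y → Submodule ℝ (EuclideanSpace ℝ (Fin n)),
      (∀ t y, (W y).map (dflow Z t y).toLinearMap = W (flow Z t y)) → ∀ t y,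
      (W y).map (dflow (-Z) t y).toLinearMap = W (flow (-Z) t y) := by
    intro W hW t y
    rw [dflow_neg_field hZ, flow_neg hZ]
    exact hW (-t) y
  obtain ⟨g, C, hC, θ, hθ, hyp⟩ := h.hyperbolic
  have hlen : ∀ t (y : Y) (v : TangentSpace (𝓡 n) y),
      length g _ (flowDeriv (-Z) t y v) = length g _ (flowDeriv Z (-t) y v) := fun t y v =>
    length_congr g (flow_neg hZ t y) (congrArg (fun D : EuclideanSpace ℝ (Fin n) →L[ℝ]
      EuclideanSpace ℝ (Fin n) => D v) (dflow_neg_field hZ t y))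
  refine ⟨fun y => neg_ne_zero.2 (h.ne_zero y), fun y => (h.disjoint y).symm, fun y => ?_,
    hmap Es h.map_stable, hmap Eu h.map_unstable, g, C, hC, θ, hθ, fun t ht y => ⟨?_, ?_⟩⟩
  · have h1 : Submodule.span ℝ {(-Z) y} = Submodule.span ℝ {Z y} := by
      rw [Pi.neg_apply, ← Set.neg_singleton, Submodule.span_neg]
    rw [h1, sup_comm (Es y)]
    exact h.isCompl y
  · intro v hv
    rw [hlen]
    exact (hyp t ht y).2 v hv
  · intro v hv
    rw [hlen, neg_neg]
    exact (hyp t ht y).1 v hv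

/-- A vector of Eu' decays in backward time, hence by the angle bound so do its components along Z
and Es. The first is constant in size, and the second is recovered from its past by a map bounded by
C; both are therefore zero. -/
theorem unstable_le_of_isHyperbolic {A : FlowEmbedding Z}
    {Eu Es Eu' Es' : Y → Submodule ℝ (EuclideanSpace ℝ (Fin n))} {C θ C' θ' : ℝ}
    (h : A.IsHyperbolic Eu Es C θ) (h' : A.IsHyperbolic Eu' Es' C' θ') (y : Y) :
    Eu' y ≤ Eu y := by
  obtain ⟨K, hK, hangle⟩ := h.exists_angle_bound hZ
  intro v hv
  obtain ⟨a, s, hs, u, hu, rfl⟩ := h.exists_decomp y v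
  set w := a • fieldCoord Z y + s + u with hw
  have hC : 0 < C := zero_lt_one.trans_le h.one_le
  have key : ∀ t ≥ 0, |a| + ‖A.diff (flow Z (-t) y) (dflow Z (-t) y s)‖ ≤
      K * (C' * Real.exp (-θ' * t) * ‖A.diff y w‖) := by
    intro t ht
    have h1 := hangle (flow Z (-t) y) a _ (h.dflow_mem_stable (-t) y s hs) _
      (h.dflow_mem_unstable (-t) y u hu)
    have h2 : a • fieldCoord Z (flow Z (-t) y) + dflow Z (-t) y s + dflow Z (-t) y u =
        dflow Z (-t) y w := by
      rw [hw, map_add, map_add, map_smul, dflow_field hZ]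
    rw [h2] at h1
    have h3 := mul_le_mul_of_nonneg_left (h'.unstable_le t ht y w hv) hK.le
    linarith [norm_nonneg (A.diff (flow Z (-t) y) (dflow Z (-t) y u))]
  have hlim : Tendsto (fun t => K * (C' * Real.exp (-θ' * t) * ‖A.diff y w‖)) atTop (𝓝 0) := by
    have h1 : Tendsto (fun t => Real.exp (-θ' * t)) atTop (𝓝 0) :=
      Real.tendsto_exp_atBot.comp (tendsto_id.const_mul_atTop_of_neg (neg_lt_zero.2 h'.pos))
    simpa using ((h1.const_mul C').mul_const ‖A.diff y w‖).const_mul K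
  have ha : a = 0 := by
    refine abs_eq_zero.1 (le_antisymm (ge_of_tendsto hlim ?_) (abs_nonneg a))
    filter_upwards [eventually_ge_atTop 0] with t ht
    linarith [key t ht, norm_nonneg (A.diff (flow Z (-t) y) (dflow Z (-t) y s))]
  have hs0 : s = 0 := by
    have h1 : ‖A.diff y s‖ ≤ C * 0 := by
      refine ge_of_tendsto (hlim.const_mul C) ?_
      filter_upwards [eventually_ge_atTop 0] with t ht
      have h2 := h.stable_le t ht (flow Z (-t) y) _ (h.dflow_mem_stable (-t) y s hs)
      have h3 := dflow_neg_dflow hZ (-t) y s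
      rw [neg_neg] at h3
      rw [h3, flow_flow_neg hZ] at h2
      have h4 : C * Real.exp (-θ * t) ≤ C := by
        have : Real.exp (-θ * t) ≤ 1 := Real.exp_le_one_iff.2 (by nlinarith [h.pos])
        nlinarith
      refine h2.trans ((mul_le_mul_of_nonneg_right h4 (norm_nonneg _)).trans ?_)
      exact mul_le_mul_of_nonneg_left (by linarith [key t ht, abs_nonneg a]) hC.le
    have h2 : A.diff y s = 0 := by
      rw [mul_zero] at h1
      exact norm_eq_zero.1 (le_antisymm h1 (norm_nonneg _))
    exact A.injective_diff y (h2.trans (map_zero _).symm)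
  rw [hw, ha, hs0]
  simpa using hu

/-- The unstable bundle is determined by the flow. -/
theorem IsAnosovSplitting.unstable_unique
    {Eu Es Eu' Es' : (y : Y) → Submodule ℝ (TangentSpace (𝓡 n) y)}
    (h : IsAnosovSplitting Z Eu Es) (h' : IsAnosovSplitting Z Eu' Es') (y : Y) : Eu y = Eu' y := by
  obtain ⟨A⟩ := FlowEmbedding.nonempty hZ
  obtain ⟨C, θ, hh⟩ := h.isHyperbolic A
  obtain ⟨C', θ', hh'⟩ := h'.isHyperbolic A
  exact le_antisymm (unstable_le_of_isHyperbolic hZ hh' hh y)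
    (unstable_le_of_isHyperbolic hZ hh hh' y)

omit hZ [T2Space Y] [CompactSpace Y] in
theorem IsAnosov.exists_splitting (hA : IsAnosov Z) :
    ∃ Eu, IsAnosovSplitting Z Eu (stableBundle Z) := by
  have h : stableBundle Z = hA.choose := funext fun y => dif_pos hA
  rw [h]
  exact hA.choose_spec

theorem IsAnosov.neg (hA : IsAnosov Z) : IsAnosov (-Z) := by
  obtain ⟨Es, Eu, h⟩ := hA
  exact ⟨Eu, Es, h.neg hZ⟩

/-- The stable bundles of `Z` and `-Z` are the two parts of an Anosov splitting. -/
theorem IsAnosov.isAnosovSplitting (hA : IsAnosov Z) :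
    IsAnosovSplitting Z (stableBundle (-Z)) (stableBundle Z) := by
  obtain ⟨Eu, h⟩ := hA.exists_splitting
  obtain ⟨Eu', h'⟩ := (hA.neg hZ).exists_splitting
  -- Reversing twice turns the stable bundle chosen for -Z into an unstable bundle for Z, where
  -- uniqueness applies.
  have h'' := h'.neg (contMDiff_neg_field hZ)
  rw [neg_neg] at h''
  have : Eu = stableBundle (-Z) := funext fun y => h.unstable_unique hZ h'' y
  rwa [← this]

end Reversal

/-! ### The factors of the zeta function -/

section Factor

open Filter

variable {n : ℕ} {Y : Type*} [TopologicalSpace Y] [ChartedSpace (EuclideanSpace ℝ (Fin n)) Y]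
  [IsManifold (𝓡 n) ∞ Y] {Z : (y : Y) → TangentSpace (𝓡 n) y}

/-- The stable bundle as a family of subspaces of the model space. -/
def stableCoord (Z : (y : Y) → TangentSpace (𝓡 n) y) (y : Y) :
    Submodule ℝ (EuclideanSpace ℝ (Fin n)) := stableBundle Z y

theorem stableSign_eq (y : Y) : stableSign Z y = (SignType.sign (detOn (stableCoord Z y)
    (dflow Z (period Z y) y).toLinearMap) : ℝ) := rfl

/-- The factor of the zeta function computed at a given periodic point. -/
def friedFactorAt {V : Type*} [NormedAddCommGroup V] [NormedSpace ℂ V] {ι : Type*}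
    (Z : (y : Y) → TangentSpace (𝓡 n) y) (F : FlatVectorBundle Y V ι) (σ : ℂ) (y : Y) : ℂ :=
  LinearMap.det (LinearMap.id - (Complex.exp (-(period Z y : ℂ) * σ) *
      (stableSign Z y : ℂ)) • flowLift Z F (period Z y) y) ^
    ((-1 : ℤ) ^ (Module.finrank ℝ (stableCoord Z y) + 1))

theorem friedFactor_eq {V : Type*} [NormedAddCommGroup V] [NormedSpace ℂ V] {ι : Type*}
    (F : FlatVectorBundle Y V ι) (σ : ℂ) (γ : PrimitiveOrbit Z) :
    friedFactor Z F σ γ = friedFactorAt Z F σ γ.point := by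
  rw [friedFactor, friedFactorAt, smul_smul]
  rfl

variable [T2Space Y] [CompactSpace Y]
  (hZ : ContMDiff (𝓡 n) (𝓡 n).tangent ∞ (fun y => (⟨y, Z y⟩ : TangentBundle (𝓡 n) Y)))

include hZ

/-- The differential of the flow as an isomorphism in coordinates. -/
def dflowEquiv (t : ℝ) (y : Y) : EuclideanSpace ℝ (Fin n) ≃ₗ[ℝ] EuclideanSpace ℝ (Fin n) :=
  LinearEquiv.ofLinearMap (dflow Z t y).toLinearMap (dflow Z (-t) (flow Z t y)).toLinearMap
    (by
      ext1 v
      have := dflow_neg_dflow hZ (-t) (flow Z t y) v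
      rwa [flow_neg_flow hZ, neg_neg] at this)
    (by
      ext1 v
      exact dflow_neg_dflow hZ t y v)

theorem dflow_conj {T : ℝ} {y : Y} (hT : flow Z T y = y) (s : ℝ) :
    (dflow Z T (flow Z s y)).toLinearMap =
      (dflowEquiv hZ s y).conj (dflow Z T y).toLinearMap := by
  ext1 v
  obtain ⟨w, rfl⟩ := (dflowEquiv hZ s y).surjective v
  rw [LinearEquiv.conj_apply_apply, LinearEquiv.symm_apply_apply]
  change dflow Z T (flow Z s y) (dflow Z s y w) = dflow Z s y (dflow Z T y w)
  rw [← dflow_add_apply hZ, add_comm, dflow_add_apply hZ, hT]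

theorem map_stableCoord (hA : IsAnosov Z) (t : ℝ) (y : Y) :
    (stableCoord Z y).map (dflow Z t y).toLinearMap = stableCoord Z (flow Z t y) :=
  (hA.isAnosovSplitting hZ).map_stable t y

theorem dflow_mem_stableCoord (hA : IsAnosov Z) {t : ℝ} {y : Y} (hT : flow Z t y = y) :
    ∀ v ∈ stableCoord Z y, (dflow Z t y).toLinearMap v ∈ stableCoord Z y := by
  intro v hv
  have := Submodule.mem_map_of_mem (f := (dflow Z t y).toLinearMap) hv
  rwa [map_stableCoord hZ hA, hT] at this

theorem stableSign_flow (hA : IsAnosov Z) {y : Y} (hT : flow Z (period Z y) y = y) (s : ℝ) :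
    stableSign Z (flow Z s y) = stableSign Z y := by
  rw [stableSign_eq, stableSign_eq, period_flow hZ, dflow_conj hZ hT, ← map_stableCoord hZ hA,
    ← detOn_map_conj (stableCoord Z y) _ (dflowEquiv hZ s y) (dflow_mem_stableCoord hZ hA hT)]
  rfl

theorem finrank_stableCoord_flow (hA : IsAnosov Z) (s : ℝ) (y : Y) :
    Module.finrank ℝ (stableCoord Z (flow Z s y)) = Module.finrank ℝ (stableCoord Z y) := by
  rw [← map_stableCoord hZ hA]
  exact ((dflowEquiv hZ s y).submoduleMap (stableCoord Z y)).finrank_eq.symm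

/-- Moving the base point conjugates both the holonomy and the action on the stable space, so the
factor does not depend on the point chosen on the trajectory. -/
theorem friedFactorAt_flow (hA : IsAnosov Z) {V : Type*} [NormedAddCommGroup V] [NormedSpace ℂ V]
    {ι : Type*} (F : FlatVectorBundle Y V ι) (σ : ℂ) {y : Y} (hT : flow Z (period Z y) y = y)
    (s : ℝ) : friedFactorAt Z F σ (flow Z s y) = friedFactorAt Z F σ y := by
  rw [friedFactorAt, friedFactorAt, finrank_stableCoord_flow hZ hA, stableSign_flow hZ hA hT,
    period_flow hZ, flowLift_conj hZ F hT, ← LinearMap.det_conj (LinearMap.id - _ • flowLift Z F _ y)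
      (flowLiftEquiv hZ F s y)]
  congr 2
  ext v
  simp [LinearEquiv.conj_apply_apply]

theorem finrank_stableCoord_add (hA : IsAnosov Z) (y : Y) :
    Module.finrank ℝ (stableCoord Z y) + Module.finrank ℝ (stableCoord (-Z) y) + 1 = n := by
  have h := hA.isAnosovSplitting hZ
  have h1 : IsCompl (Submodule.span ℝ {fieldCoord Z y}) (stableCoord (-Z) y ⊔ stableCoord Z y) :=
    h.isCompl y
  have h2 : Disjoint (stableCoord (-Z) y) (stableCoord Z y) := h.disjoint y
  have h3 := Submodule.finrank_add_eq_of_isCompl h1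
  have h4 := Submodule.finrank_sup_add_finrank_inf_eq (stableCoord (-Z) y) (stableCoord Z y)
  rw [h2.eq_bot, finrank_bot] at h4
  have hz : fieldCoord Z y ≠ 0 := h.ne_zero y
  rw [finrank_span_singleton hz, finrank_euclideanSpace_fin] at h3
  omega

/-- The flow multiplies the orientation of `TY` at a periodic point by the product of its actions on
the orientations of the stable bundles of `Z` and `-Z`. -/
theorem stableSign_neg_mul (hA : IsAnosov Z) {y : Y} (hT : flow Z (period Z y) y = y) :
    stableSign (-Z) y * (SignType.sign (LinearMap.det
      (dflow (-Z) (period Z y) y).toLinearMap) : ℝ) = stableSign Z y := by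
  have h := hA.isAnosovSplitting hZ
  set T := period Z y with hTdef
  have hZ' := contMDiff_neg_field hZ
  have hA' := hA.neg hZ
  have hT' : flow (-Z) T y = y := by rw [flow_neg hZ, flow_neg_eq_self_iff hZ, hT]
  have hT'' : flow Z (-T) y = y := by rw [flow_neg_eq_self_iff hZ, hT]
  have h1 : IsCompl (Submodule.span ℝ {fieldCoord Z y}) (stableCoord (-Z) y ⊔ stableCoord Z y) :=
    h.isCompl y
  have h2 : Disjoint (stableCoord (-Z) y) (stableCoord Z y) := h.disjoint y
  set D := (dflow (-Z) T y).toLinearMap with hD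
  have hDu : ∀ v ∈ stableCoord (-Z) y, D v ∈ stableCoord (-Z) y :=
    dflow_mem_stableCoord hZ' hA' hT'
  have hDs : ∀ v ∈ stableCoord Z y, D v ∈ stableCoord Z y := by
    rw [hD, dflow_neg_field hZ]
    exact dflow_mem_stableCoord hZ hA hT''
  have hDz : D (fieldCoord Z y) = fieldCoord Z y := by
    rw [hD, dflow_neg_field hZ]
    have := dflow_field hZ (-T) y
    rwa [hT''] at this
  have hdet : LinearMap.det D = detOn (stableCoord (-Z) y) D * detOn (stableCoord Z y) D := by
    rw [← detOn_top, ← h1.sup_eq_top, detOn_sup h1.disjoint, detOn_sup h2 hDu hDs,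
      detOn_span_singleton hDz, one_mul]
    · intro v hv
      obtain ⟨a, rfl⟩ := Submodule.mem_span_singleton.1 hv
      rw [map_smul, hDz]
      exact hv
    · intro v hv
      obtain ⟨u, hu, w, hw, rfl⟩ := Submodule.mem_sup.1 hv
      rw [map_add]
      exact Submodule.add_mem_sup (hDu u hu) (hDs w hw)
  -- D inverts the differential of φ_T at y, so on the stable space the two determinants are
  -- reciprocal and have the same sign; the nonzero sign on the other summand is squared away.
  have hinv : detOn (stableCoord Z y) D * detOn (stableCoord Z y) (dflow Z T y).toLinearMap = 1 := by
    refine detOn_mul_detOn (dflow_mem_stableCoord hZ hA hT) hDs fun v => ?_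
    rw [hD, dflow_neg_field hZ]
    have := dflow_neg_dflow hZ T y v
    rwa [hT] at this
  have hu0 : detOn (stableCoord (-Z) y) D ≠ 0 := by
    intro h0
    rw [h0, zero_mul] at hdet
    exact det_dflow_ne_zero hZ' T y hdet
  rw [stableSign_eq, stableSign_eq, period_neg_field hZ, ← hTdef, ← hD, hdet]
  have e1 := congrArg SignType.sign hinv
  rw [sign_mul, sign_one] at e1
  rw [sign_mul]
  generalize SignType.sign (detOn (stableCoord Z y) D) = a at *
  generalize SignType.sign (detOn (stableCoord Z y) (dflow Z T y).toLinearMap) = b at *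
  have hu : SignType.sign (detOn (stableCoord (-Z) y) D) ≠ 0 := sign_ne_zero.2 hu0
  generalize SignType.sign (detOn (stableCoord (-Z) y) D) = u at *
  revert e1 hu
  clear * -
  cases a <;> cases b <;> cases u <;> simp

/-- Dualizing and reversing time undo each other on the holonomy, and the orientation signs combine
to the stable sign of Z. The determinants are thus equal, and only the exponents have to be
compared. -/
theorem friedFactorAt_neg_dual (hA : IsAnosov Z) {V : Type*} [NormedAddCommGroup V]
    [NormedSpace ℂ V] [FiniteDimensional ℂ V] {ι : Type*} (F : FlatVectorBundle Y V ι) (σ : ℂ)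
    {y : Y} (hT : flow Z (period Z y) y = y) :
    friedFactorAt (-Z) (F.dual.tensorOrientation n) σ y =
      friedFactorAt Z F σ y ^ ((-1 : ℤ) ^ (n - 1)) := by
  have hT' : flow (-Z) (period Z y) y = y := by rw [flow_neg hZ, flow_neg_eq_self_iff hZ, hT]
  rw [friedFactorAt, friedFactorAt, period_neg_field hZ,
    det_id_sub_smul_flowLift_dual (contMDiff_neg_field hZ) F hT', flowLift_neg_field hZ,
    mul_assoc, ← Complex.ofReal_mul, stableSign_neg_mul hZ hA hT, ← zpow_mul, ← pow_add]
  congr 1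
  have h := finrank_stableCoord_add hZ hA y
  -- By the dimension count n - 1 = n_s + n_u, with n ≥ 1, so the exponents differ by the even
  -- number 2 n_s.
  have h2 : Module.finrank ℝ (stableCoord Z y) + 1 + (n - 1) =
      Module.finrank ℝ (stableCoord (-Z) y) + 1 + 2 * Module.finrank ℝ (stableCoord Z y) := by omega
  rw [h2, pow_add _ _ (2 * _), pow_mul]
  simp

end Factor

/-! ### Determinants near the identity -/

section DetEstimate

variable {V : Type*} [NormedAddCommGroup V] [NormedSpace ℂ V] [FiniteDimensional ℂ V]

theorem differentiable_det_id_sub : Differentiable ℂ fun M : V →L[ℂ] V =>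
    LinearMap.det (LinearMap.id - M.toLinearMap) := by
  let b := Module.finBasis ℂ V
  have h : (fun M : V →L[ℂ] V => LinearMap.det (LinearMap.id - M.toLinearMap)) = fun M =>
      ∑ τ : Equiv.Perm (Fin (Module.finrank ℂ V)), (Equiv.Perm.sign τ : ℂ) *
        ∏ i, (LinearMap.toContinuousLinearMap (b.coord (τ i))) (b i - M (b i)) := by
    funext M
    rw [← LinearMap.det_toMatrix b, Matrix.det_apply']
    simp [LinearMap.toMatrix_apply]
  rw [h]
  have hi : ∀ i k, Differentiable ℂ fun M : V →L[ℂ] V =>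
      (LinearMap.toContinuousLinearMap (b.coord k)) (b i - M (b i)) := fun i k =>
    (ContinuousLinearMap.differentiable _).comp ((differentiable_const _).sub
      (ContinuousLinearMap.apply ℂ V (b i)).differentiable)
  exact Differentiable.fun_sum fun τ _ => Differentiable.const_mul
    (fun M => (HasFDerivAt.finsetProd (u := Finset.univ)
      fun i _ => (hi i (τ i) M).hasFDerivAt).differentiableAt) _

/-- A determinant close to the identity is close to `1`. -/
theorem exists_norm_det_id_sub_sub_one_le : ∃ r > (0 : ℝ), ∃ K > (0 : ℝ), ∀ (N : V →ₗ[ℂ] V) (ρ : ℝ),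
    ρ < r → (∀ v, ‖N v‖ ≤ ρ * ‖v‖) → 0 ≤ ρ →
      ‖LinearMap.det (LinearMap.id - N) - 1‖ ≤ K * ρ := by
  have h := (differentiable_det_id_sub (V := V) 0).isBigO_sub
  obtain ⟨K, hK, hb⟩ := h.exists_pos
  obtain ⟨r, hr, hr'⟩ := Metric.eventually_nhds_iff.1 hb.bound
  refine ⟨r, hr, K, hK, fun N ρ hρ hN h0 => ?_⟩
  have h1 : ‖LinearMap.toContinuousLinearMap N‖ ≤ ρ :=
    ContinuousLinearMap.opNorm_le_bound _ h0 hN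
  have h2 := hr' (y := LinearMap.toContinuousLinearMap N) (by
    rw [dist_zero_right]
    exact h1.trans_lt hρ)
  simp only [LinearMap.coe_toContinuousLinearMap, ContinuousLinearMap.toLinearMap_zero, sub_zero,
    LinearMap.det_id] at h2
  exact h2.trans (by gcongr)

end DetEstimate

theorem norm_zpow_neg_one_pow_sub_one_le {z : ℂ} (hz : ‖z - 1‖ ≤ 1 / 2) (k : ℕ) :
    ‖z ^ ((-1 : ℤ) ^ k) - 1‖ ≤ 2 * ‖z - 1‖ := by
  rcases neg_one_pow_eq_or ℤ k with h | h
  · rw [h, zpow_one]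
    linarith [norm_nonneg (z - 1)]
  · have h1 : 1 / 2 ≤ ‖z‖ := by
      have := norm_sub_norm_le 1 z
      rw [norm_one, norm_sub_rev] at this
      linarith
    have hz0 : z ≠ 0 := norm_pos_iff.1 (by linarith)
    have h2 : z⁻¹ - 1 = -(z - 1) * z⁻¹ := by field_simp; ring
    rw [h, zpow_neg_one, h2, norm_mul, norm_neg, norm_inv, mul_comm]
    refine mul_le_mul_of_nonneg_right ?_ (norm_nonneg _)
    rw [inv_le_comm₀ (by linarith) two_pos]
    linarith

/-! ### Convergence of the product and matching of trajectories -/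

section Zeta

variable {n : ℕ} {Y : Type*} [TopologicalSpace Y] [ChartedSpace (EuclideanSpace ℝ (Fin n)) Y]
  [IsManifold (𝓡 n) ∞ Y] [T2Space Y] [CompactSpace Y] {Z : (y : Y) → TangentSpace (𝓡 n) y}
  (hZ : ContMDiff (𝓡 n) (𝓡 n).tangent ∞ (fun y => (⟨y, Z y⟩ : TangentBundle (𝓡 n) Y)))

theorem abs_stableSign_le_one (y : Y) : |stableSign Z y| ≤ 1 := by
  rw [stableSign]
  generalize SignType.sign (detOn (E := EuclideanSpace ℝ (Fin n)) (stableBundle Z y)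
    (flowDeriv Z (period Z y) y).toLinearMap) = s
  cases s <;> simp

include hZ

/-- The summable terms tend to zero, so all but finitely many periods exceed 1; the others have a
positive minimum. -/
theorem exists_period_lower_bound (hA : IsAnosov Z) :
    ∃ T₀ > 0, ∀ γ : PrimitiveOrbit Z, T₀ ≤ period Z γ.point := by
  obtain ⟨b, hb, hsum⟩ := exists_summable_exp_period hZ hA
  obtain ⟨Es, Eu, hsplit⟩ := hA
  have hev := hsum.tendsto_cofinite_zero.eventually_lt_const (Real.exp_pos (-b))
  rw [Filter.eventually_cofinite] at hev
  set S := hev.toFinset with hS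
  have hmin : ∃ T > 0, ∀ γ ∈ S, T ≤ period Z γ.point := by
    rcases S.eq_empty_or_nonempty with h | hne
    · exact ⟨1, one_pos, by simp [h]⟩
    · obtain ⟨q, -, hq⟩ := S.exists_min_image (fun γ : PrimitiveOrbit Z => period Z γ.point) hne
      exact ⟨period Z q.point, (isPeriod_period hZ hsplit.ne_zero q.point_mem).1, hq⟩
  obtain ⟨T, hT, hTS⟩ := hmin
  refine ⟨min T 1, lt_min hT one_pos, fun γ => ?_⟩
  by_cases hγ : γ ∈ S
  · exact (min_le_left _ _).trans (hTS γ hγ)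
  · refine (min_le_right _ _).trans ?_
    have h1 : Real.exp (-b * period Z γ.point) < Real.exp (-b) := by
      by_contra h
      exact hγ (by rw [hS, Set.Finite.mem_toFinset]; exact h)
    rw [Real.exp_lt_exp] at h1
    nlinarith

variable {V : Type*} [NormedAddCommGroup V] [NormedSpace ℂ V] [FiniteDimensional ℂ V] {ι : Type*}
  (F : FlatVectorBundle Y V ι)

/-- In a half plane, the factors of the zeta function are nonzero and their distances to `1` are
summable. -/
theorem exists_summable_friedFactor_sub_one (hA : IsAnosov Z) : ∃ c : ℝ, ∀ σ : ℂ, c < σ.re →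
    (∀ γ, friedFactor Z F σ γ ≠ 0) ∧ Summable fun γ => ‖friedFactor Z F σ γ - 1‖ := by
  obtain ⟨b, hb, hsum⟩ := exists_summable_exp_period hZ hA
  obtain ⟨T₀, hT₀, hper⟩ := exists_period_lower_bound hZ hA
  obtain ⟨C, hC, κ, hgrow⟩ := exists_flowLift_bound hZ F
  obtain ⟨r, hr, K, hK, hdet⟩ := exists_norm_det_id_sub_sub_one_le (V := V)
  obtain ⟨Es, Eu, hsplit⟩ := id hA
  -- With ρ ≤ q the determinant estimate applies, as ρ < r, and puts the determinant within 1/2 of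
  -- 1, so it is nonzero and can be inverted with control.
  set q := min (r / 2) (1 / (2 * K)) with hq
  have hq0 : 0 < q := lt_min (by positivity) (by positivity)
  obtain ⟨a, ha0, ha⟩ : ∃ a ≥ 0, C * Real.exp (-a * T₀) ≤ q := by
    refine ⟨max 0 (Real.log (C / q) / T₀), le_max_left _ _, ?_⟩
    have h1 : Real.log (C / q) ≤ max 0 (Real.log (C / q) / T₀) * T₀ := by
      rw [← div_le_iff₀ hT₀]
      exact le_max_right _ _
    have h2 : Real.exp (-max 0 (Real.log (C / q) / T₀) * T₀) ≤ q / C := by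
      rw [← Real.exp_log (div_pos hq0 hC), Real.exp_le_exp, ← inv_div C q, Real.log_inv]
      linarith
    calc _ ≤ C * (q / C) := by gcongr
      _ = q := by field_simp
  -- κ offsets the growth of the holonomy, a makes every factor close to 1, and b gives summability
  -- over trajectories.
  refine ⟨κ + a + b, fun σ hσ => ?_⟩
  have hest : ∀ γ : PrimitiveOrbit Z, ‖LinearMap.det (LinearMap.id -
      (Complex.exp (-(period Z γ.point : ℂ) * σ) * (stableSign Z γ.point : ℂ)) •
        flowLift Z F (period Z γ.point) γ.point) - 1‖ ≤
      min (1 / 2) (K * C * Real.exp (-b * period Z γ.point)) := by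
    intro γ
    set T := period Z γ.point with hT
    obtain ⟨hT0, hTp⟩ := isPeriod_period hZ hsplit.ne_zero γ.point_mem
    obtain ⟨Q, hQ⟩ := hgrow γ.point T hT0 hTp
    set z := Complex.exp (-(T : ℂ) * σ) * (stableSign Z γ.point : ℂ) with hz
    have hz' : ‖z‖ ≤ Real.exp (-σ.re * T) := by
      rw [hz, norm_mul, Complex.norm_exp, Complex.norm_real, Real.norm_eq_abs]
      have h1 : (-(T : ℂ) * σ).re = -σ.re * T := by simp [mul_comm]
      rw [h1]
      exact mul_le_of_le_one_right (Real.exp_pos _).le (abs_stableSign_le_one _)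
    have hconj : LinearMap.det (LinearMap.id - z • flowLift Z F T γ.point) =
        LinearMap.det (LinearMap.id - z • Q.conj (flowLift Z F T γ.point)) := by
      rw [← LinearMap.det_conj (LinearMap.id - z • flowLift Z F T γ.point) Q]
      congr 1
      ext v
      simp [LinearEquiv.conj_apply_apply]
    set ρ := C * Real.exp ((κ - σ.re) * T) with hρ
    have hρ0 : 0 ≤ ρ := by positivity
    have hN : ∀ v, ‖(z • Q.conj (flowLift Z F T γ.point)) v‖ ≤ ρ * ‖v‖ := by
      intro v
      rw [LinearMap.smul_apply, norm_smul]
      calc _ ≤ Real.exp (-σ.re * T) * (C * Real.exp (κ * T) * ‖v‖) := by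
            gcongr
            exact hQ v
        _ = ρ * ‖v‖ := by
            rw [hρ, sub_mul, sub_eq_add_neg, Real.exp_add, neg_mul]
            ring
    have hTT : T₀ ≤ T := hper γ
    have hρa : ρ ≤ q := by
      have h1 : (κ - σ.re) * T ≤ -a * T₀ := by
        have h2 : (κ - σ.re) * T ≤ -a * T :=
          mul_le_mul_of_nonneg_right (by linarith) (hT₀.le.trans hTT)
        have h3 : a * T₀ ≤ a * T := mul_le_mul_of_nonneg_left hTT ha0
        linarith
      exact (mul_le_mul_of_nonneg_left (Real.exp_le_exp.2 h1) hC.le).trans ha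
    have hρb : ρ ≤ C * Real.exp (-b * T) := by
      rw [hρ]
      gcongr
      linarith
    have h := hdet _ ρ (hρa.trans_lt ((min_le_left _ _).trans_lt (half_lt_self hr))) hN hρ0
    rw [hconj]
    refine le_min (h.trans ?_) (h.trans ?_)
    · calc K * ρ ≤ K * (1 / (2 * K)) := by
            gcongr
            exact hρa.trans (min_le_right _ _)
        _ = 1 / 2 := by field_simp
    · rw [mul_assoc]
      gcongr
  constructor
  · intro γ
    rw [friedFactor_eq, friedFactorAt]
    refine zpow_ne_zero _ fun h0 => ?_
    have h := (hest γ).trans (min_le_left _ _)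
    rw [h0] at h
    norm_num at h
  · refine Summable.of_nonneg_of_le (fun _ => norm_nonneg _) (fun γ => ?_)
      ((hsum.mul_left (K * C)).mul_left 2)
    rw [friedFactor_eq, friedFactorAt]
    refine (norm_zpow_neg_one_pow_sub_one_le ((hest γ).trans (min_le_left _ _)) _).trans ?_
    exact mul_le_mul_of_nonneg_left ((hest γ).trans (min_le_right _ _)) zero_le_two

/-- The closed trajectories of `Z` and of `-Z` are the same. -/
def primitiveOrbitNeg : PrimitiveOrbit Z ≃ PrimitiveOrbit (-Z) :=
  Equiv.subtypeEquivRight fun γ => by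
    have h : ∀ y : Y, Set.range (fun t : ℝ => flow (-Z) t y) = Set.range fun t => flow Z t y := by
      intro y
      simp only [flow_neg hZ]
      exact (Equiv.neg ℝ).surjective.range_comp fun t => flow Z t y
    simp only [periodicPoints_neg_field hZ, h]

/-- The points chosen for the orbit of Z and for that of -Z may differ, but lie on one trajectory;
invariance along the flow reduces to a single point. -/
theorem friedFactor_primitiveOrbitNeg (hA : IsAnosov Z) (σ : ℂ) (γ : PrimitiveOrbit Z) :
    friedFactor (-Z) (F.dual.tensorOrientation n) σ (primitiveOrbitNeg hZ γ) =
      friedFactor Z F σ γ ^ ((-1 : ℤ) ^ (n - 1)) := by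
  have hT := (isPeriod_period hZ (hA.isAnosovSplitting hZ).ne_zero γ.point_mem).2
  have hmem : γ.point ∈ (primitiveOrbitNeg hZ γ).1 := by
    change γ.point ∈ γ.1
    rw [γ.eq_range]
    exact ⟨0, flow_zero hZ _⟩
  rw [PrimitiveOrbit.eq_range] at hmem
  obtain ⟨t, ht⟩ := hmem
  have hne : ∀ y, (-Z) y ≠ 0 := ((hA.neg hZ).isAnosovSplitting (contMDiff_neg_field hZ)).ne_zero
  have hT' := (isPeriod_period (contMDiff_neg_field hZ) hne (primitiveOrbitNeg hZ γ).point_mem).2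
  rw [friedFactor_eq, friedFactor_eq, ← friedFactorAt_neg_dual hZ hA F σ hT, ← ht]
  exact (friedFactorAt_flow (contMDiff_neg_field hZ) (hA.neg hZ) _ σ hT' t).symm

end Zeta

end Fried

end

/-! ### The functional equation -/

theorem mainTheorem7 {n : ℕ} {Y : Type*} [TopologicalSpace Y]
    [ChartedSpace (EuclideanSpace ℝ (Fin n)) Y] [IsManifold (𝓡 n) ∞ Y]
    [T2Space Y] [CompactSpace Y] [ConnectedSpace Y]
    {V : Type*} [NormedAddCommGroup V] [NormedSpace ℂ V] [FiniteDimensional ℂ V] {ι : Type*}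
    (F : Fried.FlatVectorBundle Y V ι)
    (Z : (y : Y) → TangentSpace (𝓡 n) y)
    (hZ : ContMDiff (𝓡 n) (𝓡 n).tangent ∞ (fun y => (⟨y, Z y⟩ : TangentBundle (𝓡 n) Y)))
    (hA : Fried.IsAnosov Z) :
    ∃ c : ℝ, ∀ σ : ℂ, c < σ.re →
      Multipliable (Fried.friedFactor Z F σ) ∧
      Multipliable (Fried.friedFactor (-Z) (F.dual.tensorOrientation n) σ) ∧
      Fried.friedZeta (-Z) (F.dual.tensorOrientation n) σ ≠ 0 ∧
      Fried.friedZeta Z F σ =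
        Fried.friedZeta (-Z) (F.dual.tensorOrientation n) σ ^ ((-1 : ℤ) ^ (n - 1)) := by
  obtain ⟨c, hc⟩ := Fried.exists_summable_friedFactor_sub_one hZ F hA
  refine ⟨c, fun σ hσ => ?_⟩
  obtain ⟨hne, hsum⟩ := hc σ hσ
  have hone : Fried.friedFactor Z F σ = fun γ => 1 + (Fried.friedFactor Z F σ γ - 1) := by
    funext γ
    ring
  have hmul : Multipliable (Fried.friedFactor Z F σ) := by
    rw [hone]
    exact multipliable_one_add_of_summable hsum
  -- Nonvanishing of the infinite product, not only of its factors, is what allows inverting it term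
  -- by term.
  have hprod : ∏' γ, Fried.friedFactor Z F σ γ ≠ 0 := by
    rw [hone]
    refine tprod_one_add_ne_zero_of_summable (fun γ => ?_) hsum
    simpa using hne γ
  set k : ℤ := (-1) ^ (n - 1) with hk
  have hkk : k * k = 1 := by
    rw [hk, ← pow_add, ← two_mul, pow_mul]
    simp
  have hpow : HasProd (fun γ => Fried.friedFactor Z F σ γ ^ k)
      ((∏' γ, Fried.friedFactor Z F σ γ) ^ k) := by
    rcases neg_one_pow_eq_or ℤ (n - 1) with h | h
    · simpa [hk, h] using hmul.hasProd
    · simpa [hk, h] using hmul.hasProd.inv₀ hprod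
  -- Convergence for -Z is inherited through the bijection of trajectories, so the same c serves
  -- both products.
  have hneg : HasProd (Fried.friedFactor (-Z) (F.dual.tensorOrientation n) σ)
      ((∏' γ, Fried.friedFactor Z F σ γ) ^ k) := by
    rw [← (Fried.primitiveOrbitNeg hZ).hasProd_iff]
    convert hpow using 1
    funext γ
    exact Fried.friedFactor_primitiveOrbitNeg hZ F hA σ γ
  have hzeta : Fried.friedZeta (-Z) (F.dual.tensorOrientation n) σ =
      (∏' γ, Fried.friedFactor Z F σ γ) ^ k := hneg.tprod_eq
  refine ⟨hmul, hneg.multipliable, ?_, ?_⟩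
  · rw [hzeta]
    exact zpow_ne_zero _ hprod
  · rw [hzeta, ← zpow_mul, hkk, zpow_one]
    rfl
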